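/- Let $d\ge 1$, let $L\ge 4$ be even, and let $\Lambda_L=(\mathbb Z/L\mathbb Z)^d$ be the periodic box, identified with $\{x\in\mathbb Z^d:-\frac L2<x_i\le\frac L2\}$, with edge set $\mathcal E$ consisting of the unordered pairs of nearest neighbours. Let $\beta>0$, $u\in[0,\frac12]$, $\theta\in\{2,3,4,\dots\}$ and $S=\frac{\theta-1}2$, so that $\theta=2S+1$. Let $\rho_u$ be the law of a Poisson point process on $\mathcal E\times[0,\beta]$ of "crosses" with intensity $u$ and "double bars" with intensity $1-u$ (independent of each other). For a realization $\omega$, let $\mathcal L(\omega)$ be the set of loops in $\Lambda_L\times[0,\beta]_{\rm per}$: the loop through a space-time point (outside the support of $\omega$) is followed by moving vertically in the periodic time direction until an event at the current site is met; at a cross one goes across the edge and continues in the same vertical direction, at a double bar one goes across the edge and continues in the opposite vertical direction; loops are identified with their supports. Let $\mathbb P$ be the probability measure proportional to $\theta^{|\mathcal L(\omega)|}\,{\rm d}\rho_u(\omega)$, let $$\kappa(x,t)=\mathbb P\bigl((0,0)\text{ and }(x,t)\text{ belong to the same loop}\bigr),\qquad x\in\Lambda_L,\ t\in[0,\beta],$$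 and let $$\widetilde\kappa(k,\tau)=\sum_{x\in\Lambda_L}\int_0^\beta e^{-ikx-i\tau t}\,\kappa(x,t)\,{\rm d}t .$$ Let $\Lambda^*=\{k\in\frac{2\pi}L\mathbb Z^d:-\pi<k_i\le\pi,\ i=1,\dots,d\}$ and $\varepsilon(k)=2\sum_{i=1}^d(1-\cos k_i)$. Then for every $k\in\Lambda^*\setminus\{0\}$ the number $\widetilde\kappa(k,0)$ is real and $$\widetilde\kappa(k,0)\le\frac{2S+1}{\varepsilon(k)} .$$ -/

import Mathlib

open MeasureTheory
open scoped ENNReal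

noncomputable section

namespace RandomLoop

/-! ### Finite Poisson point processes -/

/-- Finite point configurations in `X`. -/
structure Configuration (X : Type*) where
  /-- the points of the configuration -/
  points : Finset X

/-- The configuration formed by the points `p 0, …, p (n - 1)`. -/
def Configuration.ofTuple {X : Type*} {n : ℕ} (p : Fin n → X) : Configuration X :=
  ⟨(Set.finite_range p).toFinset⟩

/-- The σ-algebra on configurations inherited from the σ-algebra of `X`: a set of configurations
is measurable when, for every `n`, its preimage in `Xⁿ` is. -/
instance {X : Type*} [MeasurableSpace X] : MeasurableSpace (Configuration X) :=
  ⨅ n : ℕ, MeasurableSpace.map (fun p : Fin n → X => Configuration.ofTuple p) inferInstance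

/-- The law of the Poisson point process with finite intensity measure `μ`: a Poisson number (of
mean `μ(X)`) of independent points with law `μ / μ(X)`, that is,
`∑ n, e^{-μ(X)} / n! · μ^{⊗ n}` forgetting the order of the points. -/
def poissonLaw {X : Type*} [MeasurableSpace X] (μ : Measure X) : Measure (Configuration X) :=
  Measure.sum fun n : ℕ =>
    (ENNReal.ofReal (Real.exp (-μ.real Set.univ)) / (n.factorial : ℝ≥0∞)) •
      Measure.map (fun p : Fin n → X => Configuration.ofTuple p) (Measure.pi fun _ => μ)

/-! ### The random loop model on a graph -/

/-- The two kinds of events of the Poisson process. -/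
inductive LinkKind
  | cross
  | doubleBar

/-- A mark of an event: the edge at which it occurs and its kind. -/
structure Mark {V : Type*} (G : SimpleGraph V) where
  edge : G.edgeSet
  kind : LinkKind

instance {V : Type*} (G : SimpleGraph V) : MeasurableSpace (Mark G) := ⊤

/-- An event: a mark together with the time at which it occurs. -/
abbrev Event {V : Type*} (G : SimpleGraph V) := Mark G × ℝ

/-- The intensity `u` of the crosses and `1 - u` of the double bars. -/
def rate (u : ℝ) : LinkKind → ℝ
  | .cross => u
  | .doubleBar => 1 - u

/-- The intensity measure on `{edges} × {cross, double bar} × [0, β]`. -/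
def intensity {V : Type*} (G : SimpleGraph V) (β u : ℝ) : Measure (Event G) :=
  (Measure.sum fun m : Mark G => ENNReal.ofReal (rate u m.kind) • Measure.dirac m).prod
    (volume.restrict (Set.Icc 0 β))

/-- The measure `ρ_u`: independent Poisson point processes on `{edges} × [0, β]`, of intensity `u`
for the crosses and `1 - u` for the double bars. -/
def poissonMeasure {V : Type*} (G : SimpleGraph V) (β u : ℝ) : Measure (Configuration (Event G)) :=
  poissonLaw (intensity G β u)

section Loops

variable {V : Type*} {G : SimpleGraph V}

/-- There is an event of `ω` of the given kind at the edge `{x, y}` and at time `t`, where times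
are understood modulo `β`. -/
def HasLink (β : ℝ) (ω : Configuration (Event G)) (kind : LinkKind) (x y : V)
    (t : AddCircle β) : Prop :=
  ∃ a ∈ ω.points, a.1.kind = kind ∧ (a.1.edge : Sym2 V) = s(x, y) ∧ ((a.2 : ℝ) : AddCircle β) = t

/-- The space-time point `p = (x, t)` is in the support of `ω`: some event of `ω` occurs at time
`t` at an edge that contains `x`. -/
def InSupport (β : ℝ) (ω : Configuration (Event G)) (p : V × AddCircle β) : Prop :=
  ∃ kind y, HasLink β ω kind p.1 y p.2

/-- The time at (signed) distance `s` from `t` in the vertical direction `δ = ±1`. -/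
def shift {β : ℝ} (t : AddCircle β) (δ : ℤˣ) (s : ℝ) : AddCircle β :=
  t + ((((δ : ℤ) : ℝ) * s : ℝ) : AddCircle β)

/-- The motion along the loops of `ω`. A state `(x, t, δ)` is a space-time point together with a
vertical direction (`δ = 1` is up, `δ = -1` is down). -/
inductive Move (β : ℝ) (ω : Configuration (Event G)) :
    V × AddCircle β × ℤˣ → V × AddCircle β × ℤˣ → Prop
  /-- Travel vertically as long as no event is met. -/
  | travel (x : V) (t : AddCircle β) (δ : ℤˣ) (s : ℝ) (hs : 0 ≤ s)
      (free : ∀ r ∈ Set.Icc 0 s, ¬ InSupport β ω (x, shift t δ r)) :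
      Move β ω (x, t, δ) (x, shift t δ s, δ)
  /-- When a cross is met (at time `t`), go across and continue in the same direction. -/
  | cross (x y : V) (t : AddCircle β) (δ : ℤˣ) (h : ℝ) (hh : 0 < h)
      (link : HasLink β ω LinkKind.cross x y t)
      (free : ∀ r ∈ Set.Ioc 0 h,
        ¬ InSupport β ω (x, shift t δ (-r)) ∧ ¬ InSupport β ω (y, shift t δ r)) :
      Move β ω (x, shift t δ (-h), δ) (y, shift t δ h, δ)
  /-- When a double bar is met (at time `t`), go across and continue in the opposite direction. -/
  | doubleBar (x y : V) (t : AddCircle β) (δ : ℤˣ) (h : ℝ) (hh : 0 < h)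
      (link : HasLink β ω LinkKind.doubleBar x y t)
      (free : ∀ r ∈ Set.Ioc 0 h,
        ¬ InSupport β ω (x, shift t δ (-r)) ∧ ¬ InSupport β ω (y, shift t δ (-r))) :
      Move β ω (x, shift t δ (-h), δ) (y, shift t δ (-h), -δ)

/-- The loop that contains `p`, identified with its support: the set of all points that are visited
by the trajectory that starts at `p` and moves up. -/
def loopThrough (β : ℝ) (ω : Configuration (Event G)) (p : V × AddCircle β) :
    Set (V × AddCircle β) :=
  {q | ∃ δ : ℤˣ, Relation.ReflTransGen (Move β ω) (p.1, p.2, 1) (q.1, q.2, δ)}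

/-- The set `ℒ(ω)` of the loops of `ω`. -/
def loops (β : ℝ) (ω : Configuration (Event G)) : Set (Set (V × AddCircle β)) :=
  {ℓ | ∃ p, ¬ InSupport β ω p ∧ ℓ = loopThrough β ω p}

/-- The number `|ℒ(ω)|` of loops. -/
def numLoops (β : ℝ) (ω : Configuration (Event G)) : ℕ := (loops β ω).ncard

variable (G)

/-- The event `E_{x,y,t}` that `(x, 0)` and `(y, t)` belong to the same loop. -/
def connected (β : ℝ) (x y : V) (t : ℝ) : Set (Configuration (Event G)) :=
  {ω | ∃ ℓ ∈ loops β ω, (x, (0 : AddCircle β)) ∈ ℓ ∧ (y, (t : AddCircle β)) ∈ ℓ}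

/-- The partition function `Y = ∫ θ^{|ℒ(ω)|} dρ_u(ω)`. -/
def partitionFunction (β u θ : ℝ) : ℝ≥0∞ :=
  ∫⁻ ω, ENNReal.ofReal θ ^ numLoops β ω ∂(poissonMeasure G β u)

/-- The law `Y⁻¹ θ^{|ℒ(ω)|} dρ_u(ω)` of the random loop model. -/
def loopMeasure (β u θ : ℝ) : Measure (Configuration (Event G)) :=
  (partitionFunction G β u θ)⁻¹ •
    (poissonMeasure G β u).withDensity fun ω => ENNReal.ofReal θ ^ numLoops β ω

end Loops

/-! ### The periodic box -/

/-- The box `Λ_L = (ℤ / Lℤ)^d` with edges between nearest neighbours. -/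
def torus (d L : ℕ) : SimpleGraph (Fin d → ZMod L) :=
  SimpleGraph.fromRel fun x y => ∃ i, y = x + Pi.single i 1

/-- The loop correlation `κ(x, t) = ℙ(E_{0,x,t})` in the box `Λ_L`. -/
def kappa (d L : ℕ) (β u θ : ℝ) (x : Fin d → ZMod L) (t : ℝ) : ℝ :=
  (loopMeasure (torus d L) β u θ).real (connected (torus d L) β 0 x t)

/-- The product `k x = ∑ k_i x_i`, where `x ∈ Λ_L` is represented by the integer vector with
coordinates in `(-L/2, L/2]`. -/
def pairing {d L : ℕ} (k : Fin d → ℝ) (x : Fin d → ZMod L) : ℝ :=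
  ∑ i, k i * ((x i).valMinAbs : ℝ)

/-- The space-time Fourier transform
`κ̃(k, τ) = ∑_{x ∈ Λ_L} ∫_0^β e^{-i k x - i τ t} κ(x, t) dt`. -/
def kappaTilde (d L : ℕ) [NeZero L] (β u θ : ℝ) (k : Fin d → ℝ) (τ : ℝ) : ℂ :=
  ∑ x : Fin d → ZMod L, ∫ t in (0 : ℝ)..β,
    Complex.exp (-Complex.I * (pairing k x : ℂ) - Complex.I * (τ : ℂ) * (t : ℂ)) *
      (kappa d L β u θ x t : ℂ)

/-- The dual torus `Λ* = {k ∈ (2π/L) ℤ^d : -π < k_i ≤ π}`. -/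
def dualTorus (d L : ℕ) : Set (Fin d → ℝ) :=
  {k | ∀ i, (∃ n : ℤ, k i = 2 * Real.pi / L * n) ∧ -Real.pi < k i ∧ k i ≤ Real.pi}

/-- The dispersion relation `ε(k) = 2 ∑ (1 - cos k_i)`. -/
def dispersion {d : ℕ} (k : Fin d → ℝ) : ℝ := 2 * ∑ i, (1 - Real.cos (k i))

end RandomLoop

end

namespace RandomLoop

open Filter Topology NormedSpace

/-! ### The exponential in a Banach algebra -/

section BanachAlgebra

variable {𝔸 : Type*} [NormedRing 𝔸] [NormedAlgebra ℝ 𝔸] [CompleteSpace 𝔸] [NormOneClass 𝔸]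

/-! The weight θ^{|𝓛|} counts the colourings of the loops with θ colours. Cut at the events, such a
colouring is a closed path of spin configurations, so the loop model is the expansion of tr e^{βH}
for the spin operator H = `loopGenerator`, in which a cross acts on an edge by Σ E_ac ⊗ E_ca and a
double bar by Σ E_ac ⊗ E_ac (`sum_marks_pow_card`, `partitionFunction_eq`). Let w be a function of
the colours with Σ w = 0 and let W = diag w. Different loops are coloured independently, so tr(W_x
H^j W_y H^{n-j}) retains only the configurations that connect the two points
(`sum_marks_two_point`). Integrated over time, κ is therefore a multiple of the Duhamel two-point
function of W (`integral_loopMeasure_connected`), which is the second derivative of a trace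
(`tsum_le_of_trace_exp_le`).

That derivative is bounded by reflection positivity. A field v adds -(v_x - v_y)(W_x - W_y) -
½|w|²(v_x - v_y)² to each bond. For u ≤ 1/2 a bond cut by a reflection is a sum of products of the
same real operators on the two sides, the field entering as a shift, plus one-sided terms
(`bond_eq_sum_bondTerm`). The trace of exp(A ⊗ 1 + 1 ⊗ B + Σ C_i ⊗ E_i) is a limit of sums of
products of one trace per side, so Cauchy–Schwarz applies (`trace_exp_twoSided_sq_le`), and
reflecting an extremal field gives Gaussian domination Z(v) ≤ Z(0) (`fieldPartition_le`).

After summation by parts (`generator_eq`) the field acts through its Laplacian Δv. Expanding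
Gaussian domination to second order gives Σ Δv(x) Δv(y) K(x,y) ≤ θ Σ v Δv, where K is the
correlation integrated over time (`sum_laplacian_mul_pairCorrelation_le`). The functions cos kx and
sin kx satisfy Δv = ε(k) v; adding their two bounds yields ε² |Λ| κ̃ ≤ θ ε |Λ|. Inversion symmetry
makes κ̃ real.

Loops are defined as subsets of a continuous space-time. Almost surely the events have distinct
times inside (0, β); the number of loops then depends only on the ordered list of marks, and the
connection of (x, 0) with (y, s) only on that list and on the slot of s (`Ordered.numLoops_eq`,
`Ordered.mem_connected_iff`). A uniform s has each of the n + 1 possible ranks among n uniform times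
with equal weight (`lintegral_rankOf`), which produces the factor 1/(n+1)! of the Duhamel series. -/

theorem norm_pow_sub_pow_le (x y : 𝔸) (c : ℝ) (hx : ‖x‖ ≤ c) (hy : ‖y‖ ≤ c) (n : ℕ) :
    ‖x ^ (n + 1) - y ^ (n + 1)‖ ≤ (n + 1) * c ^ n * ‖x - y‖ := by
  have hc : 0 ≤ c := (norm_nonneg _).trans hx
  induction n with
  | zero => simp
  | succ n ih =>
    have : x ^ (n + 1 + 1) - y ^ (n + 1 + 1)
        = x * (x ^ (n + 1) - y ^ (n + 1)) + (x - y) * y ^ (n + 1) := by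
      rw [pow_succ' x (n + 1), pow_succ' y (n + 1)]; noncomm_ring
    rw [this]
    calc _ ≤ ‖x‖ * ‖x ^ (n + 1) - y ^ (n + 1)‖ + ‖x - y‖ * ‖y‖ ^ (n + 1) := by
          refine (norm_add_le _ _).trans (add_le_add (norm_mul_le _ _) ?_)
          exact (norm_mul_le _ _).trans (by gcongr; exact norm_pow_le _ _)
      _ ≤ c * ((n + 1) * c ^ n * ‖x - y‖) + ‖x - y‖ * c ^ (n + 1) := by gcongr
      _ = _ := by push_cast; ring

theorem norm_exp_le (x : 𝔸) : ‖exp x‖ ≤ Real.exp ‖x‖ := by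
  rw [← (exp_series_hasSum_exp' (𝕂 := ℝ) x).tsum_eq, Real.exp_eq_exp_ℝ,
    ← (exp_series_hasSum_exp' (𝕂 := ℝ) ‖x‖).tsum_eq]
  refine tsum_of_norm_bounded (exp_series_hasSum_exp' (𝕂 := ℝ) ‖x‖).summable.hasSum fun n => ?_
  rw [norm_smul, norm_inv, Real.norm_natCast, smul_eq_mul]
  gcongr
  exact norm_pow_le _ _

/-- Each factor differs from exp(K/n) by o(1/n), and both have norm at most exp(c/n), so the n-th
powers differ by o(1). The term R is there to absorb the product A ⊗ B in (1 + A/n) ⊗ (1 + B/n). -/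
theorem tendsto_one_add_pow_exp (K R : 𝔸) :
    Tendsto (fun n : ℕ => (1 + ((n : ℝ)⁻¹) • K + ((n : ℝ)⁻¹) ^ 2 • R) ^ n) atTop (𝓝 (exp K)) := by
  set c : ℝ := ‖K‖ + ‖R‖ with hcdef
  have hc : 0 ≤ c := by positivity
  have hinv : Tendsto (fun n : ℕ => ((n : ℝ)⁻¹)) atTop (𝓝 0) := tendsto_inv_atTop_nhds_zero_nat
  -- first order expansion of the exponential
  have hlittle : Tendsto (fun n : ℕ => (n : ℝ) *
      ‖(1 + ((n : ℝ)⁻¹) • K + ((n : ℝ)⁻¹) ^ 2 • R) - exp (((n : ℝ)⁻¹) • K)‖) atTop (𝓝 0) := by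
    have h1 : HasDerivAt (fun s : ℝ => exp (s • K)) K 0 := by
      have := hasDerivAt_exp_smul_const (𝕂 := ℝ) K (0 : ℝ)
      simpa using this
    have h2 := hasDerivAt_iff_tendsto_slope.1 h1
    have h3 : Tendsto (fun n : ℕ => ((n : ℝ)⁻¹)) atTop (𝓝[≠] 0) := by
      refine tendsto_nhdsWithin_iff.2 ⟨hinv, ?_⟩
      filter_upwards [eventually_gt_atTop 0] with n hn
      simp; omega
    have h4 := h2.comp h3
    have h5 : Tendsto (fun n : ℕ => ‖K - slope (fun s : ℝ => exp (s • K)) 0 ((n : ℝ)⁻¹)‖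
        + (n : ℝ)⁻¹ * ‖R‖) atTop (𝓝 0) := by
      have := ((tendsto_const_nhds (x := K)).sub h4).norm.add (hinv.mul_const ‖R‖)
      simpa using this
    refine squeeze_zero' (Eventually.of_forall fun n => by positivity) ?_ h5
    filter_upwards [eventually_gt_atTop 0] with n hn
    have hn' : (0 : ℝ) < n := by exact_mod_cast hn
    have : (1 + ((n : ℝ)⁻¹) • K + ((n : ℝ)⁻¹) ^ 2 • R) - exp (((n : ℝ)⁻¹) • K)
        = ((n : ℝ)⁻¹) • ((K - slope (fun s : ℝ => exp (s • K)) 0 ((n : ℝ)⁻¹))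
          + ((n : ℝ)⁻¹) • R) := by
      rw [slope_def_module]
      simp only [sub_zero, zero_smul, exp_zero, inv_inv, smul_add, smul_sub, smul_smul]
      rw [inv_mul_cancel₀ hn'.ne', one_smul, one_smul, pow_two]
      abel
    rw [this, norm_smul, norm_inv, Real.norm_natCast, mul_inv_cancel_left₀ hn'.ne']
    refine (norm_add_le _ _).trans ?_
    rw [norm_smul, norm_inv, Real.norm_natCast]
  have hlim : Tendsto (fun n : ℕ => Real.exp c * ((n : ℝ) *
      ‖(1 + ((n : ℝ)⁻¹) • K + ((n : ℝ)⁻¹) ^ 2 • R) - exp (((n : ℝ)⁻¹) • K)‖)) atTop (𝓝 0) := by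
    simpa using hlittle.const_mul (Real.exp c)
  refine tendsto_iff_norm_sub_tendsto_zero.2 (squeeze_zero'
    (Eventually.of_forall fun n => norm_nonneg _) ?_ hlim)
  filter_upwards [eventually_gt_atTop 0] with n hn
  obtain ⟨m, rfl⟩ : ∃ m, n = m + 1 := ⟨n - 1, by omega⟩
  have hn' : (0 : ℝ) < ((m + 1 : ℕ) : ℝ) := by positivity
  have hn1 : (1 : ℝ) ≤ ((m + 1 : ℕ) : ℝ) := by push_cast; linarith [(Nat.cast_nonneg m : (0:ℝ) ≤ m)]
  set r : ℝ := (((m + 1 : ℕ) : ℝ)⁻¹) with hr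
  have hr0 : 0 ≤ r := by positivity
  have hr1 : r ≤ 1 := inv_le_one_of_one_le₀ hn1
  have hexp : exp K = exp (r • K) ^ (m + 1) := by
    let _ : NormedAlgebra ℚ 𝔸 := NormedAlgebra.restrictScalars ℚ ℝ 𝔸
    rw [← exp_nsmul, ← Nat.cast_smul_eq_nsmul ℝ, smul_smul, hr, mul_inv_cancel₀ hn'.ne', one_smul]
  rw [hexp]
  have hb1 : ‖1 + r • K + r ^ 2 • R‖ ≤ Real.exp (r * c) := by
    calc _ ≤ ‖(1 : 𝔸)‖ + ‖r • K‖ + ‖r ^ 2 • R‖ := norm_add₃_le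
      _ ≤ 1 + r * ‖K‖ + r * ‖R‖ := by
          rw [norm_one, norm_smul, norm_smul, Real.norm_of_nonneg hr0,
            Real.norm_of_nonneg (by positivity)]
          gcongr
          nlinarith
      _ = r * c + 1 := by rw [hcdef]; ring
      _ ≤ _ := Real.add_one_le_exp _
  have hb2 : ‖exp (r • K)‖ ≤ Real.exp (r * c) := by
    refine (norm_exp_le (r • K)).trans ?_
    refine Real.exp_le_exp.2 ?_
    rw [norm_smul, Real.norm_of_nonneg hr0]
    gcongr
    rw [hcdef]; linarith [norm_nonneg R]
  refine (norm_pow_sub_pow_le _ _ _ hb1 hb2 m).trans ?_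
  have hpow : Real.exp (r * c) ^ m ≤ Real.exp c := by
    rw [← Real.exp_nat_mul]
    refine Real.exp_le_exp.2 ?_
    rw [← mul_assoc]
    have : (m : ℝ) * r ≤ 1 := by
      rw [hr, ← div_eq_mul_inv, div_le_one hn']; push_cast; linarith
    nlinarith
  push_cast
  calc _ = ((m : ℝ) + 1) * ‖1 + r • K + r ^ 2 • R - exp (r • K)‖ * Real.exp (r * c) ^ m := by ring
    _ ≤ ((m : ℝ) + 1) * ‖1 + r • K + r ^ 2 • R - exp (r • K)‖ * Real.exp c := by gcongr
    _ = _ := by ring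

/-- The derivative at `s` of `exp (X + s Y)`, as a series. -/
noncomputable def expDeriv (X Y : 𝔸) (s : ℝ) : 𝔸 :=
  ∑' n : ℕ, ((n + 1).factorial : ℝ)⁻¹ •
    ∑ i ∈ Finset.range (n + 1), (X + s • Y) ^ (n - i) * Y * (X + s • Y) ^ i

theorem norm_expDeriv_term_le (Z Y : 𝔸) (C : ℝ) (hZ : ‖Z‖ ≤ C) (n : ℕ) :
    ‖((n + 1).factorial : ℝ)⁻¹ • ∑ i ∈ Finset.range (n + 1), Z ^ (n - i) * Y * Z ^ i‖
      ≤ ‖Y‖ * (C ^ n / n.factorial) := by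
  have hC : 0 ≤ C := (norm_nonneg _).trans hZ
  rw [norm_smul, norm_inv, Real.norm_natCast]
  have h : ‖∑ i ∈ Finset.range (n + 1), Z ^ (n - i) * Y * Z ^ i‖ ≤ (n + 1) * (C ^ n * ‖Y‖) := by
    refine (norm_sum_le _ _).trans ((Finset.sum_le_card_nsmul _ _ (C ^ n * ‖Y‖) ?_).trans ?_)
    · intro i hi
      have hi' : i ≤ n := by simpa [Nat.lt_succ_iff] using hi
      calc _ ≤ ‖Z‖ ^ (n - i) * ‖Y‖ * ‖Z‖ ^ i := by
            refine (norm_mul_le _ _).trans ?_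
            gcongr
            · exact (norm_mul_le _ _).trans (by gcongr; exact norm_pow_le _ _)
            · exact norm_pow_le _ _
        _ ≤ C ^ (n - i) * ‖Y‖ * C ^ i := by gcongr
        _ = C ^ (n - i + i) * ‖Y‖ := by rw [pow_add]; ring
        _ = _ := by rw [Nat.sub_add_cancel hi']
    · simp [nsmul_eq_mul]
  calc _ ≤ ((n + 1).factorial : ℝ)⁻¹ * ((n + 1) * (C ^ n * ‖Y‖)) := by gcongr
    _ = _ := by
      rw [Nat.factorial_succ]; push_cast
      have : (n.factorial : ℝ) ≠ 0 := by positivity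
      field_simp

theorem summable_expDeriv (X Y : 𝔸) (s : ℝ) :
    Summable fun n : ℕ => ((n + 1).factorial : ℝ)⁻¹ •
      ∑ i ∈ Finset.range (n + 1), (X + s • Y) ^ (n - i) * Y * (X + s • Y) ^ i :=
  Summable.of_norm_bounded ((Real.summable_pow_div_factorial _).mul_left ‖Y‖)
    fun n => norm_expDeriv_term_le _ Y _ le_rfl n

/-- X and Y need not commute, so the exponential series is differentiated term by term. On the unit
ball ‖X + sY‖ ≤ ‖X‖ + ‖Y‖, which makes the majorant summable and independent of s. -/
theorem hasDerivAt_exp_add_smul (X Y : 𝔸) {s : ℝ} (hs : s ∈ Metric.ball (0 : ℝ) 1) :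
    HasDerivAt (fun s : ℝ => exp (X + s • Y)) (expDeriv X Y s) s := by
  have hfun : (fun s : ℝ => exp (X + s • Y))
      = fun s : ℝ => 1 + ∑' n : ℕ, ((n + 1).factorial : ℝ)⁻¹ • (X + s • Y) ^ (n + 1) := by
    funext s
    have h := exp_series_hasSum_exp' (𝕂 := ℝ) (X + s • Y)
    refine h.tsum_eq.symm.trans (h.summable.tsum_eq_zero_add.trans ?_)
    rw [pow_zero, Nat.factorial_zero, Nat.cast_one, inv_one, one_smul]
  rw [hfun]
  refine HasDerivAt.const_add (1 : 𝔸) ?_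
  have hb : ∀ s ∈ Metric.ball (0 : ℝ) 1, ‖X + s • Y‖ ≤ ‖X‖ + ‖Y‖ := by
    intro s hs
    refine (norm_add_le _ _).trans ?_
    rw [norm_smul]
    have : ‖s‖ ≤ 1 := by simpa using (Metric.mem_ball.1 hs).le
    gcongr
    nlinarith [norm_nonneg Y]
  refine hasDerivAt_tsum_of_isPreconnected (t := Metric.ball (0 : ℝ) 1)
    (g := fun (n : ℕ) (s : ℝ) => ((n + 1).factorial : ℝ)⁻¹ • (X + s • Y) ^ (n + 1))
    (g' := fun (n : ℕ) (s : ℝ) => ((n + 1).factorial : ℝ)⁻¹ •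
      ∑ i ∈ Finset.range (n + 1), (X + s • Y) ^ (n - i) * Y * (X + s • Y) ^ i)
    (u := fun n => ‖Y‖ * ((‖X‖ + ‖Y‖) ^ n / n.factorial)) (y₀ := 0)
    ((Real.summable_pow_div_factorial _).mul_left _) Metric.isOpen_ball
    (convex_ball _ _).isPreconnected ?_ ?_ (by simp) ?_ hs
  · intro n y _
    have h1 : HasDerivAt (fun s : ℝ => X + s • Y) Y y := by
      simpa using ((hasDerivAt_id y).smul_const Y).const_add X
    exact (h1.fun_pow' (n + 1)).const_smul (((n + 1).factorial : ℝ)⁻¹)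
  · intro n y hy
    exact norm_expDeriv_term_le _ Y _ (hb y hy) n
  · have h := exp_series_hasSum_exp' (𝕂 := ℝ) (X + (0 : ℝ) • Y)
    exact (summable_nat_add_iff
      (f := fun n : ℕ => ((n.factorial : ℝ)⁻¹) • (X + (0 : ℝ) • Y) ^ n) 1).2 h.summable

/-- With a negative second derivative, 0 would be a local maximum as well as a minimum; then g would
vanish near 0, and its second derivative with it. -/
theorem nonneg_of_hasDerivAt_of_nonneg {g g' : ℝ → ℝ} {g₂ : ℝ} (h0 : g 0 = 0) (hg : ∀ s, 0 ≤ g s)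
    (hd : ∀ s ∈ Metric.ball (0 : ℝ) 1, HasDerivAt g (g' s) s) (hd' : HasDerivAt g' g₂ 0) :
    0 ≤ g₂ := by
  by_contra! hneg
  have hd0 : HasDerivAt g (g' 0) 0 := hd 0 (by simp)
  have hev : deriv g =ᶠ[𝓝 0] g' := by
    filter_upwards [Metric.ball_mem_nhds (0 : ℝ) one_pos] with s hs using (hd s hs).deriv
  have hmin : IsLocalMin g 0 := Eventually.of_forall fun s => by simpa [h0] using hg s
  have hmax : IsLocalMax g 0 := by
    refine isLocalMax_of_deriv_deriv_neg ?_ hmin.deriv_eq_zero hd0.continuousAt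
    rw [hev.deriv_eq, hd'.deriv]; exact hneg
  have hz : g =ᶠ[𝓝 0] fun _ => 0 := by
    filter_upwards [hmax] with s hs
    exact le_antisymm (by simpa [h0] using hs) (hg s)
  have h2 : g' =ᶠ[𝓝 0] fun _ => 0 := by
    have := hz.deriv
    filter_upwards [hev, this] with s hs hs'
    rw [← hs, hs']; simp
  have := (hd'.congr_of_eventuallyEq h2.symm).unique (hasDerivAt_const 0 0)
  exact hneg.ne this

/-- Second order expansion of a trace inequality. -/
theorem tsum_le_of_trace_exp_le (T : 𝔸 →L[ℝ] ℝ) (hT : ∀ a b, T (a * b) = T (b * a)) (X Y : 𝔸)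
    (c : ℝ) (h : ∀ s : ℝ, T (exp (X + s • Y)) ≤ Real.exp (c * s ^ 2 / 2) * T (exp X)) :
    ∑' n : ℕ, ((n + 1).factorial : ℝ)⁻¹ *
      ∑ i ∈ Finset.range (n + 1), T (Y * X ^ i * Y * X ^ (n - i)) ≤ c * T (exp X) := by
  set F : ℝ := T (exp X)
  -- Cyclicity of `T` makes the n + 1 summands of each term equal, so the first derivative contains
  -- a plain exponential and can be differentiated by the same rule.
  have hd1 : ∀ s ∈ Metric.ball (0 : ℝ) 1,
      HasDerivAt (fun s : ℝ => T (exp (X + s • Y))) (T (Y * exp (X + s • Y))) s := by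
    intro s hs
    have h1 := T.hasFDerivAt.comp_hasDerivAt s (hasDerivAt_exp_add_smul X Y hs)
    convert! h1 using 1
    rw [expDeriv, T.map_tsum (summable_expDeriv X Y s)]
    have h2 := exp_series_hasSum_exp' (𝕂 := ℝ) (X + s • Y)
    rw [← h2.tsum_eq, ← h2.summable.tsum_mul_left, T.map_tsum (h2.summable.mul_left Y)]
    congr 1
    funext n
    rw [mul_smul_comm, map_smul, map_smul, map_sum, Finset.sum_congr rfl (g := fun _ =>
      T (Y * (X + s • Y) ^ n))]
    · rw [Finset.sum_const, Finset.card_range, Nat.factorial_succ, nsmul_eq_mul, smul_eq_mul,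
        smul_eq_mul]
      push_cast
      have : (n.factorial : ℝ) ≠ 0 := by positivity
      field_simp
    · intro i hi
      have hi' : i ≤ n := by simpa [Nat.lt_succ_iff] using hi
      rw [mul_assoc, hT, mul_assoc, ← pow_add, Nat.add_sub_cancel' hi']
  have hd2 : HasDerivAt (fun s : ℝ => T (Y * exp (X + s • Y))) (T (Y * expDeriv X Y 0)) 0 :=
    T.hasFDerivAt.comp_hasDerivAt (0 : ℝ)
      ((hasDerivAt_exp_add_smul X Y (by simp)).const_mul Y)
  -- This is the Duhamel function ∫₀¹ T(Y e^{tX} Y e^{(1-t)X}) dt as a series, because ∫₀¹ t^i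
  -- (1-t)^{n-i} dt = i! (n-i)! / (n+1)!.
  have hval : T (Y * expDeriv X Y 0) = ∑' n : ℕ, ((n + 1).factorial : ℝ)⁻¹ *
      ∑ i ∈ Finset.range (n + 1), T (Y * X ^ i * Y * X ^ (n - i)) := by
    have hs := summable_expDeriv X Y 0
    rw [expDeriv, ← hs.tsum_mul_left, T.map_tsum (hs.mul_left Y)]
    congr 1
    funext n
    rw [mul_smul_comm, map_smul, Finset.mul_sum, map_sum, smul_eq_mul,
      ← Finset.sum_range_reflect]
    congr 1
    refine Finset.sum_congr rfl fun i hi => ?_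
    have hi' : i ≤ n := by simpa [Nat.lt_succ_iff] using hi
    simp only [zero_smul, add_zero]
    rw [show n + 1 - 1 - i = n - i by omega, show n - (n - i) = i by omega]
    simp only [mul_assoc]
  rw [← hval]
  have hg : ∀ s : ℝ, HasDerivAt (fun s : ℝ => Real.exp (c * s ^ 2 / 2) * F)
      (Real.exp (c * s ^ 2 / 2) * (c * s) * F) s := by
    intro s
    have h1 : HasDerivAt (fun s : ℝ => c * s ^ 2 / 2) (c * s) s := by
      convert! (((hasDerivAt_pow 2 s).const_mul c).div_const 2) using 1
      norm_num; ring
    exact h1.exp.mul_const F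
  have hg2 : HasDerivAt (fun s : ℝ => Real.exp (c * s ^ 2 / 2) * (c * s) * F) (c * F) 0 := by
    have h1 : HasDerivAt (fun s : ℝ => c * s ^ 2 / 2) (c * 0) 0 := by
      convert! (((hasDerivAt_pow 2 (0 : ℝ)).const_mul c).div_const 2) using 1
      norm_num
    have h2 : HasDerivAt (fun s : ℝ => c * s) c 0 := by
      simpa using (hasDerivAt_id (0 : ℝ)).const_mul c
    convert! (h1.exp.mul h2).mul_const F using 1
    simp
  have := nonneg_of_hasDerivAt_of_nonneg
    (g := fun s => Real.exp (c * s ^ 2 / 2) * F - T (exp (X + s • Y)))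
    (by simp [F]) (fun s => sub_nonneg.2 (h s)) (fun s hs => (hg s).sub (hd1 s hs)) (hg2.sub hd2)
  linarith

end BanachAlgebra

/-! ### Reflection positivity of traces -/

section Kronecker

open scoped Kronecker

variable {m ι : Type*} [Fintype m] [DecidableEq m] [Fintype ι]

theorem sum_kronecker_pow (X Y : ι → Matrix m m ℝ) (n : ℕ) :
    (∑ i, X i ⊗ₖ Y i) ^ n = ∑ s : Fin n → ι,
      (List.ofFn fun j => X (s j)).prod ⊗ₖ (List.ofFn fun j => Y (s j)).prod := by
  induction n with
  | zero => simp
  | succ n ih =>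
    rw [pow_succ', ih, Finset.sum_mul_sum, ← Finset.sum_product',
      ← (Fin.consEquiv fun _ : Fin (n + 1) => ι).sum_comp]
    refine Finset.sum_congr rfl fun p _ => ?_
    simp [Fin.consEquiv, List.ofFn_succ, Matrix.mul_kronecker_mul]

/-- The two tensor factors interact only through the common word `s`; for a fixed word the trace
factorizes. -/
theorem trace_sum_kronecker_pow (X Y : ι → Matrix m m ℝ) (n : ℕ) :
    ((∑ i, X i ⊗ₖ Y i) ^ n).trace = ∑ s : Fin n → ι,
      (List.ofFn fun j => X (s j)).prod.trace * (List.ofFn fun j => Y (s j)).prod.trace := by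
  rw [sum_kronecker_pow, Matrix.trace_sum]
  simp_rw [Matrix.trace_kronecker]

/-- The two-sided generator `A ⊗ 1 + 1 ⊗ B + ∑ C i ⊗ E i`. -/
noncomputable def twoSided (A : Matrix m m ℝ) (C : ι → Matrix m m ℝ) (B : Matrix m m ℝ)
    (E : ι → Matrix m m ℝ) : Matrix (m × m) (m × m) ℝ :=
  A ⊗ₖ 1 + 1 ⊗ₖ B + ∑ i, C i ⊗ₖ E i

/-- The sum is the trace of the n-th power of (1 + A/n) ⊗ (1 + B/n) + n⁻¹ Σ C_i ⊗ E_i, that is 1 +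
K/n + A ⊗ B/n² with K = `twoSided A C B E`. The square roots share 1/n between the sides, so equal
data on the two sides give a sum of squares. -/
theorem tendsto_trace_twoSided [Nonempty m] (A : Matrix m m ℝ) (C : ι → Matrix m m ℝ)
    (B : Matrix m m ℝ) (E : ι → Matrix m m ℝ) :
    Tendsto (fun n : ℕ => ∑ s : Fin n → Option ι,
      (List.ofFn fun j => (s j).elim (1 + (n : ℝ)⁻¹ • A) fun i => √((n : ℝ)⁻¹) • C i).prod.trace *
      (List.ofFn fun j => (s j).elim (1 + (n : ℝ)⁻¹ • B) fun i => √((n : ℝ)⁻¹) • E i).prod.trace)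
      atTop (𝓝 (exp (twoSided A C B E)).trace) := by
  let _ : NormedRing (Matrix (m × m) (m × m) ℝ) := Matrix.linftyOpNormedRing
  let _ : NormedAlgebra ℝ (Matrix (m × m) (m × m) ℝ) := Matrix.linftyOpNormedAlgebra
  have : NormOneClass (Matrix (m × m) (m × m) ℝ) := Matrix.linfty_opNormOneClass
  have h := tendsto_one_add_pow_exp (twoSided A C B E) (A ⊗ₖ B)
  have hc : Continuous fun M : Matrix (m × m) (m × m) ℝ => M.trace := by fun_prop
  refine ((hc.tendsto _).comp h).congr fun n => ?_
  simp only [Function.comp]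
  rw [← trace_sum_kronecker_pow
    (fun o : Option ι => o.elim (1 + (n : ℝ)⁻¹ • A) fun i => √((n : ℝ)⁻¹) • C i)
    (fun o : Option ι => o.elim (1 + (n : ℝ)⁻¹ • B) fun i => √((n : ℝ)⁻¹) • E i)]
  congr 2
  rw [Fintype.sum_option]
  simp only [Option.elim]
  have hs : ∀ i, (√((n : ℝ)⁻¹) • C i) ⊗ₖ (√((n : ℝ)⁻¹) • E i) = (n : ℝ)⁻¹ • (C i ⊗ₖ E i) := by
    intro i
    rw [Matrix.smul_kronecker, Matrix.kronecker_smul, smul_smul,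
      Real.mul_self_sqrt (by positivity)]
  simp_rw [hs, ← Finset.smul_sum]
  rw [Matrix.add_kronecker, Matrix.kronecker_add, Matrix.kronecker_add, Matrix.one_kronecker_one,
    Matrix.smul_kronecker, Matrix.smul_kronecker, Matrix.kronecker_smul, Matrix.kronecker_smul,
    smul_smul, twoSided, ← pow_two]
  simp only [smul_add]
  abel

theorem trace_exp_twoSided_self_nonneg [Nonempty m] (A : Matrix m m ℝ) (C : ι → Matrix m m ℝ) :
    0 ≤ (exp (twoSided A C A C)).trace :=
  ge_of_tendsto' (tendsto_trace_twoSided A C A C)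
    fun _ => Finset.sum_nonneg fun _ _ => mul_self_nonneg _

/-- Reflection positivity, in the form of a Cauchy–Schwarz inequality. -/
theorem trace_exp_twoSided_sq_le [Nonempty m] (A : Matrix m m ℝ) (C : ι → Matrix m m ℝ)
    (B : Matrix m m ℝ) (E : ι → Matrix m m ℝ) :
    (exp (twoSided A C B E)).trace ^ 2
      ≤ (exp (twoSided A C A C)).trace * (exp (twoSided B E B E)).trace := by
  refine le_of_tendsto_of_tendsto' ((tendsto_trace_twoSided A C B E).pow 2)
    ((tendsto_trace_twoSided A C A C).mul (tendsto_trace_twoSided B E B E)) fun n => ?_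
  simp_rw [← pow_two]
  exact Finset.sum_mul_sq_le_sq_mul_sq _ _ _

end Kronecker

end RandomLoop

namespace RandomLoop

open Filter Topology NormedSpace

/-! ### Spin systems -/

section SpinSystem

open scoped Kronecker

variable {V C : Type*} [Fintype V] [DecidableEq V] [Fintype C] [DecidableEq C]

/-- The operator that acts as `M` on the spin at `x`. -/
def siteOp (x : V) : Matrix C C ℝ →ₗ[ℝ] Matrix (V → C) (V → C) ℝ where
  toFun M := Matrix.of fun σ σ' => if ∀ z, z ≠ x → σ z = σ' z then M (σ x) (σ' x) else 0
  map_add' M N := by ext σ σ'; simp only [Matrix.of_apply, Matrix.add_apply]; split_ifs <;> simp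
  map_smul' c M := by
    ext σ σ'; simp only [Matrix.of_apply, Matrix.smul_apply, RingHom.id_apply]; split_ifs <;> simp

theorem siteOp_apply (x : V) (M : Matrix C C ℝ) (σ σ' : V → C) :
    siteOp x M σ σ' = if ∀ z, z ≠ x → σ z = σ' z then M (σ x) (σ' x) else 0 := rfl

theorem siteOp_one (x : V) : siteOp x (1 : Matrix C C ℝ) = 1 := by
  ext σ σ'
  rw [siteOp_apply, Matrix.one_apply, Matrix.one_apply]
  by_cases h : σ = σ'
  · simp [h]
  · rw [if_neg h]
    split_ifs with h1 h2
    · exact absurd (funext fun z => if hz : z = x then hz ▸ h2 else h1 z hz) h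
    · rfl
    · rfl

theorem siteOp_diagonal (x : V) (f : C → ℝ) :
    siteOp x (Matrix.diagonal f) = Matrix.diagonal fun σ : V → C => f (σ x) := by
  ext σ σ'
  rw [siteOp_apply, Matrix.diagonal_apply, Matrix.diagonal_apply]
  by_cases h : σ = σ'
  · simp [h]
  · rw [if_neg h]
    split_ifs with h1 h2
    · exact absurd (funext fun z => if hz : z = x then hz ▸ h2 else h1 z hz) h
    · rfl
    · rfl

theorem siteOp_mul_siteOp_apply {x y : V} (hxy : x ≠ y) (M N : Matrix C C ℝ) (σ σ' : V → C) :
    (siteOp x M * siteOp y N) σ σ' =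
      if ∀ z, z ≠ x → z ≠ y → σ z = σ' z then M (σ x) (σ' x) * N (σ y) (σ' y) else 0 := by
  rw [Matrix.mul_apply, Finset.sum_eq_single (Function.update σ x (σ' x))]
  · simp only [siteOp_apply]
    have h1 : ∀ z, z ≠ x → σ z = Function.update σ x (σ' x) z := fun z hz => by simp [hz]
    rw [if_pos h1]
    simp only [Function.update_self, Function.update_of_ne hxy.symm]
    by_cases h : ∀ z, z ≠ x → z ≠ y → σ z = σ' z
    · rw [if_pos h, if_pos]
      intro z hz
      by_cases hzx : z = x
      · simp [hzx]
      · simp [hzx, h z hzx hz]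
    · rw [if_neg h, if_neg, mul_zero]
      contrapose! h
      intro z hzx hzy
      simpa [hzx] using h z hzy
  · intro τ _ hτ
    simp only [siteOp_apply]
    by_contra hne
    have h1 : ∀ z, z ≠ x → σ z = τ z := by
      by_contra h; exact hne (by rw [if_neg h, zero_mul])
    have h2 : ∀ z, z ≠ y → τ z = σ' z := by
      by_contra h; exact hne (by rw [if_neg h, mul_zero])
    refine hτ (funext fun z => ?_)
    by_cases hz : z = x
    · subst hz; simpa using h2 z hxy
    · simp [hz, h1 z hz]
  · simp

theorem reindex_siteOp {V' : Type*} [Fintype V'] [DecidableEq V'] (e : V ≃ V') (x : V)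
    (M : Matrix C C ℝ) :
    Matrix.reindexAlgEquiv ℝ ℝ (Equiv.arrowCongr e (Equiv.refl C)) (siteOp x M)
      = siteOp (e x) M := by
  ext σ σ'
  simp only [Matrix.coe_reindexAlgEquiv, Matrix.reindex_apply, Matrix.submatrix_apply,
    siteOp_apply]
  simp only [Equiv.arrowCongr_symm, Equiv.arrowCongr_apply, Equiv.symm_symm, Equiv.refl_symm,
    Function.comp, Equiv.refl_apply]
  congr 1
  refine propext ⟨fun h z hz => ?_, fun h z hz => h _ fun hz' => hz (e.injective hz')⟩
  simpa using h (e.symm z) (by rintro rfl; simp at hz)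

/-- The interaction across an edge, in terms of the representations `f` and `g` of the spin
operators at its end points, with the values `s` and `t` of the external field. -/
noncomputable def bond {𝔸 : Type*} [Ring 𝔸] [Algebra ℝ 𝔸] (u : ℝ) (w : C → ℝ) (f g : Matrix C C ℝ → 𝔸)
    (s t : ℝ) : 𝔸 :=
  ∑ a, ∑ c, (u • (f (Matrix.single a c 1) * g (Matrix.single c a 1)) +
      (1 - u) • (f (Matrix.single a c 1) * g (Matrix.single a c 1)))
    - (s - t) • (f (Matrix.diagonal w) - g (Matrix.diagonal w))
    - ((∑ a, w a ^ 2) / 2 * (s - t) ^ 2) • (1 : 𝔸)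

/-- This is why `bond` takes arbitrary maps `f` and `g`: the same expression can be carried from the
full spin space to the two tensor factors. -/
theorem map_bond {𝔸 𝔹 : Type*} [Ring 𝔸] [Algebra ℝ 𝔸] [Ring 𝔹] [Algebra ℝ 𝔹] (φ : 𝔸 →ₐ[ℝ] 𝔹)
    (u : ℝ) (w : C → ℝ) (f g : Matrix C C ℝ → 𝔸) (s t : ℝ) :
    φ (bond u w f g s t) = bond u w (fun M => φ (f M)) (fun M => φ (g M)) s t := by
  simp [bond, map_sum, map_sub, map_add, map_smul, map_mul]

theorem bond_comm {𝔸 : Type*} [Ring 𝔸] [Algebra ℝ 𝔸] (u : ℝ) (w : C → ℝ)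
    {f g : Matrix C C ℝ → 𝔸} (h : ∀ M N, f M * g N = g N * f M) (s t : ℝ) :
    bond u w f g s t = bond u w g f t s := by
  rw [bond, bond]
  congr 1
  · congr 1
    · simp only [h, Finset.sum_add_distrib]
      congr 1
      exact Finset.sum_comm
    · rw [← neg_sub t s, ← neg_sub (g _), smul_neg, neg_smul, neg_neg]
  · congr 1; ring

/-- The index set of the terms of the interaction across an edge. -/
abbrev BondIndex (C : Type*) := (C × C) ⊕ (C × C) ⊕ C

/-- The spin operators in the reflection positive form of the interaction across an edge. -/
noncomputable def bondTerm (u : ℝ) (w : C → ℝ) (s : ℝ) : BondIndex C → Matrix C C ℝ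
  | .inl (a, c) => if a = c then 0 else
      √(u / 2) • (Matrix.single a c 1 + Matrix.single c a 1)
  | .inr (.inl (a, c)) => if a = c then 0 else √(1 - 2 * u) • Matrix.single a c 1
  | .inr (.inr a) => Matrix.single a a 1 + (w a * s) • (1 : Matrix C C ℝ)

theorem diagonal_eq_sum_single (w : C → ℝ) :
    Matrix.diagonal w = ∑ a, w a • Matrix.single a a (1 : ℝ) := by
  ext i j
  simp only [Matrix.sum_apply, Matrix.smul_apply, Matrix.single_apply, Matrix.diagonal_apply]
  by_cases h : i = j
  · subst h; simp
  · simp only [h, if_false]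
    refine (Finset.sum_eq_zero fun a _ => ?_).symm
    rw [if_neg (by rintro ⟨rfl, rfl⟩; exact h rfl), smul_zero]

/-- The interaction across an edge is reflection positive, up to terms that involve only one of
the end points. -/
theorem bond_eq_sum_bondTerm {𝔸 : Type*} [Ring 𝔸] [Algebra ℝ 𝔸] {u : ℝ} (hu0 : 0 ≤ u)
    (hu1 : u ≤ 1 / 2) (w : C → ℝ) (f g : Matrix C C ℝ →ₗ[ℝ] 𝔸) (hf : f 1 = 1) (hg : g 1 = 1)
    (s t : ℝ) :
    bond u w f g s t = ∑ i, f (bondTerm u w s i) * g (bondTerm u w t i)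
      - (s • f (Matrix.diagonal w) + ((∑ a, w a ^ 2) / 2 * s ^ 2) • (1 : 𝔸))
      - (t • g (Matrix.diagonal w) + ((∑ a, w a ^ 2) / 2 * t ^ 2) • (1 : 𝔸)) := by
  have hdf : f (Matrix.diagonal w) = ∑ a, w a • f (Matrix.single a a 1) := by
    rw [diagonal_eq_sum_single, map_sum]; simp only [map_smul]
  have hdg : g (Matrix.diagonal w) = ∑ a, w a • g (Matrix.single a a 1) := by
    rw [diagonal_eq_sum_single, map_sum]; simp only [map_smul]
  set F : C → C → 𝔸 := fun a c => f (Matrix.single a c 1) with hF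
  set G : C → C → 𝔸 := fun a c => g (Matrix.single a c 1) with hG
  -- Shifting the diagonal units by the field produces the mixed terms of -(s-t)(W_x - W_y) and of
  -- the square (s-t)². The parts that belong to one end point are subtracted separately in the
  -- statement.
  have hd : ∑ a, f (bondTerm u w s (.inr (.inr a))) * g (bondTerm u w t (.inr (.inr a)))
      = ∑ a, F a a * G a a + t • f (Matrix.diagonal w) + s • g (Matrix.diagonal w)
        + ((∑ a, w a ^ 2) * s * t) • (1 : 𝔸) := by
    simp only [bondTerm, map_add, map_smul, hf, hg, hdf, hdg]
    simp only [add_mul, mul_add, Finset.sum_add_distrib, Finset.smul_sum, Finset.sum_mul,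
      Finset.sum_smul, smul_mul_assoc, mul_smul_comm, one_mul, mul_one, smul_smul, smul_add]
    rw [← add_assoc, add_right_comm (∑ a, F a a * G a a)]
    congr 1
    · congr 2
      · simp only [mul_comm]
      · simp only [mul_comm]
    · exact Finset.sum_congr rfl fun a _ => by congr 1; ring
  -- Off the diagonal, all crosses are paired with an equal weight `u` of double bars; symmetrizing
  -- over (a, c) makes both factors equal to E_ac + E_ca, at the price of a factor 1/2.
  have h1 : ∑ p : C × C, f (bondTerm u w s (.inl p)) * g (bondTerm u w t (.inl p))
      = ∑ a, ∑ c, if a = c then 0 else u • (F a c * G c a + F a c * G a c) := by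
    have e : ∀ p : C × C, f (bondTerm u w s (.inl p)) * g (bondTerm u w t (.inl p))
        = (if p.1 = p.2 then 0 else (u / 2) • (F p.1 p.2 * G p.2 p.1 + F p.1 p.2 * G p.1 p.2))
        + (if p.2 = p.1 then 0 else (u / 2) • (F p.2 p.1 * G p.1 p.2 + F p.2 p.1 * G p.2 p.1)) := by
      rintro ⟨a, c⟩
      by_cases h : a = c
      · simp [bondTerm, h]
      · simp only [bondTerm, h, Ne.symm h, if_false, map_smul, map_add, smul_mul_assoc,
          mul_smul_comm, smul_smul, Real.mul_self_sqrt (show 0 ≤ u / 2 by linarith), ← smul_add]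
        congr 1
        simp only [hF, hG]
        noncomm_ring
    simp_rw [e, Finset.sum_add_distrib, Fintype.sum_prod_type]
    rw [Finset.sum_comm (f := fun a c : C => if c = a then (0 : 𝔸) else
      (u / 2) • (F c a * G a c + F c a * G c a)), ← Finset.sum_add_distrib]
    refine Finset.sum_congr rfl fun a _ => ?_
    rw [← Finset.sum_add_distrib]
    refine Finset.sum_congr rfl fun c _ => ?_
    split_ifs
    · simp
    · rw [← add_smul]; congr 1; ring
  -- The double bars left over have weight (1 - u) - u, whose square root is used here: this is
  -- where `u ≤ 1/2` enters.
  have h2 : ∑ p : C × C, f (bondTerm u w s (.inr (.inl p))) * g (bondTerm u w t (.inr (.inl p)))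
      = ∑ a, ∑ c, if a = c then 0 else (1 - 2 * u) • (F a c * G a c) := by
    rw [Fintype.sum_prod_type]
    refine Finset.sum_congr rfl fun a _ => Finset.sum_congr rfl fun c _ => ?_
    by_cases h : a = c
    · simp [bondTerm, h]
    · simp only [bondTerm, h, if_false, map_smul, smul_mul_assoc, mul_smul_comm, smul_smul,
        Real.mul_self_sqrt (show 0 ≤ 1 - 2 * u by linarith), hF, hG]
  -- For a = c crosses and double bars give the same operator, with total coefficient u + (1 - u) =
  -- 1.
  have h3 : ∑ a, ∑ c, (u • (F a c * G c a) + (1 - u) • (F a c * G a c))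
      = ∑ a, ∑ c, (if a = c then 0 else u • (F a c * G c a + F a c * G a c))
        + ∑ a, ∑ c, (if a = c then 0 else (1 - 2 * u) • (F a c * G a c))
        + ∑ a, F a a * G a a := by
    have e : ∑ a, F a a * G a a = ∑ a, ∑ c, if a = c then F a c * G a c else 0 := by simp
    rw [e]
    simp only [← Finset.sum_add_distrib]
    refine Finset.sum_congr rfl fun a _ => Finset.sum_congr rfl fun c _ => ?_
    by_cases h : a = c
    · subst h; simp only [if_true, ← add_smul]; simp
    · simp only [h, if_false]; module
  rw [Fintype.sum_sum_type, Fintype.sum_sum_type, h1, h2, hd, bond, h3]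
  module

/-! ### The generator in an external field and its splitting by a reflection -/

variable (G : SimpleGraph V) [DecidableRel G.Adj]

/-- The generator of the loop model, in the external field `v`. -/
noncomputable def generator (u : ℝ) (w : C → ℝ) (v : V → ℝ) : Matrix (V → C) (V → C) ℝ :=
  (1 / 2 : ℝ) • ∑ x, ∑ y, if G.Adj x y then bond u w (siteOp x) (siteOp y) (v x) (v y) else 0

/-- The partition function in the external field `v`. -/
noncomputable def fieldPartition (β u : ℝ) (w : C → ℝ) (v : V → ℝ) : ℝ :=
  (exp (β • generator G u w v)).trace

/-- A reflection `r` of the graph, which exchanges `H` and its complement. -/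
structure IsReflection (r : V ≃ V) (H : Finset V) : Prop where
  invol : ∀ x, r (r x) = x
  mem_iff : ∀ x, r x ∈ H ↔ x ∉ H
  adj_iff : ∀ x y, G.Adj (r x) (r y) ↔ G.Adj x y
  cross : ∀ x ∈ H, ∀ y, y ∉ H → G.Adj x y → y = r x

variable {G}

namespace IsReflection

variable {r : V ≃ V} {H : Finset V} (hr : IsReflection G r H)
include hr

theorem sum_eq {M : Type*} [AddCommMonoid M] (f : V → M) :
    ∑ x, f x = ∑ x : H, (f x + f (r x)) := by
  rw [Finset.sum_add_distrib, Finset.sum_coe_sort H f, Finset.sum_coe_sort H fun x => f (r x),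
    ← Finset.sum_add_sum_compl H f]
  congr 1
  refine Finset.sum_nbij' (fun x => r x) (fun x => r x) ?_ ?_ ?_ ?_ ?_
  · intro x hx; exact (hr.mem_iff x).2 (by simpa using hx)
  · intro x hx; rw [Finset.mem_compl, hr.mem_iff]; simpa using hx
  · intro x _; exact hr.invol x
  · intro x _; exact hr.invol x
  · intro x _; rw [hr.invol]

/-- Edges lie inside `H`, inside its image, or across; the field `cross` of `IsReflection` leaves
only edges from x to r x in the last class. -/
theorem sum_adj_eq {M : Type*} [AddCommMonoid M] (Φ : V → V → M) :
    (∑ x, ∑ y, if G.Adj x y then Φ x y else 0)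
      = (∑ x : H, ∑ y : H, if G.Adj x y then Φ x y else 0)
        + (∑ x : H, ∑ y : H, if G.Adj x y then Φ (r x) (r y) else 0)
        + ∑ x : H, if G.Adj x (r x) then Φ x (r x) + Φ (r x) x else 0 := by
  rw [hr.sum_eq]
  simp_rw [hr.sum_eq (fun y => ite _ _ _), hr.adj_iff, Finset.sum_add_distrib]
  have hc : ∀ x y : H, G.Adj x (r y) → y = x := by
    intro x y h
    have := hr.cross x x.2 (r y) (by rw [hr.mem_iff]; simp) h
    exact Subtype.ext (r.injective this)
  have hc' : ∀ x y : H, G.Adj (r x) y ↔ G.Adj y (r x) := fun x y => G.adj_comm _ _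
  have e1 : (∑ x : H, ∑ y : H, if G.Adj x (r y) then Φ x (r y) else 0)
      = ∑ x : H, if G.Adj x (r x) then Φ x (r x) else 0 := by
    refine Finset.sum_congr rfl fun x _ => Finset.sum_eq_single x (fun y _ hy => ?_) (by simp)
    exact if_neg fun h => hy (hc x y h)
  have e2 : (∑ x : H, ∑ y : H, if G.Adj (r x) y then Φ (r x) y else 0)
      = ∑ x : H, if G.Adj x (r x) then Φ (r x) x else 0 := by
    refine Finset.sum_congr rfl fun x _ => ?_
    simp_rw [hc']
    refine Finset.sum_eq_single x (fun y _ hy => ?_) (by simp)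
    exact if_neg fun h => hy (hc y x h).symm
  rw [e1, e2]
  have e3 : (∑ x : H, if G.Adj x (r x) then Φ x (r x) + Φ (r x) x else 0)
      = (∑ x : H, if G.Adj x (r x) then Φ x (r x) else 0)
        + ∑ x : H, if G.Adj x (r x) then Φ (r x) x else 0 := by
    rw [← Finset.sum_add_distrib]
    exact Finset.sum_congr rfl fun x _ => by split_ifs <;> simp
  rw [e3]
  abel

/-- The colourings of `V`, as pairs of colourings of `H`. -/
def splitEquiv (C : Type*) : (V → C) ≃ (H → C) × (H → C) where
  toFun σ := (fun x => σ x, fun x => σ (r x))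
  invFun p z := if h : z ∈ H then p.1 ⟨z, h⟩ else p.2 ⟨r z, (hr.mem_iff z).2 h⟩
  left_inv σ := by
    funext z
    by_cases h : z ∈ H
    · simp [h]
    · simp [h, hr.invol]
  right_inv p := by
    ext x
    · simp
    · have : r (x : V) ∉ H := by rw [hr.mem_iff]; simp
      simp [this, hr.invol]

theorem splitEquiv_symm_left (C : Type*) (p : (H → C) × (H → C)) (x : H) :
    (hr.splitEquiv C).symm p x = p.1 x := congrFun (congrArg Prod.fst
      ((hr.splitEquiv C).apply_symm_apply p)) x

theorem splitEquiv_symm_right (C : Type*) (p : (H → C) × (H → C)) (x : H) :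
    (hr.splitEquiv C).symm p (r x) = p.2 x := congrFun (congrArg Prod.snd
      ((hr.splitEquiv C).apply_symm_apply p)) x

theorem forall_iff (P : V → Prop) : (∀ z, P z) ↔ (∀ z : H, P z) ∧ ∀ z : H, P (r z) := by
  refine ⟨fun h => ⟨fun z => h z, fun z => h _⟩, fun h z => ?_⟩
  by_cases hz : z ∈ H
  · exact h.1 ⟨z, hz⟩
  · simpa [hr.invol] using h.2 ⟨r z, (hr.mem_iff z).2 hz⟩

theorem ne_apply (x y : H) : (x : V) ≠ r y := fun h => by
  have := (hr.mem_iff y).1 (h ▸ x.2); exact this y.2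

theorem reindex_siteOp_left (x : H) (M : Matrix C C ℝ) :
    Matrix.reindexAlgEquiv ℝ ℝ (hr.splitEquiv C) (siteOp (x : V) M) = siteOp x M ⊗ₖ 1 := by
  ext ⟨a, b⟩ ⟨a', b'⟩
  simp only [Matrix.coe_reindexAlgEquiv, Matrix.reindex_apply, Matrix.submatrix_apply,
    siteOp_apply, Matrix.kroneckerMap_apply, Matrix.one_apply, hr.splitEquiv_symm_left]
  refine (if_congr (hr.forall_iff _) rfl rfl).trans ?_
  simp only [hr.splitEquiv_symm_left, hr.splitEquiv_symm_right, (hr.ne_apply x _).symm,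
    ne_eq, not_false_eq_true, true_implies, Subtype.coe_inj]
  simp only [← funext_iff (f := b) (g := b')]
  by_cases h1 : b = b' <;> by_cases h2 : ∀ z : H, ¬ z = x → a z = a' z <;> simp [h1, h2]

theorem reindex_siteOp_right (x : H) (M : Matrix C C ℝ) :
    Matrix.reindexAlgEquiv ℝ ℝ (hr.splitEquiv C) (siteOp (r x) M) = 1 ⊗ₖ siteOp x M := by
  ext ⟨a, b⟩ ⟨a', b'⟩
  simp only [Matrix.coe_reindexAlgEquiv, Matrix.reindex_apply, Matrix.submatrix_apply,
    siteOp_apply, Matrix.kroneckerMap_apply, Matrix.one_apply, hr.splitEquiv_symm_right]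
  refine (if_congr (hr.forall_iff _) rfl rfl).trans ?_
  simp only [hr.splitEquiv_symm_left, hr.splitEquiv_symm_right, (hr.ne_apply _ x),
    ne_eq, not_false_eq_true, true_implies, r.injective.eq_iff, Subtype.coe_inj]
  simp only [← funext_iff (f := a) (g := a')]
  by_cases h1 : a = a' <;> by_cases h2 : ∀ z : H, ¬ z = x → b z = b' z <;> simp [h1, h2]

variable (G r H) in
omit hr in
/-- The part of the generator that involves the spins in `H` only. -/
noncomputable def sideGenerator (u : ℝ) (w : C → ℝ) (v : H → ℝ) : Matrix (H → C) (H → C) ℝ :=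
  ((1 / 2 : ℝ) • ∑ x : H, ∑ y : H,
      if G.Adj x y then bond u w (siteOp x) (siteOp y) (v x) (v y) else 0)
    - ∑ x : H, if G.Adj x (r x) then
        v x • siteOp x (Matrix.diagonal w) + ((∑ a, w a ^ 2) / 2 * v x ^ 2) • 1 else 0

variable (G r H) in
omit hr in
/-- The operators on `H` in the terms of the generator that couple `H` to its complement. -/
noncomputable def crossTerm (β u : ℝ) (w : C → ℝ) (v : H → ℝ) (p : H × BondIndex C) :
    Matrix (H → C) (H → C) ℝ :=
  if G.Adj p.1 (r p.1) then √β • siteOp p.1 (bondTerm u w (v p.1) p.2) else 0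

/-- The reflection identifies both halves with `H`, so the two tensor factors are the same space.
Both sides are given by the same functions of their own field values; a reflection symmetric field
therefore yields `twoSided A C A C`. -/
theorem reindex_generator {β u : ℝ} (hβ : 0 ≤ β) (hu0 : 0 ≤ u) (hu1 : u ≤ 1 / 2) (w : C → ℝ)
    (v : V → ℝ) :
    Matrix.reindexAlgEquiv ℝ ℝ (hr.splitEquiv C) (β • generator G u w v)
      = twoSided (β • sideGenerator G r H u w fun x => v x)
          (crossTerm G r H β u w fun x => v x)
          (β • sideGenerator G r H u w fun x => v (r x))
          (crossTerm G r H β u w fun x => v (r x)) := by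
  set Ψ := Matrix.reindexAlgEquiv ℝ ℝ (hr.splitEquiv C)
  let ℓ : Matrix (H → C) (H → C) ℝ →ₐ[ℝ] Matrix ((H → C) × (H → C)) ((H → C) × (H → C)) ℝ :=
    AlgHom.ofLinearMap (LinearMap.mk ⟨fun A => A ⊗ₖ 1, fun A B => Matrix.add_kronecker A B 1⟩
        fun c A => Matrix.smul_kronecker c A 1)
      Matrix.one_kronecker_one fun A B => by
        change (A * B) ⊗ₖ 1 = A ⊗ₖ 1 * B ⊗ₖ 1
        rw [← Matrix.mul_kronecker_mul, one_mul]
  let ρ : Matrix (H → C) (H → C) ℝ →ₐ[ℝ] Matrix ((H → C) × (H → C)) ((H → C) × (H → C)) ℝ :=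
    AlgHom.ofLinearMap (LinearMap.mk ⟨fun A => 1 ⊗ₖ A, fun A B => Matrix.kronecker_add 1 A B⟩
        fun c A => Matrix.kronecker_smul c 1 A)
      Matrix.one_kronecker_one fun A B => by
        change 1 ⊗ₖ (A * B) = 1 ⊗ₖ A * 1 ⊗ₖ B
        rw [← Matrix.mul_kronecker_mul, one_mul]
  have hℓ : ∀ A, ℓ A = A ⊗ₖ 1 := fun _ => rfl
  have hρ : ∀ A, ρ A = 1 ⊗ₖ A := fun _ => rfl
  have hℓρ : ∀ A B, ℓ A * ρ B = A ⊗ₖ B := fun A B => by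
    rw [hℓ, hρ, ← Matrix.mul_kronecker_mul, one_mul, mul_one]
  have hρℓ : ∀ A B, ρ B * ℓ A = A ⊗ₖ B := fun A B => by
    rw [hℓ, hρ, ← Matrix.mul_kronecker_mul, one_mul, mul_one]
  have hΨℓ : ∀ (x : H) (M : Matrix C C ℝ), Ψ (siteOp (x : V) M) = ℓ (siteOp x M) :=
    fun x M => hr.reindex_siteOp_left x M
  have hΨρ : ∀ (x : H) (M : Matrix C C ℝ), Ψ (siteOp (r x) M) = ρ (siteOp x M) :=
    fun x M => hr.reindex_siteOp_right x M
  have hbond : ∀ (x y : V) (s t : ℝ), Ψ (bond u w (siteOp x) (siteOp y) s t)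
      = bond u w (fun M => Ψ (siteOp x M)) (fun M => Ψ (siteOp y M)) s t :=
    fun x y s t => map_bond Ψ.toAlgHom u w (siteOp x) (siteOp y) s t
  set c : ℝ := (∑ a, w a ^ 2) / 2 with hc
  set D : H → Matrix (H → C) (H → C) ℝ := fun x => siteOp x (Matrix.diagonal w)
  have hcross : ∀ x : H, bond u w (fun M => ℓ (siteOp x M)) (fun M => ρ (siteOp x M)) (v x) (v (r x))
      = ∑ i, (siteOp x (bondTerm u w (v x) i)) ⊗ₖ (siteOp x (bondTerm u w (v (r x)) i))
        - ℓ (v x • D x + (c * v x ^ 2) • 1) - ρ (v (r x) • D x + (c * v (r x) ^ 2) • 1) := by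
    intro x
    have h := bond_eq_sum_bondTerm hu0 hu1 w (ℓ.toLinearMap ∘ₗ siteOp x)
      (ρ.toLinearMap ∘ₗ siteOp x) (by simp [siteOp_one]) (by simp [siteOp_one]) (v x) (v (r x))
    simp only [LinearMap.comp_apply, AlgHom.toLinearMap_apply, hℓρ] at h
    rw [map_add, map_add, map_smul, map_smul, map_smul, map_smul, map_one, map_one]
    exact h
  -- The two orientations of a crossing edge contribute equally, which compensates for the factor
  -- 1/2 in `generator`.
  have hcross' : ∀ x : H, bond u w (fun M => ρ (siteOp x M)) (fun M => ℓ (siteOp x M)) (v (r x)) (v x)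
      = bond u w (fun M => ℓ (siteOp x M)) (fun M => ρ (siteOp x M)) (v x) (v (r x)) :=
    fun x => bond_comm u w (fun M N => by rw [hρℓ, hℓρ]) _ _
  have hcrossterm : ∀ x : H, ∑ i, crossTerm G r H β u w (fun x => v x) (x, i) ⊗ₖ
      crossTerm G r H β u w (fun x => v (r x)) (x, i) = if G.Adj x (r x) then
        β • ∑ i, (siteOp x (bondTerm u w (v x) i)) ⊗ₖ (siteOp x (bondTerm u w (v (r x)) i))
        else 0 := by
    intro x
    by_cases hx : G.Adj x (r x)
    · simp only [crossTerm, if_pos hx]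
      rw [Finset.smul_sum]
      refine Finset.sum_congr rfl fun i _ => ?_
      rw [Matrix.smul_kronecker, Matrix.kronecker_smul, smul_smul, Real.mul_self_sqrt hβ]
    · simp [crossTerm, hx]
  have e1 : Ψ (generator G u w v) = (1 / 2 : ℝ) •
      ((ℓ (∑ x : H, ∑ y : H,
          if G.Adj x y then bond u w (siteOp x) (siteOp y) (v x) (v y) else 0)
        + ρ (∑ x : H, ∑ y : H,
          if G.Adj x y then bond u w (siteOp x) (siteOp y) (v (r x)) (v (r y)) else 0))
        + ∑ x : H, if G.Adj x (r x) then
          (2 : ℝ) • bond u w (fun M => ℓ (siteOp x M)) (fun M => ρ (siteOp x M)) (v x) (v (r x))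
          else 0) := by
    rw [generator, hr.sum_adj_eq fun x y => bond u w (siteOp x) (siteOp y) (v x) (v y),
      map_smul, map_add, map_add]
    congr 2
    · congr 1
      · simp only [map_sum, apply_ite Ψ, apply_ite ℓ, map_zero, hbond, map_bond, hΨℓ]
      · simp only [map_sum, apply_ite Ψ, apply_ite ρ, map_zero, hbond, map_bond, hΨρ]
    · simp only [map_sum, apply_ite Ψ, map_zero, map_add, hbond, hΨℓ, hΨρ, hcross', two_smul]
  rw [map_smul, e1, twoSided, Fintype.sum_prod_type]
  simp only [hcrossterm]
  rw [← hℓ, ← hρ]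
  simp only [sideGenerator, map_smul, map_sub]
  have e2 : ∀ F : H → Matrix (H → C) (H → C) ℝ, ℓ (∑ x : H, if G.Adj x (r x) then F x else 0)
      = ∑ x : H, if G.Adj x (r x) then ℓ (F x) else 0 := fun F => by
    simp only [map_sum, apply_ite ℓ, map_zero]
  have e3 : ∀ F : H → Matrix (H → C) (H → C) ℝ, ρ (∑ x : H, if G.Adj x (r x) then F x else 0)
      = ∑ x : H, if G.Adj x (r x) then ρ (F x) else 0 := fun F => by
    simp only [map_sum, apply_ite ρ, map_zero]
  rw [e2, e3]
  have e4 : (∑ x : H, if G.Adj x (r x) then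
          (2 : ℝ) • bond u w (fun M => ℓ (siteOp x M)) (fun M => ρ (siteOp x M)) (v x) (v (r x))
          else 0) = (2 : ℝ) •
      ((∑ x : H, if G.Adj x (r x) then
        ∑ i, (siteOp x (bondTerm u w (v x) i)) ⊗ₖ (siteOp x (bondTerm u w (v (r x)) i)) else 0)
      - (∑ x : H, if G.Adj x (r x) then ℓ (v x • D x + (c * v x ^ 2) • 1) else 0)
      - (∑ x : H, if G.Adj x (r x) then ρ (v (r x) • D x + (c * v (r x) ^ 2) • 1) else 0)) := by
    rw [← Finset.sum_sub_distrib, ← Finset.sum_sub_distrib, Finset.smul_sum]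
    refine Finset.sum_congr rfl fun x _ => ?_
    split_ifs
    · rw [hcross]
    · simp
  have e5 : (∑ x : H, if G.Adj x (r x) then
        β • ∑ i, (siteOp x (bondTerm u w (v x) i)) ⊗ₖ (siteOp x (bondTerm u w (v (r x)) i)) else 0)
      = β • ∑ x : H, if G.Adj x (r x) then
        ∑ i, (siteOp x (bondTerm u w (v x) i)) ⊗ₖ (siteOp x (bondTerm u w (v (r x)) i)) else 0 := by
    rw [Finset.smul_sum]
    exact Finset.sum_congr rfl fun x _ => by split_ifs <;> simp
  rw [e4, e5]
  module

end IsReflection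

theorem trace_exp_reindex {m n : Type*} [Fintype m] [DecidableEq m] [Fintype n] [DecidableEq n]
    (e : m ≃ n) (A : Matrix m m ℝ) :
    (exp (Matrix.reindexAlgEquiv ℝ ℝ e A)).trace = (exp A).trace := by
  let _ : NormedRing (Matrix m m ℝ) := Matrix.linftyOpNormedRing
  let _ : NormedAlgebra ℝ (Matrix m m ℝ) := Matrix.linftyOpNormedAlgebra
  let _ : NormedRing (Matrix n n ℝ) := Matrix.linftyOpNormedRing
  let _ : NormedAlgebra ℝ (Matrix n n ℝ) := Matrix.linftyOpNormedAlgebra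
  let _ : NormedAlgebra ℚ (Matrix m m ℝ) := NormedAlgebra.restrictScalars ℚ ℝ _
  have hc : Continuous (Matrix.reindexAlgEquiv ℝ ℝ e) :=
    (Matrix.reindexAlgEquiv ℝ ℝ e).toLinearMap.continuous_of_finiteDimensional
  have h := NormedSpace.map_exp (Matrix.reindexAlgEquiv ℝ ℝ e) hc A
  refine (congrArg Matrix.trace h.symm).trans ?_
  simp only [Matrix.coe_reindexAlgEquiv, Matrix.trace, Matrix.reindex_apply, Matrix.diag_apply,
    Matrix.submatrix_apply]
  exact e.symm.sum_comp fun i => exp A i i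

theorem trace_exp_add_algebraMap {m : Type*} [Fintype m] [DecidableEq m] (A : Matrix m m ℝ)
    (r : ℝ) : (exp (A + algebraMap ℝ _ r)).trace = Real.exp r * (exp A).trace := by
  have h : exp (A + algebraMap ℝ _ r) = Real.exp r • exp A := by
    let _ : NormedRing (Matrix m m ℝ) := Matrix.linftyOpNormedRing
    let _ : NormedAlgebra ℝ (Matrix m m ℝ) := Matrix.linftyOpNormedAlgebra
    let _ : NormedAlgebra ℚ (Matrix m m ℝ) := NormedAlgebra.restrictScalars ℚ ℝ _
    have h1 := exp_add_of_commute (Algebra.commutes r A).symm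
    refine h1.trans ?_
    rw [← algebraMap_exp_comm, ← Algebra.commutes, ← Algebra.smul_def, Real.exp_eq_exp_ℝ]
    rfl
  rw [h, Matrix.trace_smul, smul_eq_mul]

theorem matrix_tsum_le_of_trace_exp_le {m : Type*} [Fintype m] [DecidableEq m] [Nonempty m]
    (X Y : Matrix m m ℝ) (c : ℝ)
    (h : ∀ s : ℝ, (exp (X + s • Y)).trace ≤ Real.exp (c * s ^ 2 / 2) * (exp X).trace) :
    ∑' n : ℕ, ((n + 1).factorial : ℝ)⁻¹ *
      ∑ i ∈ Finset.range (n + 1), (Y * X ^ i * Y * X ^ (n - i)).trace ≤ c * (exp X).trace := by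
  let _ : NormedRing (Matrix m m ℝ) := Matrix.linftyOpNormedRing
  let _ : NormedAlgebra ℝ (Matrix m m ℝ) := Matrix.linftyOpNormedAlgebra
  have : NormOneClass (Matrix m m ℝ) := Matrix.linfty_opNormOneClass
  exact RandomLoop.tsum_le_of_trace_exp_le
    (LinearMap.toContinuousLinearMap (Matrix.traceLinearMap m ℝ ℝ))
    (fun a b => Matrix.trace_mul_comm a b) X Y c h

end SpinSystem

end RandomLoop

namespace RandomLoop

open Filter Topology NormedSpace

/-! ### Gaussian domination and the bound on the Duhamel function -/

section GaussianDomination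

variable {V C : Type*} [Fintype V] [DecidableEq V] [Fintype C] [DecidableEq C]
  {G : SimpleGraph V} [DecidableRel G.Adj]

/-- The field that is equal to `v` on `H` and to the reflection of `v` on the complement. -/
noncomputable def reflectField (r : V ≃ V) (H : Finset V) (v : V → ℝ) (x : V) : ℝ :=
  if x ∈ H then v x else v (r x)

/-- The number of oriented edges with equal values of `v` at the end points. -/
noncomputable def flatEdges (G : SimpleGraph V) [DecidableRel G.Adj] (v : V → ℝ) : ℕ :=
  ∑ x, ∑ y, if G.Adj x y then (if v x = v y then 1 else 0) else 0

namespace IsReflection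

variable {r : V ≃ V} {H : Finset V} (hr : IsReflection G r H)
include hr

theorem reflectField_coe (v : V → ℝ) (x : H) : reflectField r H v x = v x := by
  simp [reflectField]

theorem reflectField_apply_coe (v : V → ℝ) (x : H) : reflectField r H v (r x) = v x := by
  have : r (x : V) ∉ H := by rw [hr.mem_iff]; simp
  simp [reflectField, this, hr.invol]

/-- The two fields on the right copy `v` from `H` to the complement and from the complement to `H`.
After `reindex_generator` they have equal data on the two sides, and the claim is the Cauchy–Schwarz
inequality of `trace_exp_twoSided_sq_le`. -/
theorem fieldPartition_sq_le [Nonempty C] {β u : ℝ} (hβ : 0 ≤ β) (hu0 : 0 ≤ u) (hu1 : u ≤ 1 / 2)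
    (w : C → ℝ) (v : V → ℝ) :
    fieldPartition G β u w v ^ 2 ≤ fieldPartition G β u w (reflectField r H v) *
      fieldPartition G β u w (reflectField r H (v ∘ r)) := by
  simp only [fieldPartition]
  rw [← trace_exp_reindex (hr.splitEquiv C), ← trace_exp_reindex (hr.splitEquiv C) (_ • generator G u w (reflectField r H v)),
    ← trace_exp_reindex (hr.splitEquiv C) (_ • generator G u w (reflectField r H (v ∘ r))),
    hr.reindex_generator hβ hu0 hu1, hr.reindex_generator hβ hu0 hu1,
    hr.reindex_generator hβ hu0 hu1]
  simp only [hr.reflectField_coe, hr.reflectField_apply_coe, Function.comp]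
  exact trace_exp_twoSided_sq_le _ _ _ _

theorem fieldPartition_reflectField_nonneg [Nonempty C] {β u : ℝ} (hβ : 0 ≤ β) (hu0 : 0 ≤ u)
    (hu1 : u ≤ 1 / 2) (w : C → ℝ) (v : V → ℝ) :
    0 ≤ fieldPartition G β u w (reflectField r H v) := by
  simp only [fieldPartition]
  rw [← trace_exp_reindex (hr.splitEquiv C), hr.reindex_generator hβ hu0 hu1]
  simp only [hr.reflectField_coe, hr.reflectField_apply_coe]
  exact trace_exp_twoSided_self_nonneg _ _

/-- Edges inside a half are counted twice by one reflected field and not at all by the other, so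
their totals agree. Every crossing edge becomes flat in both reflected fields, while the edge at
`x₀` was not flat for `v`. -/
theorem two_mul_flatEdges_lt (v : V → ℝ) {x₀ : V} (h₀ : x₀ ∈ H) (hadj : G.Adj x₀ (r x₀))
    (hv : v x₀ ≠ v (r x₀)) :
    2 * flatEdges G v <
      flatEdges G (reflectField r H v) + flatEdges G (reflectField r H (v ∘ r)) := by
  have e : ∀ v' : V → ℝ, flatEdges G v' = _ := fun v' =>
    hr.sum_adj_eq fun x y => if v' x = v' y then 1 else 0
  rw [e, e, e]
  simp only [hr.reflectField_coe, hr.reflectField_apply_coe, Function.comp, if_true]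
  have hlt : (∑ x : H, if G.Adj x (r x) then
      (if v x = v (r x) then 1 else 0) + (if v (r x) = v x then 1 else 0) else 0)
      < ∑ x : H, if G.Adj x (r x) then 1 + 1 else 0 := by
    refine Finset.sum_lt_sum (fun x _ => ?_) ⟨⟨x₀, h₀⟩, Finset.mem_univ _, ?_⟩
    · split_ifs <;> simp
    · simp [hadj, hv, hv.symm]
  omega

end IsReflection

theorem fieldPartition_const (β u : ℝ) (w : C → ℝ) (v : V → ℝ) (h : ∀ x y, v x = v y) :
    fieldPartition G β u w v = fieldPartition G β u w 0 := by
  simp only [fieldPartition, generator, bond]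
  simp [sub_eq_zero.2 (h _ _)]

/-- Gaussian domination. -/
theorem fieldPartition_le [Nonempty C] {β u : ℝ} (hβ : 0 ≤ β) (hu0 : 0 ≤ u) (hu1 : u ≤ 1 / 2)
    (w : C → ℝ) (hG : G.Connected)
    (hrefl : ∀ x y, G.Adj x y → ∃ r H, IsReflection G r H ∧ r x = y) (v : V → ℝ) :
    fieldPartition G β u w v ≤ fieldPartition G β u w 0 := by
  classical
  set Z := fieldPartition G β u w with hZ
  -- Fields with values in the range of `v` form a finite set that is stable under the reflections,
  -- so a maximizer exists without any estimate at infinity.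
  set F : Finset (V → ℝ) := Fintype.piFinset fun _ => Finset.univ.image v with hF
  have hvF : v ∈ F := by simp [hF]
  have hrF : ∀ v' ∈ F, ∀ r H, reflectField r H v' ∈ F := by
    intro v' hv' r H
    rw [hF, Fintype.mem_piFinset] at hv' ⊢
    intro x
    rw [reflectField]; split_ifs <;> exact hv' _
  have hcF : ∀ v' ∈ F, ∀ r : V ≃ V, v' ∘ r ∈ F := by
    intro v' hv' r
    rw [hF, Fintype.mem_piFinset] at hv' ⊢
    exact fun x => hv' _
  obtain ⟨v₁, hv₁, hmax₁⟩ := F.exists_max_image Z ⟨v, hvF⟩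
  -- Among the maximizers of `Z`, one with the most flat edges: if it is not constant, reflecting
  -- across an edge that is not flat gives two maximizers with more flat edges on average.
  obtain ⟨v₂, hv₂, hmax₂⟩ := (F.filter fun v' => Z v' = Z v₁).exists_max_image (flatEdges G)
    ⟨v₁, by simp [hv₁]⟩
  rw [Finset.mem_filter] at hv₂
  obtain ⟨hv₂F, hZ₂⟩ := hv₂
  by_cases hconst : ∀ x y, v₂ x = v₂ y
  · rw [hZ, ← fieldPartition_const β u w v₂ hconst, ← hZ, hZ₂]
    exact hmax₁ v hvF
  have hconst₀ : Z v₁ ≤ 0 ∨ 0 < Z v₁ := le_or_gt _ _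
  have hedge : ∃ x y, G.Adj x y ∧ v₂ x ≠ v₂ y := by
    by_contra! hno
    refine hconst fun x y => ?_
    obtain ⟨p⟩ := hG.preconnected x y
    induction p with
    | nil => rfl
    | cons h _ ih => exact (hno _ _ h).trans ih
  obtain ⟨x, y, hxy, hne⟩ := hedge
  obtain ⟨r, H, hr, rfl⟩ := hrefl x y hxy
  have hx₀ : ∃ x₀ ∈ H, G.Adj x₀ (r x₀) ∧ v₂ x₀ ≠ v₂ (r x₀) := by
    by_cases hx : x ∈ H
    · exact ⟨x, hx, hxy, hne⟩
    · exact ⟨r x, (hr.mem_iff x).2 hx, by rwa [hr.invol, G.adj_comm], by rw [hr.invol]; exact hne.symm⟩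
  obtain ⟨x₀, hx₀, hadj, hne₀⟩ := hx₀
  have hlt := hr.two_mul_flatEdges_lt v₂ hx₀ hadj hne₀
  have hsq := hr.fieldPartition_sq_le hβ hu0 hu1 w v₂
  have ha := hmax₁ _ (hrF v₂ hv₂F r H)
  have hb := hmax₁ _ (hrF _ (hcF v₂ hv₂F r) r H)
  have hb0 := hr.fieldPartition_reflectField_nonneg hβ hu0 hu1 w (v₂ ∘ r)
  have ha0 := hr.fieldPartition_reflectField_nonneg hβ hu0 hu1 w v₂
  rw [← hZ] at hsq ha0 hb0
  rw [hZ₂] at hsq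
  -- A positive maximum is needed to deduce equality from the Cauchy–Schwarz bound. Otherwise `0 ≤ Z
  -- 0` is enough, and this holds because the zero field is reflection symmetric.
  rcases hconst₀ with hneg | hpos
  · refine (hmax₁ v hvF).trans (hneg.trans ?_)
    have : Z 0 = Z (reflectField r H fun _ => 0) := by
      congr 1; funext z; simp [reflectField]
    rw [this]
    exact hr.fieldPartition_reflectField_nonneg hβ hu0 hu1 w _
  -- Two numbers in [0, Z v₁] whose product is at least (Z v₁)² are both equal to Z v₁.
  · have hae : Z (reflectField r H v₂) = Z v₁ := by nlinarith
    have hbe : Z (reflectField r H (v₂ ∘ r)) = Z v₁ := by nlinarith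
    have h1 := hmax₂ _ (Finset.mem_filter.2 ⟨hrF v₂ hv₂F r H, hae⟩)
    have h2 := hmax₂ _ (Finset.mem_filter.2 ⟨hrF _ (hcF v₂ hv₂F r) r H, hbe⟩)
    omega

variable (G) in
/-- The graph Laplacian. -/
noncomputable def laplacian (v : V → ℝ) (x : V) : ℝ := ∑ y, if G.Adj x y then v x - v y else 0

variable (G) in
/-- The generator of the loop model. -/
noncomputable def loopGenerator (C : Type*) [Fintype C] [DecidableEq C] (u : ℝ) :
    Matrix (V → C) (V → C) ℝ :=
  generator G u (fun _ : C => 0) 0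

/-- Summation by parts over the edges. The quadratic term is scalar and the linear one involves only
the Laplacian of `v`. -/
theorem generator_eq (u : ℝ) (w : C → ℝ) (v : V → ℝ) :
    generator G u w v = loopGenerator G C u
      - (∑ x, laplacian G v x • siteOp x (Matrix.diagonal w))
      - ((∑ a, w a ^ 2) / 2 * ∑ x, v x * laplacian G v x) • 1 := by
  set D : V → Matrix (V → C) (V → C) ℝ := fun x => siteOp x (Matrix.diagonal w) with hD
  set c := (∑ a, w a ^ 2) / 2
  have h1 : ∀ x y, bond u w (siteOp x) (siteOp y) (v x) (v y)
      = bond u (fun _ : C => 0) (siteOp x) (siteOp y) (0 : ℝ) 0 - (v x - v y) • (D x - D y)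
        - (c * (v x - v y) ^ 2) • (1 : Matrix (V → C) (V → C) ℝ) := by
    intro x y; simp [bond, hD, c]
  have h2 : (∑ x, ∑ y, if G.Adj x y then (v x - v y) • (D x - D y) else 0)
      = (2 : ℝ) • ∑ x, laplacian G v x • D x := by
    have e1 : (∑ x, ∑ y, if G.Adj x y then (v x - v y) • (D x - D y) else 0)
        = (∑ x, ∑ y, if G.Adj x y then (v x - v y) • D x else 0)
          + ∑ x, ∑ y, if G.Adj x y then (v y - v x) • D y else 0 := by
      simp only [← Finset.sum_add_distrib]
      refine Finset.sum_congr rfl fun x _ => Finset.sum_congr rfl fun y _ => ?_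
      split_ifs
      · module
      · simp
    rw [e1, Finset.sum_comm (f := fun x y => if G.Adj x y then (v y - v x) • D y else 0), two_smul]
    congr 1
    · refine Finset.sum_congr rfl fun x _ => ?_
      rw [laplacian, Finset.sum_smul]
      exact Finset.sum_congr rfl fun y _ => by split_ifs <;> simp
    · refine Finset.sum_congr rfl fun x _ => ?_
      rw [laplacian, Finset.sum_smul]
      exact Finset.sum_congr rfl fun y _ => by
        by_cases h : G.Adj x y <;> simp [h, G.adj_comm y x]
  have h3 : (∑ x, ∑ y, if G.Adj x y then (v x - v y) ^ 2 else 0)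
      = 2 * ∑ x, v x * laplacian G v x := by
    have e1 : (∑ x, ∑ y, if G.Adj x y then (v x - v y) ^ 2 else 0)
        = (∑ x, ∑ y, if G.Adj x y then v x * (v x - v y) else 0)
          + ∑ x, ∑ y, if G.Adj x y then v y * (v y - v x) else 0 := by
      simp only [← Finset.sum_add_distrib]
      refine Finset.sum_congr rfl fun x _ => Finset.sum_congr rfl fun y _ => ?_
      split_ifs
      · ring
      · simp
    rw [e1, Finset.sum_comm (f := fun x y => if G.Adj x y then v y * (v y - v x) else 0), two_mul]
    congr 1
    · refine Finset.sum_congr rfl fun x _ => ?_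
      rw [laplacian, Finset.mul_sum]
      exact Finset.sum_congr rfl fun y _ => by split_ifs <;> simp
    · refine Finset.sum_congr rfl fun x _ => ?_
      rw [laplacian, Finset.mul_sum]
      exact Finset.sum_congr rfl fun y _ => by
        by_cases h : G.Adj x y <;> simp [h, G.adj_comm y x]
  have h4 : (∑ x, ∑ y, if G.Adj x y then bond u w (siteOp x) (siteOp y) (v x) (v y) else 0)
      = (∑ x, ∑ y, if G.Adj x y then
          bond u (fun _ : C => 0) (siteOp x) (siteOp y) (0 : ℝ) 0 else 0)
        - (∑ x, ∑ y, if G.Adj x y then (v x - v y) • (D x - D y) else 0)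
        - (c * ∑ x, ∑ y, if G.Adj x y then (v x - v y) ^ 2 else 0) •
          (1 : Matrix (V → C) (V → C) ℝ) := by
    simp only [Finset.mul_sum, Finset.sum_smul, ← Finset.sum_sub_distrib]
    refine Finset.sum_congr rfl fun x _ => Finset.sum_congr rfl fun y _ => ?_
    split_ifs
    · rw [h1]
    · simp
  rw [generator, h4, h2, h3, loopGenerator, generator]
  simp only [Pi.zero_apply]
  module

/-- The infrared bound for the Duhamel two-point function. -/
theorem tsum_duhamel_le [Nonempty C] {β u : ℝ} (hβ : 0 ≤ β) (hu0 : 0 ≤ u) (hu1 : u ≤ 1 / 2)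
    (w : C → ℝ) (hG : G.Connected)
    (hrefl : ∀ x y, G.Adj x y → ∃ r H, IsReflection G r H ∧ r x = y) (v : V → ℝ)
    (X Y : Matrix (V → C) (V → C) ℝ) (hX : X = β • loopGenerator G C u)
    (hY : Y = β • ∑ x, laplacian G v x • siteOp x (Matrix.diagonal w)) :
    ∑' n : ℕ, ((n + 1).factorial : ℝ)⁻¹ *
        ∑ i ∈ Finset.range (n + 1), (Y * X ^ i * Y * X ^ (n - i)).trace
      ≤ (β * (∑ a, w a ^ 2) * ∑ x, v x * laplacian G v x) * (exp X).trace := by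
  set E := ∑ x, v x * laplacian G v x with hE
  refine matrix_tsum_le_of_trace_exp_le X Y _ fun s => ?_
  have hlap : ∀ x, laplacian G (fun x => -s * v x) x = -s * laplacian G v x := by
    intro x
    simp only [laplacian, Finset.mul_sum]
    exact Finset.sum_congr rfl fun y _ => by split_ifs <;> ring
  -- The field is -s v because the linear term enters `generator` with a minus sign; this gives +s
  -- Y.
  have hgen := generator_eq (G := G) u w fun x => -s * v x
  have hdom := fieldPartition_le hβ hu0 hu1 w hG hrefl fun x => -s * v x
  have h0 : fieldPartition G β u w 0 = (exp X).trace := by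
    rw [fieldPartition, generator_eq, hX]
    simp [laplacian]
  have hsum : (∑ x, (-s * v x) * (-s * laplacian G v x)) = s ^ 2 * E := by
    rw [hE, Finset.mul_sum]; exact Finset.sum_congr rfl fun x _ => by ring
  set r : ℝ := β * (∑ a, w a ^ 2) * E * s ^ 2 / 2 with hrdef
  -- Removing the scalar quadratic part of the generator costs only a factor e^r, so Gaussian
  -- domination becomes the hypothesis of `matrix_tsum_le_of_trace_exp_le`.
  have h1 : X + s • Y = β • generator G u w (fun x => -s * v x) + algebraMap ℝ _ r := by
    rw [hgen]
    simp only [hlap, hsum]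
    rw [Algebra.algebraMap_eq_smul_one, hX, hY, hrdef]
    have : (∑ x, (-s * laplacian G v x) • siteOp x (Matrix.diagonal w))
        = (-s) • ∑ x, laplacian G v x • (siteOp x (Matrix.diagonal w) :
          Matrix (V → C) (V → C) ℝ) := by
      rw [Finset.smul_sum]; simp only [smul_smul]
    rw [this]
    module
  rw [h1, trace_exp_add_algebraMap, ← h0]
  exact mul_le_mul_of_nonneg_left hdom (Real.exp_pos r).le

theorem reindex_loopGenerator (u : ℝ) (e : V ≃ V) (he : ∀ x y, G.Adj (e x) (e y) ↔ G.Adj x y) :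
    Matrix.reindexAlgEquiv ℝ ℝ (Equiv.arrowCongr e (Equiv.refl C)) (loopGenerator G C u)
      = loopGenerator G C u := by
  obtain ⟨φ, hφ⟩ : ∃ φ : Matrix (V → C) (V → C) ℝ →ₐ[ℝ] Matrix (V → C) (V → C) ℝ,
      ⇑φ = Matrix.reindexAlgEquiv ℝ ℝ (Equiv.arrowCongr e (Equiv.refl C)) :=
    ⟨(Matrix.reindexAlgEquiv ℝ ℝ (Equiv.arrowCongr e (Equiv.refl C))).toAlgHom, rfl⟩
  rw [← hφ]
  have hf : ∀ (x : V) (M : Matrix C C ℝ), φ (siteOp x M) = siteOp (e x) M :=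
    fun x M => by rw [hφ]; exact reindex_siteOp e x M
  have hbond : ∀ x y : V, φ (bond u (fun _ : C => 0) (siteOp x) (siteOp y) 0 0)
      = bond u (fun _ : C => 0) (siteOp (e x)) (siteOp (e y)) 0 0 := fun x y => by
    rw [map_bond]
    simp only [hf]
  rw [loopGenerator, generator, map_smul, map_sum]
  simp only [map_sum, apply_ite φ, map_zero, Pi.zero_apply, hbond]
  refine congrArg _ (Eq.trans ?_ (e.sum_comp fun x => ∑ y, if G.Adj x y then
    bond u (fun _ : C => 0) (siteOp x) (siteOp y) 0 0 else 0))
  refine Finset.sum_congr rfl fun x _ => Eq.trans ?_ (e.sum_comp fun y => if G.Adj (e x) y then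
    bond u (fun _ : C => 0) (siteOp (e x)) (siteOp y) 0 0 else 0)
  simp only [he]

end GaussianDomination

end RandomLoop

namespace RandomLoop

/-! ### Loops in discrete time -/

section DiscreteLoops

variable {V : Type*} [DecidableEq V] {G : SimpleGraph V}

/-- The transposition of the end points of an edge. -/
def edgeSwap : Sym2 V → Equiv.Perm V := Sym2.lift ⟨Equiv.swap, Equiv.swap_comm⟩

theorem edgeSwap_mk (x y : V) : edgeSwap s(x, y) = Equiv.swap x y := rfl

theorem edgeSwap_edgeSwap (e : Sym2 V) (x : V) : edgeSwap e (edgeSwap e x) = x := by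
  induction e with | _ a b => simp [edgeSwap_mk]

theorem edgeSwap_mem (e : Sym2 V) (x : V) : edgeSwap e x ∈ e ↔ x ∈ e := by
  induction e with | _ a b =>
    simp only [edgeSwap_mk, Sym2.mem_iff, Equiv.swap_apply_def]
    split_ifs <;> simp_all

theorem edgeSwap_of_notMem {e : Sym2 V} {x : V} (h : x ∉ e) : edgeSwap e x = x := by
  induction e with | _ a b =>
    rw [Sym2.mem_iff, not_or] at h
    exact Equiv.swap_apply_of_ne_of_ne h.1 h.2

/-- What happens to a path that arrives at `x` in the direction `δ` when it meets an event: the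
vertex and the direction in which it leaves. -/
def scatter : Option (Mark G) → V × ℤˣ → V × ℤˣ
  | none, p => p
  | some ⟨e, .cross⟩, p => (edgeSwap e p.1, p.2)
  | some ⟨e, .doubleBar⟩, p => if p.1 ∈ (e : Sym2 V) then (edgeSwap e p.1, -p.2) else p

/-- Time reversal: a path sent back where it came out leaves where it came in. This is what makes
the motion invertible. -/
theorem scatter_neg (o : Option (Mark G)) (p : V × ℤˣ) :
    scatter o ((scatter o p).1, -(scatter o p).2) = (p.1, -p.2) := by
  match o with
  | none => rfl
  | some ⟨e, .cross⟩ => simp [scatter, edgeSwap_edgeSwap]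
  | some ⟨e, .doubleBar⟩ =>
    by_cases h : p.1 ∈ (e : Sym2 V)
    · simp [scatter, h, edgeSwap_mem, edgeSwap_edgeSwap]
    · simp [scatter, h]

theorem scatter_of_notMem {μ : Mark G} {x : V} (h : x ∉ (μ.edge : Sym2 V)) (δ : ℤˣ) :
    scatter (some μ) (x, δ) = (x, δ) := by
  match μ, h with
  | ⟨e, .cross⟩, h => simp [scatter, edgeSwap_of_notMem h]
  | ⟨e, .doubleBar⟩, h => simp [scatter, h]

theorem scatter_of_cross {μ : Mark G} {x y : V} (hk : μ.kind = .cross)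
    (he : (μ.edge : Sym2 V) = s(x, y)) (δ : ℤˣ) : scatter (some μ) (x, δ) = (y, δ) := by
  obtain ⟨e, k⟩ := μ
  simp only at hk he
  subst hk
  simp [scatter, he, edgeSwap_mk]

theorem scatter_of_doubleBar {μ : Mark G} {x y : V} (hk : μ.kind = .doubleBar)
    (he : (μ.edge : Sym2 V) = s(x, y)) (δ : ℤˣ) : scatter (some μ) (x, δ) = (y, -δ) := by
  obtain ⟨e, k⟩ := μ
  simp only at hk he
  subst hk
  simp [scatter, he, edgeSwap_mk]

variable {n : ℕ}

/-- The events in cyclic order: the given ones, then a trivial one at the end of the period. -/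
def eventMark (m : Fin n → Mark G) : Fin (n + 1) → Option (Mark G) :=
  Fin.lastCases none fun i => some (m i)

theorem eventMark_last (m : Fin n → Mark G) : eventMark m (Fin.last n) = none := by
  simp [eventMark]

theorem eventMark_castSucc (m : Fin n → Mark G) (i : Fin n) :
    eventMark m i.castSucc = some (m i) := by
  simp [eventMark]

/-- The time slot in which a path in the direction `δ` is just before the event `e`. -/
def inSlot (e : Fin (n + 1)) (δ : ℤˣ) : Fin (n + 1) := if δ = 1 then e else e + 1

/-- The time slot in which a path in the direction `δ` is just after the event `e`. -/
def outSlot (e : Fin (n + 1)) (δ : ℤˣ) : Fin (n + 1) := if δ = 1 then e + 1 else e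

/-- The event that is met by a path in the slot `j` in the direction `δ`. -/
def nextEvent (j : Fin (n + 1)) (δ : ℤˣ) : Fin (n + 1) := if δ = 1 then j else j - 1

theorem inSlot_nextEvent (j : Fin (n + 1)) (δ : ℤˣ) : inSlot (nextEvent j δ) δ = j := by
  by_cases h : δ = 1 <;> simp [inSlot, nextEvent, h]

theorem nextEvent_inSlot (e : Fin (n + 1)) (δ : ℤˣ) : nextEvent (inSlot e δ) δ = e := by
  by_cases h : δ = 1 <;> simp [inSlot, nextEvent, h]

theorem neg_eq_one_iff_ne (δ : ℤˣ) : -δ = 1 ↔ δ ≠ 1 := by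
  rcases Int.units_eq_one_or δ with rfl | rfl <;> decide

theorem inSlot_neg (e : Fin (n + 1)) (δ : ℤˣ) : inSlot e (-δ) = outSlot e δ := by
  by_cases h : δ = 1 <;> simp [inSlot, outSlot, neg_eq_one_iff_ne, h]

theorem outSlot_neg (e : Fin (n + 1)) (δ : ℤˣ) : outSlot e (-δ) = inSlot e δ := by
  rw [← inSlot_neg, neg_neg]

/-- A path in the slot `s.2.1`, at the vertex `s.1`, in the direction `s.2.2`, after the next
event. -/
def step (m : Fin n → Mark G) (s : V × Fin (n + 1) × ℤˣ) : V × Fin (n + 1) × ℤˣ :=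
  let e := nextEvent s.2.1 s.2.2
  let p := scatter (eventMark m e) (s.1, s.2.2)
  (p.1, outSlot e p.2, p.2)

theorem step_inSlot (m : Fin n → Mark G) (x : V) (e : Fin (n + 1)) (δ : ℤˣ) :
    step m (x, inSlot e δ, δ) = ((scatter (eventMark m e) (x, δ)).1,
      outSlot e (scatter (eventMark m e) (x, δ)).2, (scatter (eventMark m e) (x, δ)).2) := by
  simp only [step, nextEvent_inSlot]

/-- Reversal of the direction. -/
def turn (s : V × Fin (n + 1) × ℤˣ) : V × Fin (n + 1) × ℤˣ := (s.1, s.2.1, -s.2.2)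

theorem turn_turn (s : V × Fin (n + 1) × ℤˣ) : turn (turn s) = s := by simp [turn]

/-- By `scatter_neg`, a reversed path retraces its last step. Hence turn ∘ step ∘ turn inverts
`step`. -/
theorem step_turn_step (m : Fin n → Mark G) (s : V × Fin (n + 1) × ℤˣ) :
    step m (turn (step m s)) = turn s := by
  obtain ⟨x, j, δ⟩ := s
  obtain ⟨e, rfl⟩ : ∃ e, j = inSlot e δ := ⟨_, (inSlot_nextEvent j δ).symm⟩
  rw [step_inSlot]
  simp only [turn]
  rw [← inSlot_neg, step_inSlot, scatter_neg]
  simp [outSlot_neg]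

/-- The motion along the loops, as a permutation. -/
def stepPerm (m : Fin n → Mark G) : Equiv.Perm (V × Fin (n + 1) × ℤˣ) where
  toFun := step m
  invFun s := turn (step m (turn s))
  left_inv s := by
    change turn (step m (turn (step m s))) = s
    rw [step_turn_step, turn_turn]
  right_inv s := by
    have h := step_turn_step m (turn s)
    rw [turn_turn] at h
    exact h

theorem stepPerm_inv (m : Fin n → Mark G) (s : V × Fin (n + 1) × ℤˣ) :
    (stepPerm m)⁻¹ s = turn (step m (turn s)) := rfl

/-- Reversal conjugates the motion to its inverse, and a permutation has the same cycles as its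
inverse. -/
theorem sameCycle_turn (m : Fin n → Mark G) {s s' : V × Fin (n + 1) × ℤˣ}
    (h : (stepPerm m).SameCycle s s') : (stepPerm m).SameCycle (turn s) (turn s') := by
  have hc : ∀ s, turn (stepPerm m s) = (stepPerm m)⁻¹ (turn s) := fun s => by
    rw [stepPerm_inv, turn_turn]; rfl
  let t : Equiv.Perm (V × Fin (n + 1) × ℤˣ) := ⟨turn, turn, turn_turn, turn_turn⟩
  have h1 : t * stepPerm m * t⁻¹ = (stepPerm m)⁻¹ := by
    ext1 s
    change turn (stepPerm m (turn s)) = _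
    rw [hc, turn_turn]
  have h2 := h.conj (g := t)
  rw [h1] at h2
  exact Equiv.Perm.sameCycle_inv.1 h2

/-- Two sites of the discrete space-time are related if one of them follows the other along a
loop. -/
def loopRel (m : Fin n → Mark G) (p q : V × Fin (n + 1)) : Prop :=
  ∃ δ, (step m (p.1, p.2, δ)).1 = q.1 ∧ (step m (p.1, p.2, δ)).2.1 = q.2

/-- The loops in discrete space-time. -/
abbrev LoopClass (m : Fin n → Mark G) := Quot (loopRel m)

noncomputable instance [Fintype V] (m : Fin n → Mark G) : Fintype (LoopClass m) :=
  Fintype.ofFinite _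

/-- The loop that contains a site of the discrete space-time. -/
abbrev loopClass (m : Fin n → Mark G) (x : V) (j : Fin (n + 1)) : LoopClass m := Quot.mk _ (x, j)

theorem loopClass_inSlot (m : Fin n → Mark G) (x : V) (e : Fin (n + 1)) (δ : ℤˣ) :
    loopClass m x (inSlot e δ) = loopClass m (scatter (eventMark m e) (x, δ)).1
      (outSlot e (scatter (eventMark m e) (x, δ)).2) :=
  Quot.sound ⟨δ, by simp only [step_inSlot, and_self]⟩

/-- Classes ignore the direction of travel, cycles do not. Whenever a relation is given for the
wrong direction, `sameCycle_turn` reverses it, so the initial direction `δ` can be prescribed. -/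
theorem exists_sameCycle_of_loopClass_eq (m : Fin n → Mark G) {p q : V × Fin (n + 1)}
    (h : (Quot.mk (loopRel m) p) = Quot.mk _ q) (δ : ℤˣ) :
    ∃ δ', (stepPerm m).SameCycle (p.1, p.2, δ) (q.1, q.2, δ') := by
  have hstep : ∀ s, (stepPerm m).SameCycle s (step m s) := fun s =>
    (Equiv.Perm.SameCycle.refl _ s).apply_right
  induction Quot.eqvGen_exact h generalizing δ with
  | refl p => exact ⟨δ, Equiv.Perm.SameCycle.refl _ _⟩
  | rel p q hpq =>
    obtain ⟨δ', h1, h2⟩ := hpq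
    have hs := hstep (p.1, p.2, δ')
    set s := step m (p.1, p.2, δ') with hsdef
    have hsq : s = (q.1, q.2, s.2.2) := by rw [← h1, ← h2]
    rw [hsq] at hs
    by_cases hδ : δ = δ'
    · subst hδ; exact ⟨_, hs⟩
    · obtain rfl : δ = -δ' := Int.units_ne_iff_eq_neg.1 hδ
      exact ⟨_, sameCycle_turn m hs⟩
  | symm p q hpq ih =>
    obtain ⟨δ', h1⟩ := ih (Quot.eqvGen_sound hpq) δ
    by_cases hδ : δ' = δ
    · subst hδ; exact ⟨_, h1.symm⟩
    · obtain rfl : δ = -δ' := Int.units_ne_iff_eq_neg.1 (Ne.symm hδ)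
      exact ⟨_, sameCycle_turn m h1.symm⟩
  | trans p q r hpq hqr ih1 ih2 =>
    obtain ⟨δ₁, h1⟩ := ih1 (Quot.eqvGen_sound hpq) δ
    obtain ⟨δ₂, h2⟩ := ih2 (Quot.eqvGen_sound hqr) δ₁
    exact ⟨δ₂, h1.trans h2⟩

/-! ### Colourings of the loops -/

variable {C : Type*}

/-- The colourings on the two sides of an event are compatible with the paths. -/
def Compatible (o : Option (Mark G)) (σ σ' : V → C) : Prop :=
  ∀ x δ, (if δ = 1 then σ else σ') x =
    (if (scatter o (x, δ)).2 = 1 then σ' else σ) (scatter o (x, δ)).1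

theorem compatible_none (σ σ' : V → C) : Compatible (none : Option (Mark G)) σ σ' ↔ σ = σ' := by
  refine ⟨fun h => funext fun x => by simpa [scatter] using h x 1, ?_⟩
  rintro rfl x δ
  by_cases h : δ = 1 <;> simp [scatter, h]

/-- The slots e and e + 1 are the two sides of event e. Addition is cyclic, so the trivial event at
the end of the period imposes that the colouring closes up in time. -/
theorem forall_compatible_iff (m : Fin n → Mark G) (c : Fin (n + 1) → V → C) :
    (∀ e, Compatible (eventMark m e) (c e) (c (e + 1))) ↔
      ∀ p q, loopRel m p q → c p.2 p.1 = c q.2 q.1 := by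
  have key : ∀ x e δ, ((if δ = 1 then c e else c (e + 1)) x =
      (if (scatter (eventMark m e) (x, δ)).2 = 1 then c (e + 1) else c e)
        (scatter (eventMark m e) (x, δ)).1) ↔
      c (inSlot e δ) x = c (step m (x, inSlot e δ, δ)).2.1 (step m (x, inSlot e δ, δ)).1 := by
    intro x e δ
    rw [step_inSlot]
    simp only [inSlot, outSlot, apply_ite c]
  constructor
  · rintro h ⟨x, j⟩ ⟨y, k⟩ ⟨δ, h1, h2⟩
    obtain ⟨e, rfl⟩ : ∃ e, j = inSlot e δ := ⟨_, (inSlot_nextEvent j δ).symm⟩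
    have := (key x e δ).1 (h e x δ)
    simp only at h1 h2 ⊢
    rw [this, h1, h2]
  · intro h e x δ
    rw [key]
    exact h (x, _) (_, _) ⟨δ, rfl, rfl⟩

open scoped Classical in
theorem sum_compatible [Fintype V] [Fintype C] {M : Type*} [AddCommMonoid M] (m : Fin n → Mark G)
    (F : (Fin (n + 1) → V → C) → M) :
    (∑ c, if ∀ e, Compatible (eventMark m e) (c e) (c (e + 1)) then F c else 0)
      = ∑ f : LoopClass m → C, F fun j x => f (loopClass m x j) := by
  rw [← Finset.sum_filter]
  refine Finset.sum_bij' (fun c hc q => Quot.liftOn q (fun p => c p.2 p.1) ?_)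
    (fun f _ j x => f (loopClass m x j)) ?_ ?_ ?_ ?_ ?_
  · exact fun p q h => (forall_compatible_iff m c).1 (by simpa using hc) p q h
  · simp
  · intro f _
    rw [Finset.mem_filter, forall_compatible_iff]
    exact ⟨Finset.mem_univ _, fun p q h => congrArg f (Quot.sound h)⟩
  · intro c _; rfl
  · intro f _
    funext q
    induction q using Quot.ind
    rfl
  · intro c _; rfl

open scoped Classical in
-- The colours of distinct loops are independent and `w` has mean zero, so only q = q' survives. The
-- prefactor avoids the exponent |Q| - 1.
theorem sum_colouring_two_point {Q : Type*} [Fintype Q] [Fintype C] (w : C → ℝ)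
    (hw : ∑ a, w a = 0) (q q' : Q) :
    (Fintype.card C : ℝ) * ∑ f : Q → C, w (f q) * w (f q') =
      if q = q' then (∑ a, w a ^ 2) * (Fintype.card C : ℝ) ^ Fintype.card Q else 0 := by
  have h1 : ∀ f : Q → C, w (f q) * w (f q')
      = ∏ z, (if z = q then w (f z) else 1) * (if z = q' then w (f z) else 1) := by
    intro f; rw [Finset.prod_mul_distrib]; simp
  have h2 : ∑ f : Q → C, w (f q) * w (f q')
      = ∏ z, ∑ a, (if z = q then w a else 1) * (if z = q' then w a else 1) := by
    simp_rw [h1]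
    rw [Finset.prod_univ_sum, Fintype.piFinset_univ]
  rw [h2]
  split_ifs with h
  · subst h
    have h3 : ∀ z, ∑ a, (if z = q then w a else 1) * (if z = q then w a else 1)
        = if z = q then ∑ a, w a ^ 2 else (Fintype.card C : ℝ) := by
      intro z; split_ifs <;> simp [pow_two]
    simp_rw [h3]
    rw [← Finset.mul_prod_erase Finset.univ _ (Finset.mem_univ q), if_pos rfl,
      Finset.prod_congr rfl (g := fun _ => (Fintype.card C : ℝ))
        (fun z hz => if_neg (Finset.ne_of_mem_erase hz)),
      Finset.prod_const, Finset.card_erase_of_mem (Finset.mem_univ q), Finset.card_univ]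
    have : Fintype.card Q ≠ 0 := (Fintype.card_pos_iff.2 ⟨q⟩).ne'
    obtain ⟨k, hk⟩ := Nat.exists_eq_succ_of_ne_zero this
    rw [hk]; simp only [Nat.succ_eq_add_one, Nat.add_sub_cancel, pow_succ]; ring
  · rw [Finset.prod_eq_zero (Finset.mem_univ q), mul_zero]
    simp [h, hw]

end DiscreteLoops

end RandomLoop

namespace RandomLoop

open Filter Topology

/-! ### From loops in continuous time to loops in discrete time -/

section ContinuousTime

variable {V : Type*} {G : SimpleGraph V} {β : ℝ}

theorem shift_zero (t : AddCircle β) (δ : ℤˣ) : shift t δ 0 = t := by simp [shift]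

theorem shift_one (t : AddCircle β) (s : ℝ) : shift t 1 s = t + (s : AddCircle β) := by
  simp [shift]

theorem shift_neg (t : AddCircle β) (δ : ℤˣ) (s : ℝ) : shift t (-δ) s = shift t δ (-s) := by
  simp [shift]

theorem shift_shift (t : AddCircle β) (δ : ℤˣ) (s r : ℝ) :
    shift (shift t δ s) δ r = shift t δ (s + r) := by
  simp only [shift, add_assoc, ← AddCircle.coe_add, mul_add]

theorem Configuration.mem_ofTuple {X : Type*} {n : ℕ} (p : Fin n → X) (a : X) :
    a ∈ (Configuration.ofTuple p).points ↔ ∃ i, p i = a := by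
  simp [Configuration.ofTuple]

/-- The motion is reversible. -/
theorem Move.reverse {ω : Configuration (Event G)} {x y : V} {t₀ t : AddCircle β} {δ δ' : ℤˣ}
    (h : Move β ω (x, t₀, δ) (y, t, δ')) : Move β ω (y, t, -δ') (x, t₀, -δ) := by
  cases h with
  | travel x t δ s hs free =>
    have h := Move.travel x (shift t₀ δ s) (-δ) s hs (ω := ω) (fun r hr => by
      rw [shift_neg, shift_shift]
      exact free (s + -r) ⟨by linarith [hr.2], by linarith [hr.1]⟩)
    rwa [shift_neg, shift_shift, add_neg_cancel, shift_zero] at h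
  | cross x y t δ h hh link free =>
    have h := Move.cross y x t (-δ) h hh (ω := ω) (by
      obtain ⟨a, h1, h2, h3, h4⟩ := link
      exact ⟨a, h1, h2, h3.trans Sym2.eq_swap, h4⟩) (fun r hr => by
      rw [shift_neg, shift_neg, neg_neg]
      exact (free r hr).symm)
    rwa [shift_neg, shift_neg, neg_neg] at h
  | doubleBar x y t δ h hh link free =>
    have h := Move.doubleBar y x t δ h hh (ω := ω) (by
      obtain ⟨a, h1, h2, h3, h4⟩ := link
      exact ⟨a, h1, h2, h3.trans Sym2.eq_swap, h4⟩) (fun r hr => (free r hr).symm)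
    rwa [neg_neg]

theorem reverse_reflTransGen {ω : Configuration (Event G)} {p q : V × AddCircle β × ℤˣ}
    (h : Relation.ReflTransGen (Move β ω) p q) :
    Relation.ReflTransGen (Move β ω) (q.1, q.2.1, -q.2.2) (p.1, p.2.1, -p.2.2) := by
  induction h with
  | refl => exact .refl
  | tail _ h ih => exact .head (Move.reverse h) ih

variable {n : ℕ}

/-- The end of a time slot. -/
noncomputable def slotEnd (β : ℝ) (τ : Fin n → ℝ) : Fin (n + 1) → ℝ := Fin.lastCases β τ

/-- The beginning of a time slot. -/
noncomputable def slotStart (τ : Fin n → ℝ) : Fin (n + 1) → ℝ := Fin.cases 0 τ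

/-- The times of the events are increasing and in the open period. -/
structure Ordered (β : ℝ) (τ : Fin n → ℝ) : Prop where
  mono : StrictMono τ
  pos : ∀ i, 0 < τ i
  lt : ∀ i, τ i < β

/-- The time at which an event occurs; the trivial event occurs at the end of the period. -/
noncomputable def eventTime (β : ℝ) (τ : Fin n → ℝ) (e : Fin (n + 1)) : AddCircle β :=
  (slotEnd β τ e : ℝ)

theorem eventTime_eq (τ : Fin n → ℝ) (e : Fin (n + 1)) :
    eventTime β τ e = (slotStart τ (e + 1) : ℝ) := by
  induction e using Fin.lastCases with
  | last => simp [eventTime, slotEnd, slotStart, AddCircle.coe_period]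
  | cast i => simp [eventTime, slotEnd, slotStart]

theorem eventTime_castSucc (τ : Fin n → ℝ) (i : Fin n) :
    eventTime β τ i.castSucc = (τ i : ℝ) := by simp [eventTime, slotEnd]

namespace Ordered

variable [hβ : Fact (0 < β)] {τ : Fin n → ℝ} (hτ : Ordered β τ)
include hτ

theorem slotEnd_le_slotStart {j k : Fin (n + 1)} (h : j < k) : slotEnd β τ j ≤ slotStart τ k := by
  induction j using Fin.lastCases with
  | last => exact absurd h (Fin.le_last k).not_gt
  | cast i =>
    induction k using Fin.cases with
    | zero => exact absurd h (by simp)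
    | succ k =>
      simp only [slotEnd, slotStart, Fin.lastCases_castSucc, Fin.cases_succ]
      exact hτ.mono.monotone (Fin.castSucc_lt_succ_iff.1 h)

theorem slotStart_lt_slotEnd (j : Fin (n + 1)) : slotStart τ j < slotEnd β τ j := by
  induction j using Fin.lastCases with
  | last =>
    rw [slotEnd, Fin.lastCases_last]
    generalize Fin.last n = k
    induction k using Fin.cases with
    | zero => simpa [slotStart] using hβ.out
    | succ k => simpa [slotStart] using hτ.lt k
  | cast i =>
    rw [slotEnd, Fin.lastCases_castSucc]
    generalize hk : i.castSucc = k
    induction k using Fin.cases with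
    | zero => simpa [slotStart] using hτ.pos i
    | succ k =>
      simp only [slotStart, Fin.cases_succ]
      refine hτ.mono ?_
      rw [Fin.lt_def]
      have := congrArg Fin.val hk
      simp at this
      omega

theorem slotStart_nonneg (j : Fin (n + 1)) : 0 ≤ slotStart τ j := by
  induction j using Fin.cases with
  | zero => simp [slotStart]
  | succ i => simpa [slotStart] using (hτ.pos i).le

theorem slotEnd_le (j : Fin (n + 1)) : slotEnd β τ j ≤ β := by
  induction j using Fin.lastCases with
  | last => simp [slotEnd]
  | cast i => simpa [slotEnd] using (hτ.lt i).le

theorem exists_slot (t : AddCircle β) :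
    ∃ j, ∃ a : ℝ, slotStart τ j ≤ a ∧ a < slotEnd β τ j ∧ (a : AddCircle β) = t := by
  obtain ⟨a, ha, rfl⟩ : ∃ a ∈ Set.Ico (0 : ℝ) (0 + β), (a : AddCircle β) = t :=
    ⟨_, (AddCircle.equivIco β 0 t).2, AddCircle.coe_equivIco⟩
  rw [zero_add] at ha
  let S := Finset.univ.filter fun j => slotStart τ j ≤ a
  have hS : S.Nonempty := ⟨0, Finset.mem_filter.2 ⟨Finset.mem_univ _, ha.1⟩⟩
  have hmem := S.max'_mem hS
  refine ⟨S.max' hS, a, (Finset.mem_filter.1 hmem).2, ?_, rfl⟩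
  generalize hj : S.max' hS = j
  induction j using Fin.lastCases with
  | last => simpa [slotEnd] using ha.2
  | cast i =>
    by_contra! h
    have h1 : i.succ ∈ S := by
      simp only [S, Finset.mem_filter, Finset.mem_univ, true_and]
      simpa [slotEnd, slotStart] using h
    have h2 := S.le_max' _ h1
    rw [hj] at h2
    exact absurd h2 (Fin.castSucc_lt_succ).not_ge

theorem slot_unique {j k : Fin (n + 1)} {a b : ℝ} (ha : slotStart τ j ≤ a)
    (ha' : a < slotEnd β τ j) (hb : slotStart τ k ≤ b) (hb' : b < slotEnd β τ k)
    (hab : (a : AddCircle β) = b) : j = k ∧ a = b := by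
  have hab' : a = b := by
    refine (AddCircle.coe_eq_coe_iff_of_mem_Ico (p := β) (a := 0) ?_ ?_).1 hab
    · exact ⟨(hτ.slotStart_nonneg j).trans ha, by linarith [hτ.slotEnd_le j]⟩
    · exact ⟨(hτ.slotStart_nonneg k).trans hb, by linarith [hτ.slotEnd_le k]⟩
  subst hab'
  refine ⟨?_, rfl⟩
  rcases lt_trichotomy j k with h | h | h
  · exact absurd (hτ.slotEnd_le_slotStart h) (by linarith)
  · exact h
  · exact absurd (hτ.slotEnd_le_slotStart h) (by linarith)

omit hτ in
variable (τ) in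
open scoped Classical in
/-- The time slot that contains a given time. -/
noncomputable def _root_.RandomLoop.slotAt (t : AddCircle β) : Fin (n + 1) :=
  if h : ∃ j, ∃ a : ℝ, slotStart τ j ≤ a ∧ a < slotEnd β τ j ∧ (a : AddCircle β) = t then h.choose
  else 0

theorem slotAt_coe {j : Fin (n + 1)} {a : ℝ} (h1 : slotStart τ j ≤ a) (h2 : a < slotEnd β τ j) :
    slotAt τ (a : AddCircle β) = j := by
  have h : ∃ j, ∃ b : ℝ, slotStart τ j ≤ b ∧ b < slotEnd β τ j ∧
    (b : AddCircle β) = (a : AddCircle β) := ⟨j, a, h1, h2, rfl⟩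
  rw [slotAt, dif_pos h]
  obtain ⟨b, hb1, hb2, hb3⟩ := h.choose_spec
  exact (hτ.slot_unique hb1 hb2 h1 h2 hb3).1

theorem eventTime_injective : Function.Injective (eventTime β τ) := by
  intro e e' h
  rw [eventTime_eq, eventTime_eq] at h
  exact add_right_cancel (hτ.slot_unique le_rfl (hτ.slotStart_lt_slotEnd _) le_rfl
    (hτ.slotStart_lt_slotEnd _) h).1

/-- Within a distance less than this ε on either side of an event, no other event is met. -/
theorem exists_slotWidth : ∃ ε > 0, ∀ j, ε ≤ slotEnd β τ j - slotStart τ j := by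
  obtain ⟨j, -, hj⟩ := Finset.exists_min_image Finset.univ
    (fun j => slotEnd β τ j - slotStart τ j) ⟨0, Finset.mem_univ _⟩
  exact ⟨_, sub_pos.2 (hτ.slotStart_lt_slotEnd j), fun k => hj k (Finset.mem_univ k)⟩

omit [hβ : Fact (0 < β)] hτ in
theorem shift_eventTime_one (e : Fin (n + 1)) (r : ℝ) :
    shift (eventTime β τ e) 1 r = ((slotStart τ (e + 1) + r : ℝ) : AddCircle β) := by
  rw [shift_one, eventTime_eq, AddCircle.coe_add]

omit [hβ : Fact (0 < β)] hτ in
theorem shift_eventTime_neg_one (e : Fin (n + 1)) (r : ℝ) :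
    shift (eventTime β τ e) (-1) r = ((slotEnd β τ e - r : ℝ) : AddCircle β) := by
  rw [shift_neg, shift_one, eventTime, ← AddCircle.coe_add, sub_eq_add_neg]

theorem slotAt_shift_eventTime {ε : ℝ} (hε : ∀ j, ε ≤ slotEnd β τ j - slotStart τ j)
    (e : Fin (n + 1)) (δ : ℤˣ) {r : ℝ} (h0 : 0 < r) (hr : r < ε) :
    slotAt τ (shift (eventTime β τ e) δ r) = outSlot e δ := by
  rcases Int.units_eq_one_or δ with rfl | rfl
  · rw [shift_eventTime_one, hτ.slotAt_coe (j := e + 1) (by linarith) (by linarith [hε (e + 1)])]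
    simp [outSlot]
  · rw [shift_eventTime_neg_one, hτ.slotAt_coe (j := e) (by linarith [hε e]) (by linarith)]
    simp [outSlot]

variable [DecidableEq V] (m : Fin n → Mark G)

omit [hβ : Fact (0 < β)] hτ [DecidableEq V] in
variable (τ) in
/-- The configuration with events `m` at times `τ`. -/
noncomputable abbrev _root_.RandomLoop.orderedConfig : Configuration (Event G) :=
  Configuration.ofTuple fun i => (m i, τ i)

omit [hβ : Fact (0 < β)] hτ [DecidableEq V] in
theorem inSupport_iff (x : V) (t : AddCircle β) :
    InSupport β (orderedConfig τ m) (x, t) ↔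
      ∃ i, x ∈ ((m i).edge : Sym2 V) ∧ eventTime β τ i.castSucc = t := by
  constructor
  · rintro ⟨k, y, a, ha, -, h2, h3⟩
    obtain ⟨i, rfl⟩ := (Configuration.mem_ofTuple _ _).1 ha
    exact ⟨i, by rw [h2]; simp, by rw [eventTime_castSucc]; exact h3⟩
  · rintro ⟨i, hx, ht⟩
    obtain ⟨y, hy⟩ := Sym2.mem_iff_exists.1 hx
    exact ⟨_, y, (m i, τ i), (Configuration.mem_ofTuple _ _).2 ⟨i, rfl⟩, rfl, hy, by
      rw [← eventTime_castSucc, ht]⟩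

omit [hβ : Fact (0 < β)] hτ [DecidableEq V] in
theorem exists_of_hasLink {k : LinkKind} {x y : V} {t : AddCircle β}
    (h : HasLink β (orderedConfig τ m) k x y t) :
    ∃ i, (m i).kind = k ∧ ((m i).edge : Sym2 V) = s(x, y) ∧ t = eventTime β τ i.castSucc := by
  obtain ⟨a, ha, h1, h2, h3⟩ := h
  obtain ⟨i, rfl⟩ := (Configuration.mem_ofTuple _ _).1 ha
  exact ⟨i, h1, h2, by rw [eventTime_castSucc]; exact h3.symm⟩

omit [hβ : Fact (0 < β)] hτ [DecidableEq V] in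
theorem hasLink (i : Fin n) {x y : V} (h : ((m i).edge : Sym2 V) = s(x, y)) :
    HasLink β (orderedConfig τ m) (m i).kind x y (eventTime β τ i.castSucc) :=
  ⟨(m i, τ i), (Configuration.mem_ofTuple _ _).2 ⟨i, rfl⟩, rfl, h, (eventTime_castSucc τ i).symm⟩

omit [DecidableEq V] in
theorem not_inSupport_of_interior {j : Fin (n + 1)} {a : ℝ} (h1 : slotStart τ j < a)
    (h2 : a < slotEnd β τ j) (x : V) : ¬ InSupport β (orderedConfig τ m) (x, (a : AddCircle β)) := by
  rw [inSupport_iff]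
  rintro ⟨i, -, h⟩
  rw [eventTime_eq] at h
  obtain ⟨rfl, h3⟩ := hτ.slot_unique le_rfl (hτ.slotStart_lt_slotEnd _) h1.le h2 h
  exact h1.ne h3

omit [DecidableEq V] in
theorem not_inSupport_shift_eventTime {ε : ℝ} (hε : ∀ j, ε ≤ slotEnd β τ j - slotStart τ j)
    (e : Fin (n + 1)) (δ : ℤˣ) {r : ℝ} (h0 : 0 < r) (hr : r < ε) (x : V) :
    ¬ InSupport β (orderedConfig τ m) (x, shift (eventTime β τ e) δ r) := by
  rcases Int.units_eq_one_or δ with rfl | rfl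
  · rw [shift_eventTime_one]
    exact hτ.not_inSupport_of_interior m (j := e + 1) (by linarith) (by linarith [hε (e + 1)]) x
  · rw [shift_eventTime_neg_one]
    exact hτ.not_inSupport_of_interior m (j := e) (by linarith [hε e]) (by linarith) x

theorem scatter_of_not_inSupport {x : V} {e : Fin (n + 1)}
    (h : ¬ InSupport β (orderedConfig τ m) (x, eventTime β τ e)) (δ : ℤˣ) :
    scatter (eventMark m e) (x, δ) = (x, δ) := by
  induction e using Fin.lastCases with
  | last => rw [eventMark_last]; rfl
  | cast i =>
    rw [eventMark_castSucc]
    refine scatter_of_notMem (fun hx => h ?_) δ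
    rw [inSupport_iff]
    exact ⟨i, hx, rfl⟩

/-! #### The loops do not leave their classes -/

omit [hβ : Fact (0 < β)] hτ in
variable (τ) in
/-- The discrete loop at a point of space-time. -/
noncomputable abbrev _root_.RandomLoop.classAt (p : V × AddCircle β) : LoopClass m :=
  loopClass m p.1 (slotAt τ p.2)

/-- Inside a slot this is clear. At the boundary of two slots, the event there does not touch x, so
`scatter` is trivial and both slots at x lie in the same class. -/
theorem eventually_classAt_eq {x : V} {t : AddCircle β}
    (h : ¬ InSupport β (orderedConfig τ m) (x, t)) :
    ∀ᶠ s : ℝ in 𝓝 0, classAt τ m (x, t + (s : AddCircle β)) = classAt τ m (x, t) := by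
  obtain ⟨j, a, h1, h2, rfl⟩ := hτ.exists_slot t
  rcases h1.lt_or_eq with h1' | h1'
  · have : ∀ᶠ s : ℝ in 𝓝 0, a + s ∈ Set.Ioo (slotStart τ j) (slotEnd β τ j) := by
      have hc : Tendsto (fun s : ℝ => a + s) (𝓝 0) (𝓝 a) := by
        simpa using (tendsto_id (α := ℝ) (x := 𝓝 0)).const_add a
      exact hc.eventually (Ioo_mem_nhds h1' h2)
    filter_upwards [this] with s hs
    rw [← AddCircle.coe_add]
    simp only [classAt]
    rw [hτ.slotAt_coe hs.1.le hs.2, hτ.slotAt_coe h1 h2]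
  · obtain ⟨ε, hε0, hε⟩ := hτ.exists_slotWidth
    obtain ⟨e, rfl⟩ : ∃ e, j = e + 1 := ⟨j - 1, by simp⟩
    have hclass := loopClass_inSlot m x e 1
    have hat : (a : AddCircle β) = eventTime β τ e := by rw [eventTime_eq, h1']
    rw [hat] at h
    rw [hτ.scatter_of_not_inSupport m h] at hclass
    simp only [inSlot, outSlot, if_true] at hclass
    filter_upwards [Ioo_mem_nhds (neg_lt_zero.2 hε0) hε0] with s hs
    simp only [classAt]
    rw [hτ.slotAt_coe h1 h2]
    rcases lt_or_ge s 0 with hs0 | hs0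
    · rw [hat, ← hclass, ← shift_one, ← neg_neg s, ← shift_neg,
        hτ.slotAt_shift_eventTime hε e (-1) (by linarith) (by linarith [hs.1])]
      simp [outSlot]
    · rw [← AddCircle.coe_add, hτ.slotAt_coe (j := e + 1) (by linarith)
        (by linarith [hs.2, hε (e + 1)])]

theorem classAt_eq_of_isPreconnected {x : V} {t : AddCircle β} {δ : ℤˣ} {S : Set ℝ}
    (hS : IsPreconnected S)
    (h : ∀ r ∈ S, ¬ InSupport β (orderedConfig τ m) (x, shift t δ r)) {r r' : ℝ} (hr : r ∈ S)
    (hr' : r' ∈ S) : classAt τ m (x, shift t δ r) = classAt τ m (x, shift t δ r') := by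
  let _ : TopologicalSpace (LoopClass m) := ⊥
  have : DiscreteTopology (LoopClass m) := ⟨rfl⟩
  refine hS.constant (f := fun r => classAt τ m (x, shift t δ r)) (fun r hr => ?_) hr hr'
  have h1 := hτ.eventually_classAt_eq m (h r hr)
  have hc : Tendsto (fun r' : ℝ => ((δ : ℤ) : ℝ) * (r' - r)) (𝓝 r) (𝓝 0) := by
    have : Continuous fun r' : ℝ => ((δ : ℤ) : ℝ) * (r' - r) := by fun_prop
    simpa using this.tendsto r
  refine (continuousAt_const (y := classAt τ m (x, shift t δ r)).congr ?_).continuousWithinAt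
  filter_upwards [hc.eventually h1] with r' hr'
  rw [← hr']
  congr 2
  simp only [shift, add_assoc, ← AddCircle.coe_add]
  congr 2
  ring

theorem classAt_eq_of_move {x y : V} {s t : AddCircle β} {δ δ' : ℤˣ}
    (h : Move β (orderedConfig τ m) (x, s, δ) (y, t, δ')) :
    ¬ InSupport β (orderedConfig τ m) (y, t) ∧ classAt τ m (x, s) = classAt τ m (y, t) := by
  obtain ⟨ε, hε0, hε⟩ := hτ.exists_slotWidth
  cases h with
  | travel x t δ s hs free =>
    refine ⟨free _ ⟨hs, le_rfl⟩, ?_⟩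
    have := hτ.classAt_eq_of_isPreconnected m isPreconnected_Icc free (r := 0) (r' := _)
      ⟨le_rfl, hs⟩ ⟨hs, le_rfl⟩
    rwa [shift_zero] at this
  | cross x y t δ h hh link free =>
    refine ⟨(free h ⟨hh, le_rfl⟩).2, ?_⟩
    -- The distance `h` in the move may span several slots. The class is constant along the free
    -- segments, so it suffices to compare the points at distance r < ε, which lie in the slots
    -- adjacent to the event.
    set r := min h (ε / 2) with hrdef
    have hr0 : 0 < r := by positivity
    have hrε : r < ε := (min_le_right _ _).trans_lt (by linarith)
    have hrS : r ∈ Set.Ioc 0 h := ⟨hr0, min_le_left _ _⟩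
    have hhS : h ∈ Set.Ioc 0 h := ⟨hh, le_rfl⟩
    have h1 := hτ.classAt_eq_of_isPreconnected m isPreconnected_Ioc (x := x) (t := t) (δ := -δ)
      (fun r hr => by rw [shift_neg]; exact (free r hr).1) hhS hrS
    have h2 := hτ.classAt_eq_of_isPreconnected m isPreconnected_Ioc
      (fun r hr => (free r hr).2) hrS hhS
    rw [← shift_neg, h1, ← h2]
    obtain ⟨i, hk, he, rfl⟩ := exists_of_hasLink m link
    have h3 := loopClass_inSlot m x i.castSucc δ
    rw [eventMark_castSucc] at h3
    simp only [classAt]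
    rw [hτ.slotAt_shift_eventTime hε _ _ hr0 hrε, hτ.slotAt_shift_eventTime hε _ _ hr0 hrε,
      outSlot_neg, h3]
    have h4 : scatter (some (m i)) (x, δ) = (y, δ) := scatter_of_cross hk he δ
    rw [h4]
  | doubleBar x y t δ h hh link free =>
    refine ⟨(free h ⟨hh, le_rfl⟩).2, ?_⟩
    set r := min h (ε / 2) with hrdef
    have hr0 : 0 < r := by positivity
    have hrε : r < ε := (min_le_right _ _).trans_lt (by linarith)
    have hrS : r ∈ Set.Ioc 0 h := ⟨hr0, min_le_left _ _⟩
    have hhS : h ∈ Set.Ioc 0 h := ⟨hh, le_rfl⟩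
    have h1 := hτ.classAt_eq_of_isPreconnected m isPreconnected_Ioc (x := x) (t := t) (δ := -δ)
      (fun r hr => by rw [shift_neg]; exact (free r hr).1) hhS hrS
    have h2 := hτ.classAt_eq_of_isPreconnected m isPreconnected_Ioc (x := y) (t := t) (δ := -δ)
      (fun r hr => by rw [shift_neg]; exact (free r hr).2) hrS hhS
    rw [← shift_neg, h1, ← h2]
    obtain ⟨i, hk, he, rfl⟩ := exists_of_hasLink m link
    have h3 := loopClass_inSlot m x i.castSucc δ
    rw [eventMark_castSucc] at h3
    simp only [classAt]
    rw [hτ.slotAt_shift_eventTime hε _ _ hr0 hrε, outSlot_neg, h3]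
    have h4 : scatter (some (m i)) (x, δ) = (y, -δ) := scatter_of_doubleBar hk he δ
    rw [h4, outSlot_neg]

theorem classAt_eq_of_reflTransGen {p q : V × AddCircle β × ℤˣ}
    (hp : ¬ InSupport β (orderedConfig τ m) (p.1, p.2.1))
    (h : Relation.ReflTransGen (Move β (orderedConfig τ m)) p q) :
    ¬ InSupport β (orderedConfig τ m) (q.1, q.2.1) ∧
      classAt τ m (p.1, p.2.1) = classAt τ m (q.1, q.2.1) := by
  induction h with
  | refl => exact ⟨hp, rfl⟩
  | tail _ h ih =>
    have := hτ.classAt_eq_of_move m h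
    exact ⟨this.1, ih.2.trans this.2⟩

/-! #### The loops visit their classes -/

omit [DecidableEq V] in
theorem move_within {x : V} {j : Fin (n + 1)} {a b : ℝ} (h1 : slotStart τ j ≤ a) (hab : a ≤ b)
    (h2 : b < slotEnd β τ j) (h : ¬ InSupport β (orderedConfig τ m) (x, (a : AddCircle β))) :
    Move β (orderedConfig τ m) (x, (a : AddCircle β), 1) (x, (b : AddCircle β), 1) ∧
      Move β (orderedConfig τ m) (x, (b : AddCircle β), -1) (x, (a : AddCircle β), -1) := by
  have hm : Move β (orderedConfig τ m) (x, (a : AddCircle β), 1) (x, (b : AddCircle β), 1) := by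
    have hm := Move.travel x (a : AddCircle β) 1 (b - a) (sub_nonneg.2 hab)
      (ω := orderedConfig τ m) (fun r hr => by
        rw [shift_one, ← AddCircle.coe_add]
        rcases hr.1.lt_or_eq with hr0 | rfl
        · exact hτ.not_inSupport_of_interior m (j := j) (by linarith) (by linarith [hr.2]) x
        · rwa [add_zero])
    rwa [shift_one, ← AddCircle.coe_add, add_sub_cancel] at hm
  exact ⟨hm, hm.reverse⟩

/-- Each discrete transition is a single move: a cross or a double bar if the event touches the
vertex, and otherwise plain vertical travel through the time of the event. -/
theorem move_across {ε : ℝ} (hε : ∀ j, ε ≤ slotEnd β τ j - slotStart τ j) {h : ℝ} (h0 : 0 < h)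
    (hh : h < ε) (e : Fin (n + 1)) (p : V × ℤˣ) :
    Move β (orderedConfig τ m) (p.1, shift (eventTime β τ e) p.2 (-h), p.2)
      ((scatter (eventMark m e) p).1, shift (eventTime β τ e) (scatter (eventMark m e) p).2 h,
        (scatter (eventMark m e) p).2) := by
  obtain ⟨x, δ⟩ := p
  have hfree : ∀ r ∈ Set.Ioc 0 h, ∀ δ : ℤˣ, ∀ x : V,
      ¬ InSupport β (orderedConfig τ m) (x, shift (eventTime β τ e) δ r) := fun r hr δ x =>
    hτ.not_inSupport_shift_eventTime m hε e δ hr.1 (hr.2.trans_lt hh) x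
  by_cases hx : InSupport β (orderedConfig τ m) (x, eventTime β τ e)
  · obtain ⟨i, hxi, hi⟩ := (inSupport_iff m x _).1 hx
    obtain rfl := hτ.eventTime_injective hi
    obtain ⟨y, hy⟩ := Sym2.mem_iff_exists.1 hxi
    have hl := hasLink (β := β) (τ := τ) m i hy
    rw [eventMark_castSucc]
    generalize hμ : m i = μ at *
    match μ, hl, hy with
    | ⟨ed, .cross⟩, hl, hy =>
      have h4 : scatter (some ⟨ed, .cross⟩) (x, δ) = (y, δ) := scatter_of_cross rfl hy δ
      rw [h4]
      exact Move.cross x y _ δ h h0 hl fun r hr =>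
        ⟨by rw [← shift_neg]; exact hfree r hr _ _, hfree r hr _ _⟩
    | ⟨ed, .doubleBar⟩, hl, hy =>
      have h4 : scatter (some ⟨ed, .doubleBar⟩) (x, δ) = (y, -δ) := scatter_of_doubleBar rfl hy δ
      rw [h4]
      simp only [shift_neg]
      exact Move.doubleBar x y _ δ h h0 hl fun r hr => by
        rw [← shift_neg]; exact ⟨hfree r hr _ _, hfree r hr _ _⟩
  · rw [hτ.scatter_of_not_inSupport m hx]
    have hm := Move.travel x (shift (eventTime β τ e) δ (-h)) δ (h + h) (by linarith)
      (ω := orderedConfig τ m) (fun r hr => by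
        rw [shift_shift]
        rcases lt_trichotomy (-h + r) 0 with hr0 | hr0 | hr0
        · rw [← neg_neg (-h + r), ← shift_neg]
          exact hfree _ ⟨by linarith, by linarith [hr.1]⟩ _ _
        · rwa [hr0, shift_zero]
        · exact hfree _ ⟨hr0, by linarith [hr.2]⟩ _ _)
    rwa [shift_shift, neg_add_cancel_left] at hm

omit [hβ : Fact (0 < β)] hτ [DecidableEq V] in
variable (β τ) in
/-- The state in the middle of a time slot. -/
noncomputable def _root_.RandomLoop.midState (s : V × Fin (n + 1) × ℤˣ) : V × AddCircle β × ℤˣ :=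
  (s.1, (((slotStart τ s.2.1 + slotEnd β τ s.2.1) / 2 : ℝ) : AddCircle β), s.2.2)

omit [DecidableEq V] in
theorem move_midState {ε : ℝ} (hε : ∀ j, ε ≤ slotEnd β τ j - slotStart τ j) {h : ℝ} (h0 : 0 < h)
    (hh : h ≤ ε / 2) (e : Fin (n + 1)) (p : V × ℤˣ) :
    Move β (orderedConfig τ m) (p.1, shift (eventTime β τ e) p.2 h, p.2)
      (midState β τ (p.1, outSlot e p.2, p.2)) := by
  obtain ⟨x, δ⟩ := p
  rcases Int.units_eq_one_or δ with rfl | rfl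
  · rw [shift_eventTime_one]
    have := hε (e + 1)
    refine (hτ.move_within m (j := e + 1) (by linarith) ?_ ?_
      (hτ.not_inSupport_of_interior m (j := e + 1) (by linarith) (by linarith) x)).1
    · simp only [outSlot, if_true]; linarith
    · simp only [outSlot, if_true]; linarith
  · rw [shift_eventTime_neg_one]
    have := hε e
    have ho : outSlot e (-1) = e := by simp [outSlot]
    rw [midState]
    simp only [ho]
    exact (hτ.move_within m (j := e) (by linarith) (by linarith) (by linarith)
      (hτ.not_inSupport_of_interior m (j := e) (by linarith) (by linarith) x)).2

theorem reflTransGen_midState_step {x : V} {j : Fin (n + 1)} {a : ℝ} (h1 : slotStart τ j ≤ a)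
    (h2 : a < slotEnd β τ j) (h : ¬ InSupport β (orderedConfig τ m) (x, (a : AddCircle β)))
    (δ : ℤˣ) :
    Relation.ReflTransGen (Move β (orderedConfig τ m)) (x, (a : AddCircle β), δ)
      (midState β τ (step m (x, j, δ))) := by
  obtain ⟨ε, hε0, hε⟩ := hτ.exists_slotWidth
  obtain ⟨e, rfl⟩ : ∃ e, j = inSlot e δ := ⟨_, (inSlot_nextEvent j δ).symm⟩
  rw [step_inSlot]
  have hfin : ∀ h, 0 < h → h ≤ ε / 2 →
      Move β (orderedConfig τ m) (x, (a : AddCircle β), δ)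
        (x, shift (eventTime β τ e) δ (-h), δ) →
      Relation.ReflTransGen (Move β (orderedConfig τ m)) (x, (a : AddCircle β), δ)
      (midState β τ ((scatter (eventMark m e) (x, δ)).1,
        outSlot e (scatter (eventMark m e) (x, δ)).2, (scatter (eventMark m e) (x, δ)).2)) :=
    fun h h0 hh hm => ((Relation.ReflTransGen.single hm).tail
      (hτ.move_across m hε h0 (by linarith) e (x, δ))).tail (hτ.move_midState m hε h0 hh e _)
  rcases Int.units_eq_one_or δ with rfl | rfl
  · have hi : inSlot e 1 = e := by simp [inSlot]
    rw [hi] at h1 h2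
    have hr0 : 0 < min (ε / 2) (slotEnd β τ e - a) := lt_min (by linarith) (by linarith)
    refine hfin _ hr0 (min_le_left _ _) ?_
    rw [← shift_neg, shift_eventTime_neg_one]
    exact (hτ.move_within m (j := e) h1 (by linarith [min_le_right (ε / 2) (slotEnd β τ e - a)])
      (by linarith) h).1
  · have hi : inSlot e (-1) = e + 1 := by simp [inSlot]
    rw [hi] at h1 h2
    rcases h1.lt_or_eq with h1' | h1'
    · set r := min (ε / 2) (a - slotStart τ (e + 1)) with hr
      have hr0 : 0 < r := lt_min (by linarith) (by linarith)
      have hr1 : r ≤ a - slotStart τ (e + 1) := min_le_right _ _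
      refine hfin _ hr0 (min_le_left _ _) ?_
      rw [← shift_neg, neg_neg, shift_eventTime_one]
      exact (hτ.move_within m (j := e + 1) (by linarith) (by linarith) h2
        (hτ.not_inSupport_of_interior m (j := e + 1) (by linarith) (by linarith) x)).2
    -- A path going down from the very start of its slot is already at the event time. The event
    -- does not touch x, so the path simply continues into the slot below.
    · have hat : (a : AddCircle β) = eventTime β τ e := by rw [eventTime_eq, h1']
      rw [hat] at h ⊢
      rw [hτ.scatter_of_not_inSupport m h]
      have hm := Move.travel x (eventTime β τ e) (-1) (ε / 2) (by linarith)
        (ω := orderedConfig τ m) (fun r hr => by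
          rcases hr.1.lt_or_eq with hr0 | rfl
          · exact hτ.not_inSupport_shift_eventTime m hε e _ hr0 (by linarith [hr.2]) x
          · rwa [shift_zero])
      exact (Relation.ReflTransGen.single hm).tail
        (hτ.move_midState m hε (by linarith) le_rfl e (x, -1))

theorem not_inSupport_midState (s : V × Fin (n + 1) × ℤˣ) :
    ¬ InSupport β (orderedConfig τ m) ((midState β τ s).1, (midState β τ s).2.1) := by
  have := hτ.slotStart_lt_slotEnd s.2.1
  exact hτ.not_inSupport_of_interior m (j := s.2.1) (by linarith) (by linarith) s.1

theorem classAt_midState (s : V × Fin (n + 1) × ℤˣ) :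
    classAt τ m ((midState β τ s).1, (midState β τ s).2.1) = loopClass m s.1 s.2.1 := by
  have := hτ.slotStart_lt_slotEnd s.2.1
  simp only [classAt, midState]
  rw [hτ.slotAt_coe (j := s.2.1) (by linarith) (by linarith)]

theorem reflTransGen_midState_pow (s : V × Fin (n + 1) × ℤˣ) (k : ℕ) :
    Relation.ReflTransGen (Move β (orderedConfig τ m)) (midState β τ s)
      (midState β τ ((stepPerm m ^ k) s)) := by
  induction k with
  | zero => exact .refl
  | succ k ih =>
    refine ih.trans ?_
    rw [pow_succ', Equiv.Perm.mul_apply]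
    generalize (stepPerm m ^ k) s = s'
    have := hτ.slotStart_lt_slotEnd s'.2.1
    exact hτ.reflTransGen_midState_step m (x := s'.1) (j := s'.2.1) (by linarith) (by linarith)
      (hτ.not_inSupport_midState m s') s'.2.2

theorem exists_reflTransGen_of_classAt_eq [Finite V] {p q : V × AddCircle β}
    (hp : ¬ InSupport β (orderedConfig τ m) p) (hq : ¬ InSupport β (orderedConfig τ m) q)
    (h : classAt τ m p = classAt τ m q) :
    ∃ δ, Relation.ReflTransGen (Move β (orderedConfig τ m)) (p.1, p.2, 1) (q.1, q.2, δ) := by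
  obtain ⟨x, t⟩ := p
  obtain ⟨y, t'⟩ := q
  obtain ⟨j, a, ha1, ha2, rfl⟩ := hτ.exists_slot t
  obtain ⟨k, b, hb1, hb2, rfl⟩ := hτ.exists_slot t'
  simp only [classAt, hτ.slotAt_coe ha1 ha2, hτ.slotAt_coe hb1 hb2] at h
  obtain ⟨δ, hcyc⟩ := exists_sameCycle_of_loopClass_eq m h 1
  refine ⟨δ, ?_⟩
  have hstart := hτ.reflTransGen_midState_step m ha1 ha2 hp 1
  have hend := reverse_reflTransGen (hτ.reflTransGen_midState_step m hb1 hb2 hq (-δ))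
  rw [neg_neg] at hend
  -- The path goes from p to a slot midpoint, then along the cycle, then to q by reversing the path
  -- that leaves q in the direction -δ. Finiteness of the cycle allows forward steps only.
  have hcyc' : (stepPerm m).SameCycle (step m (x, j, 1)) (turn (step m (y, k, -δ))) :=
    (Equiv.Perm.sameCycle_apply_left.2 hcyc).trans (by
      have h1 : turn (step m (y, k, -δ)) = (stepPerm m)⁻¹ (y, k, δ) := rfl
      rw [h1]
      exact ⟨-1, by simp⟩)
  obtain ⟨i, -, hi⟩ := hcyc'.exists_pow_eq'
  have hmid := hτ.reflTransGen_midState_pow m (step m (x, j, 1)) i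
  rw [hi] at hmid
  exact (hstart.trans hmid).trans hend

theorem loopThrough_eq [Finite V] {p : V × AddCircle β}
    (hp : ¬ InSupport β (orderedConfig τ m) p) :
    loopThrough β (orderedConfig τ m) p =
      {q | ¬ InSupport β (orderedConfig τ m) q ∧ classAt τ m q = classAt τ m p} := by
  ext q
  constructor
  · rintro ⟨δ, h⟩
    have := hτ.classAt_eq_of_reflTransGen m (p := (p.1, p.2, 1)) hp h
    exact ⟨this.1, this.2.symm⟩
  · rintro ⟨h1, h2⟩
    exact hτ.exists_reflTransGen_of_classAt_eq m hp h1 h2.symm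

theorem loops_eq [Finite V] : loops β (orderedConfig τ m) = Set.range fun c : LoopClass m =>
    {q | ¬ InSupport β (orderedConfig τ m) q ∧ classAt τ m q = c} := by
  ext ℓ
  constructor
  · rintro ⟨p, hp, rfl⟩
    exact ⟨classAt τ m p, (hτ.loopThrough_eq m hp).symm⟩
  · rintro ⟨c, rfl⟩
    induction c using Quot.ind with | _ s =>
    have h1 := hτ.not_inSupport_midState m (s.1, s.2, 1)
    have h2 := hτ.classAt_midState m (s.1, s.2, 1)
    refine ⟨_, h1, ?_⟩
    rw [hτ.loopThrough_eq m h1, h2]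

/-- Slot midpoints are never in the support, so each class contains a free point and distinct
classes give distinct loops. -/
theorem numLoops_eq [Fintype V] :
    numLoops β (orderedConfig τ m) = Fintype.card (LoopClass m) := by
  rw [numLoops, hτ.loops_eq m, ← Nat.card_coe_set_eq, Nat.card_range_of_injective,
    Nat.card_eq_fintype_card]
  intro c c' h
  induction c using Quot.ind with | _ s =>
  have h1 := hτ.not_inSupport_midState m (s.1, s.2, 1)
  have h2 := hτ.classAt_midState m (s.1, s.2, 1)
  have h3 : ((midState β τ (s.1, s.2, 1)).1, (midState β τ (s.1, s.2, 1)).2.1) ∈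
      {q | ¬ InSupport β (orderedConfig τ m) q ∧ classAt τ m q = c'} :=
    (Set.ext_iff.1 h _).1 ⟨h1, h2⟩
  exact h2.symm.trans h3.2

theorem mem_connected_iff [Finite V] (x y : V) {s : ℝ} {k : Fin (n + 1)} (h1 : slotStart τ k < s)
    (h2 : s < slotEnd β τ k) :
    orderedConfig τ m ∈ connected G β x y s ↔ loopClass m x 0 = loopClass m y k := by
  have hs := hτ.slotAt_coe h1.le h2
  have h0 : slotAt τ (0 : AddCircle β) = 0 := by
    have h3 : slotStart τ 0 = 0 := rfl
    have h4 := hτ.slotStart_lt_slotEnd 0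
    have := hτ.slotAt_coe h3.le (by rwa [h3] at h4)
    simpa using this
  -- Time 0 is the time of the trivial last event, and distinct events have distinct times.
  have hf0 : ¬ InSupport β (orderedConfig τ m) (x, (0 : AddCircle β)) := by
    rw [inSupport_iff]
    rintro ⟨i, -, h⟩
    have h5 : eventTime β τ (Fin.last n) = 0 := by simp [eventTime, slotEnd, AddCircle.coe_period]
    exact (Fin.castSucc_lt_last i).ne (hτ.eventTime_injective (h.trans h5.symm))
  have hfs := hτ.not_inSupport_of_interior m h1 h2 y
  constructor
  · rintro ⟨ℓ, hℓ, hx, hy⟩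
    rw [hτ.loops_eq m] at hℓ
    obtain ⟨c, rfl⟩ := hℓ
    have := hx.2.trans hy.2.symm
    simpa only [classAt, hs, h0] using this
  · intro h
    refine ⟨loopThrough β (orderedConfig τ m) (x, 0), ⟨_, hf0, rfl⟩, ?_, ?_⟩
    · rw [hτ.loopThrough_eq m hf0]; exact ⟨hf0, rfl⟩
    · rw [hτ.loopThrough_eq m hf0]
      refine ⟨hfs, ?_⟩
      simp only [classAt, hs, h0, h]

end Ordered

end ContinuousTime

end RandomLoop

namespace RandomLoop

/-! ### Trace formulas -/

section PathSum

variable {S : Type*} [Fintype S] [DecidableEq S]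

theorem sum_fin_cons {M : Type*} [AddCommMonoid M] {n : ℕ} (F : (Fin (n + 1) → S) → M) :
    ∑ c, F c = ∑ σ, ∑ c : Fin n → S, F (Fin.cons σ c) := by
  rw [← (Fin.consEquiv fun _ : Fin (n + 1) => S).sum_comp, Fintype.sum_prod_type]
  rfl

/-- Expansion of matrix products over paths, with `g` inserted at time k. The induction removes the
first step of the path until the insertion is reached. -/
theorem sum_paths (A : Matrix S S ℝ) (g : S → ℝ) {n : ℕ} (k : Fin (n + 1)) (σ σ' : S) :
    (∑ c : Fin (n + 1) → S, if c 0 = σ ∧ c (Fin.last n) = σ' then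
        g (c k) * ∏ i : Fin n, A (c i.castSucc) (c i.succ) else 0)
      = (A ^ (k : ℕ) * Matrix.diagonal g * A ^ (n - k)) σ σ' := by
  have hcons : ∀ {n : ℕ} (F : (Fin (n + 1 + 1) → S) → ℝ) (σ : S),
      (∑ c : Fin (n + 1 + 1) → S, if c 0 = σ ∧ c (Fin.last (n + 1)) = σ' then
        F c * ∏ i : Fin (n + 1), A (c i.castSucc) (c i.succ) else 0)
      = ∑ τ, A σ τ * ∑ c : Fin (n + 1) → S, if c 0 = τ ∧ c (Fin.last n) = σ' then
          F (Fin.cons σ c) * ∏ i : Fin n, A (c i.castSucc) (c i.succ) else 0 := by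
    intro n F σ
    rw [sum_fin_cons, Finset.sum_eq_single σ]
    · simp_rw [Finset.mul_sum]
      rw [Finset.sum_comm]
      refine Finset.sum_congr rfl fun c _ => ?_
      rw [Finset.sum_eq_single (c 0)]
      · rw [Fin.prod_univ_succ, ← Fin.succ_last]
        simp only [Fin.cons_zero, Fin.cons_succ, true_and, Fin.castSucc_zero, ← Fin.succ_castSucc]
        split_ifs <;> ring
      · intro τ _ hτ
        rw [if_neg (fun h => hτ h.1.symm), mul_zero]
      · simp
    · intro τ _ hτ
      exact Finset.sum_eq_zero fun c _ => if_neg fun h => hτ h.1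
    · simp
  have hplain : ∀ (n : ℕ) (σ : S), (∑ c : Fin (n + 1) → S,
      if c 0 = σ ∧ c (Fin.last n) = σ' then 1 * ∏ i : Fin n, A (c i.castSucc) (c i.succ) else 0)
      = (A ^ n) σ σ' := by
    intro n
    induction n with
    | zero =>
      intro σ
      rw [← (Equiv.funUnique (Fin 1) S).symm.sum_comp]
      simp [Matrix.one_apply, ite_and, Fin.last, eq_comm]
    | succ n ih =>
      intro σ
      rw [hcons (fun _ => 1), pow_succ', Matrix.mul_apply]
      simp only [ih]
  induction n generalizing σ with
  | zero =>
    obtain rfl : k = 0 := Fin.ext (by omega)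
    rw [← (Equiv.funUnique (Fin 1) S).symm.sum_comp]
    simp [Matrix.one_apply, ite_and, Fin.last]
  | succ n ih =>
    rw [hcons (fun c => g (c k))]
    induction k using Fin.cases with
    | zero =>
      simp only [Fin.cons_zero, Fin.val_zero, pow_zero, one_mul, Nat.sub_zero]
      rw [Matrix.diagonal_mul, pow_succ', Matrix.mul_apply, Finset.mul_sum]
      refine Finset.sum_congr rfl fun τ _ => ?_
      rw [← hplain, mul_left_comm]
      congr 1
      rw [Finset.mul_sum]
      exact Finset.sum_congr rfl fun c _ => by split_ifs <;> simp
    | succ k =>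
      simp only [Fin.cons_succ, ih, Fin.val_succ]
      rw [pow_succ', Matrix.mul_assoc A, Matrix.mul_assoc A, Matrix.mul_apply,
        Nat.add_sub_add_right]

theorem sum_closed_paths (A : Matrix S S ℝ) (f g : S → ℝ) {n : ℕ} (k : Fin (n + 1)) :
    (∑ c : Fin (n + 1) → S, if c (Fin.last n) = c 0 then
        f (c 0) * g (c k) * ∏ i : Fin n, A (c i.castSucc) (c i.succ) else 0)
      = (Matrix.diagonal f * A ^ (k : ℕ) * Matrix.diagonal g * A ^ (n - k)).trace := by
  rw [Matrix.mul_assoc, Matrix.mul_assoc, ← Matrix.mul_assoc (A ^ (k : ℕ)), Matrix.trace]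
  simp only [Matrix.diag_apply, Matrix.diagonal_mul, ← sum_paths, Finset.mul_sum]
  rw [Finset.sum_comm]
  refine Finset.sum_congr rfl fun c _ => ?_
  rw [Finset.sum_eq_single (c 0)]
  · simp only [true_and]; split_ifs <;> ring
  · intro σ _ hσ
    rw [if_neg (fun h => hσ h.1.symm), mul_zero]
  · simp

end PathSum

/-! ### Colourings of marked configurations and powers of the generator -/

section TraceFormula

variable {V C : Type*} [Fintype V] [DecidableEq V] [Fintype C] [DecidableEq C]
  {G : SimpleGraph V}

instance : Finite LinkKind :=
  Finite.of_injective (fun k : LinkKind => match k with | .cross => true | .doubleBar => false)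
    (by rintro (_ | _) (_ | _) h <;> simp_all)

instance : Finite (Mark G) :=
  Finite.of_injective (fun μ : Mark G => (μ.edge, μ.kind)) (by
    rintro ⟨e, k⟩ ⟨e', k'⟩ h
    simpa using h)

noncomputable instance : Fintype (Mark G) := Fintype.ofFinite _

omit [DecidableEq V] in
theorem sum_mark_eq [Fintype G.edgeSet] {M : Type*} [AddCommMonoid M] (F : Mark G → M) :
    ∑ μ, F μ = ∑ e : G.edgeSet, (F ⟨e, .cross⟩ + F ⟨e, .doubleBar⟩) := by
  let φ : Mark G ≃ G.edgeSet × Bool :=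
    { toFun := fun μ => (μ.edge, match μ.kind with | .cross => true | .doubleBar => false)
      invFun := fun p => ⟨p.1, if p.2 then .cross else .doubleBar⟩
      left_inv := by rintro ⟨e, _ | _⟩ <;> rfl
      right_inv := by rintro ⟨e, _ | _⟩ <;> rfl }
  rw [← φ.symm.sum_comp, Fintype.sum_prod_type]
  refine Finset.sum_congr rfl fun e _ => ?_
  rw [Fintype.sum_bool]
  rfl

theorem sum_adj_eq_two_smul_sum_edges [DecidableRel G.Adj] {M : Type*} [AddCommMonoid M]
    (F : Sym2 V → M) :
    (∑ x, ∑ y, if G.Adj x y then F s(x, y) else 0) = 2 • ∑ e : G.edgeSet, F e := by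
  have h1 : (∑ x, ∑ y, if G.Adj x y then F s(x, y) else 0) = ∑ d : G.Dart, F d.edge := by
    rw [← Fintype.sum_prod_type', ← Finset.sum_filter]
    refine Finset.sum_bij' (fun p hp => ⟨p, (Finset.mem_filter.1 hp).2⟩) (fun d _ => d.toProd)
      ?_ ?_ ?_ ?_ ?_
    · simp
    · intro d _; simp
    · simp
    · simp
    · intro p _; rfl
  have h2 : ∑ d : G.Dart, F d.edge = ∑ e : G.edgeSet, ∑ d : G.Dart with d.edge = (e : Sym2 V), F d.edge := by
    rw [← Finset.sum_fiberwise (s := Finset.univ)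
      (g := fun d : G.Dart => (⟨d.edge, d.edge_mem⟩ : G.edgeSet))]
    refine Finset.sum_congr rfl fun e _ => Finset.sum_congr ?_ fun _ _ => rfl
    ext d
    simp [Subtype.ext_iff]
  rw [h1, h2, Finset.smul_sum]
  refine Finset.sum_congr rfl fun e _ => ?_
  rw [Finset.sum_congr rfl (g := fun _ => F e) (fun d hd => by rw [(Finset.mem_filter.1 hd).2]),
    Finset.sum_const, G.dart_edge_fiber_card e.1 e.2]

omit [Fintype V] [Fintype C] [DecidableEq C] in
theorem compatible_cross_iff {x y : V} {e : G.edgeSet} (he : (e : Sym2 V) = s(x, y))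
    (σ σ' : V → C) : Compatible (some ⟨e, .cross⟩ : Option (Mark G)) σ σ' ↔
      (∀ z, z ≠ x → z ≠ y → σ z = σ' z) ∧ σ x = σ' y ∧ σ y = σ' x := by
  have h1 : Compatible (some ⟨e, .cross⟩ : Option (Mark G)) σ σ' ↔
      ∀ z, σ z = σ' (Equiv.swap x y z) := by
    refine ⟨fun h z => by simpa [scatter, he, edgeSwap_mk] using h z 1, fun h z δ => ?_⟩
    rcases Int.units_eq_one_or δ with rfl | rfl
    · simpa [scatter, he, edgeSwap_mk] using h z
    · simpa [scatter, he, edgeSwap_mk] using (h (Equiv.swap x y z)).symm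
  rw [h1]
  constructor
  · intro h
    refine ⟨fun z hx hy => ?_, ?_, ?_⟩
    · rw [h z, Equiv.swap_apply_of_ne_of_ne hx hy]
    · rw [h x, Equiv.swap_apply_left]
    · rw [h y, Equiv.swap_apply_right]
  · rintro ⟨h1, h2, h3⟩ z
    by_cases hx : z = x
    · subst hx; rw [Equiv.swap_apply_left, h2]
    by_cases hy : z = y
    · subst hy; rw [Equiv.swap_apply_right, h3]
    rw [Equiv.swap_apply_of_ne_of_ne hx hy, h1 z hx hy]

omit [Fintype V] [Fintype C] [DecidableEq C] in
theorem compatible_doubleBar_iff {x y : V} {e : G.edgeSet} (he : (e : Sym2 V) = s(x, y))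
    (σ σ' : V → C) : Compatible (some ⟨e, .doubleBar⟩ : Option (Mark G)) σ σ' ↔
      (∀ z, z ≠ x → z ≠ y → σ z = σ' z) ∧ σ x = σ y ∧ σ' x = σ' y := by
  have hx : x ∈ (e : Sym2 V) := by rw [he]; simp
  have hy : y ∈ (e : Sym2 V) := by rw [he]; simp
  have hz : ∀ z, z ≠ x → z ≠ y → z ∉ (e : Sym2 V) := fun z h1 h2 => by rw [he]; simp [h1, h2]
  constructor
  · intro h
    refine ⟨fun z h1 h2 => ?_, ?_, ?_⟩
    · simpa [scatter, hz z h1 h2] using h z 1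
    · simpa [scatter, hx, he, edgeSwap_mk] using h x 1
    · simpa [scatter, hx, he, edgeSwap_mk] using h x (-1)
  · rintro ⟨h1, h2, h3⟩ z δ
    by_cases hzx : z = x
    · subst hzx
      rcases Int.units_eq_one_or δ with rfl | rfl <;> simp [scatter, he, edgeSwap_mk, h2, h3]
    by_cases hzy : z = y
    · subst hzy
      rcases Int.units_eq_one_or δ with rfl | rfl <;> simp [scatter, he, edgeSwap_mk, h2, h3]
    have := hz z hzx hzy
    rcases Int.units_eq_one_or δ with rfl | rfl <;> simp [scatter, this, h1 z hzx hzy]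

open scoped Classical in
-- Σ E_ac ⊗ E_ca exchanges the two spins, and Σ E_ac ⊗ E_ac has entry 1 exactly when the spins agree
-- before and agree after. These are the compatibility conditions at a cross and at a double bar.
theorem bond_zero_apply {x y : V} {e : G.edgeSet} (he : (e : Sym2 V) = s(x, y)) (u : ℝ)
    (σ σ' : V → C) :
    bond u (fun _ : C => 0) (siteOp x) (siteOp y) 0 0 σ σ' =
      u * (if Compatible (some ⟨e, .cross⟩ : Option (Mark G)) σ σ' then 1 else 0)
        + (1 - u) * (if Compatible (some ⟨e, .doubleBar⟩ : Option (Mark G)) σ σ' then 1 else 0) := by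
  have hxy : x ≠ y := by
    have h := e.2
    rw [he, SimpleGraph.mem_edgeSet] at h
    exact h.ne
  have h1 : ∑ a, ∑ c, (siteOp x (Matrix.single a c (1 : ℝ)) * siteOp y (Matrix.single c a 1)) σ σ'
      = if Compatible (some ⟨e, .cross⟩ : Option (Mark G)) σ σ' then 1 else 0 := by
    simp only [siteOp_mul_siteOp_apply hxy, compatible_cross_iff he]
    by_cases h : ∀ z, z ≠ x → z ≠ y → σ z = σ' z
    · simp only [if_pos h]
      rw [Finset.sum_eq_single (σ x), Finset.sum_eq_single (σ' x)]
      · have h' : (∀ z, ¬ z = x → ¬ z = y → σ z = σ' z) := h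
        by_cases h2 : σ x = σ' y <;> by_cases h3 : σ y = σ' x <;>
          simp [Matrix.single_apply, h', h2, h3, eq_comm]
        all_goals simp_all [eq_comm]
      · intro c _ hc
        simp [Matrix.single_apply, hc]
      · simp
      · intro a _ ha
        simp [Matrix.single_apply, ha]
      · simp
    · simp only [if_neg h, Finset.sum_const_zero]
      rw [if_neg fun h' => h h'.1]
  have h2 : ∑ a, ∑ c, (siteOp x (Matrix.single a c (1 : ℝ)) * siteOp y (Matrix.single a c 1)) σ σ'
      = if Compatible (some ⟨e, .doubleBar⟩ : Option (Mark G)) σ σ' then 1 else 0 := by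
    simp only [siteOp_mul_siteOp_apply hxy, compatible_doubleBar_iff he]
    by_cases h : ∀ z, z ≠ x → z ≠ y → σ z = σ' z
    · simp only [if_pos h]
      rw [Finset.sum_eq_single (σ x), Finset.sum_eq_single (σ' x)]
      · have h' : (∀ z, ¬ z = x → ¬ z = y → σ z = σ' z) := h
        by_cases h2 : σ x = σ y <;> by_cases h3 : σ' x = σ' y <;>
          simp [Matrix.single_apply, h', h2, h3]
        all_goals simp_all [eq_comm]
      · intro c _ hc
        simp [Matrix.single_apply, hc]
      · simp
      · intro a _ ha
        simp [Matrix.single_apply, ha]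
      · simp
    · simp only [if_neg h, Finset.sum_const_zero]
      rw [if_neg fun h' => h h'.1]
  rw [bond, ← h1, ← h2]
  simp [Matrix.sum_apply, Finset.sum_add_distrib, Finset.mul_sum]

open scoped Classical in
theorem loopGenerator_apply [DecidableRel G.Adj] (u : ℝ) (σ σ' : V → C) :
    loopGenerator G C u σ σ' =
      ∑ μ : Mark G, rate u μ.kind * (if Compatible (some μ) σ σ' then 1 else 0) := by
  let F : Sym2 V → ℝ := fun e => if h : e ∈ G.edgeSet then
    u * (if Compatible (some ⟨⟨e, h⟩, .cross⟩ : Option (Mark G)) σ σ' then 1 else 0)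
        + (1 - u) * (if Compatible (some ⟨⟨e, h⟩, .doubleBar⟩ : Option (Mark G)) σ σ' then 1 else 0)
    else 0
  have h1 : ∀ x y, (if G.Adj x y then bond u (fun _ : C => 0) (siteOp x) (siteOp y) 0 0 else 0) σ σ'
      = if G.Adj x y then F s(x, y) else 0 := by
    intro x y
    split_ifs with h
    · have he : s(x, y) ∈ G.edgeSet := h
      rw [bond_zero_apply (e := ⟨s(x, y), he⟩) rfl u]
      simp only [F, dif_pos he]
    · rfl
  rw [loopGenerator, generator, Matrix.smul_apply, Matrix.sum_apply]
  simp only [Matrix.sum_apply, Pi.zero_apply]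
  simp only [h1]
  rw [sum_adj_eq_two_smul_sum_edges, sum_mark_eq, two_nsmul, ← two_smul ℝ, smul_smul]
  norm_num
  refine Finset.sum_congr rfl fun e _ => ?_
  simp [F, rate]

theorem prod_loopGenerator [DecidableRel G.Adj] (u : ℝ) {n : ℕ} (c : Fin (n + 1) → V → C) :
    (open scoped Classical in
    (if c (Fin.last n) = c 0 then ∏ i : Fin n, loopGenerator G C u (c i.castSucc) (c i.succ) else 0)
      = ∑ m : Fin n → Mark G, (∏ i, rate u (m i).kind) *
        if ∀ e, Compatible (eventMark m e) (c e) (c (e + 1)) then 1 else 0) := by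
  classical
  have h : ∀ m : Fin n → Mark G, (∀ e, Compatible (eventMark m e) (c e) (c (e + 1))) ↔
      c (Fin.last n) = c 0 ∧ ∀ i : Fin n, Compatible (some (m i)) (c i.castSucc) (c i.succ) := by
    intro m
    rw [Fin.forall_fin_succ', and_comm]
    simp only [eventMark_castSucc, eventMark_last, compatible_none, Fin.last_add_one,
      Fin.coeSucc_eq_succ]
  simp only [h, loopGenerator_apply, Finset.prod_univ_sum, Fintype.piFinset_univ]
  by_cases hc : c (Fin.last n) = c 0
  · rw [if_pos hc]
    refine Finset.sum_congr rfl fun m _ => ?_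
    rw [Finset.prod_mul_distrib, Finset.prod_ite_zero]
    simp [hc]
  · simp [hc]

/-- Sum over the marks and over the compatible colourings: colours first gives θ for every loop,
marks first gives products of entries of the generator along closed paths. -/
theorem sum_marks_pow_card [DecidableRel G.Adj] (u : ℝ) (n : ℕ) :
    ∑ m : Fin n → Mark G, (∏ i, rate u (m i).kind) *
      (Fintype.card C : ℝ) ^ Fintype.card (LoopClass m) = (loopGenerator G C u ^ n).trace := by
  classical
  have h := sum_closed_paths (loopGenerator G C u) (fun _ => 1) (fun _ => 1) (0 : Fin (n + 1))
  rw [Matrix.diagonal_one] at h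
  simp only [Fin.val_zero, pow_zero, one_mul, mul_one, Nat.sub_zero, prod_loopGenerator] at h
  rw [← h, Finset.sum_comm]
  refine Finset.sum_congr rfl fun m _ => ?_
  rw [← Finset.mul_sum, sum_compatible m fun _ => (1 : ℝ)]
  simp

open scoped Classical in
theorem sum_marks_two_point [DecidableRel G.Adj] (u : ℝ) {w : C → ℝ} (hw : ∑ a, w a = 0) {n : ℕ}
    (k : Fin (n + 1)) (x y : V) :
    ∑ m : Fin n → Mark G, (∏ i, rate u (m i).kind) *
        (if loopClass m x 0 = loopClass m y k then
          (∑ a, w a ^ 2) * (Fintype.card C : ℝ) ^ Fintype.card (LoopClass m) else 0)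
      = Fintype.card C * (siteOp x (Matrix.diagonal w) * loopGenerator G C u ^ (k : ℕ) *
        siteOp y (Matrix.diagonal w) * loopGenerator G C u ^ (n - k)).trace := by
  rw [siteOp_diagonal, siteOp_diagonal, ← sum_closed_paths]
  have h : ∀ c : Fin (n + 1) → V → C, (if c (Fin.last n) = c 0 then
      w (c 0 x) * w (c k y) * ∏ i : Fin n, loopGenerator G C u (c i.castSucc) (c i.succ) else 0)
      = ∑ m : Fin n → Mark G, (∏ i, rate u (m i).kind) *
        if ∀ e, Compatible (eventMark m e) (c e) (c (e + 1)) then w (c 0 x) * w (c k y) else 0 := by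
    intro c
    rw [← mul_ite_zero, prod_loopGenerator, Finset.mul_sum]
    refine Finset.sum_congr rfl fun m _ => ?_
    split_ifs <;> ring
  simp only [h]
  rw [Finset.sum_comm, Finset.mul_sum]
  refine Finset.sum_congr rfl fun m _ => ?_
  rw [← Finset.mul_sum, sum_compatible m fun c => w (c 0 x) * w (c k y), mul_left_comm,
    sum_colouring_two_point w hw]

end TraceFormula

end RandomLoop

namespace RandomLoop

/-! ### Integrals with respect to Poisson point processes -/

section Times

variable {n : ℕ} {β : ℝ}

/-- The uniform measure on the times of `n` events. -/
noncomputable abbrev timeMeasure (β : ℝ) (n : ℕ) : Measure (Fin n → ℝ) :=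
  Measure.pi fun _ => volume.restrict (Set.Icc 0 β)

/-- The number of the events that take place before time `s`. -/
noncomputable def rankOf (s : ℝ) (t : Fin n → ℝ) : Fin (n + 1) :=
  Fin.ofNat (n + 1) {i | t i < s}.ncard

theorem ncard_setOf_lt (s : ℝ) (t : Fin n → ℝ) :
    {i | t i < s}.ncard = ∑ i, if t i < s then 1 else 0 := by
  rw [Set.ncard_eq_toFinset_card', Set.toFinset_ofPred, Finset.card_filter]

theorem val_rankOf (s : ℝ) (t : Fin n → ℝ) : (rankOf s t : ℕ) = {i | t i < s}.ncard := by
  rw [rankOf, Fin.val_ofNat, Nat.mod_eq_of_lt]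
  have := Set.ncard_le_card {i | t i < s}
  rw [Nat.card_fin] at this
  omega

theorem measurable_rankOf : Measurable fun p : ℝ × (Fin n → ℝ) => rankOf p.1 p.2 := by
  have h : Measurable fun p : ℝ × (Fin n → ℝ) => ∑ i, if p.2 i < p.1 then 1 else 0 :=
    Finset.measurable_sum _ fun i _ =>
      Measurable.ite (measurableSet_lt (by fun_prop) (by fun_prop)) (by fun_prop) (by fun_prop)
  simp only [rankOf, ncard_setOf_lt]
  exact (measurable_from_top (f := Fin.ofNat (n + 1))).comp h

theorem rankOf_comp_perm (s : ℝ) (t : Fin n → ℝ) (σ : Equiv.Perm (Fin n)) :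
    rankOf s (t ∘ σ) = rankOf s t := by
  apply Fin.ext
  rw [val_rankOf, val_rankOf, ncard_setOf_lt, ncard_setOf_lt,
    ← Equiv.sum_comp σ fun i => if t i < s then 1 else 0]
  rfl

theorem lt_iff_lt_rankOf {s : ℝ} {t : Fin n → ℝ} (ht : StrictMono t) (i : Fin n) :
    t i < s ↔ (i : ℕ) < rankOf s t := by
  rw [val_rankOf, Set.ncard_eq_toFinset_card', Set.toFinset_ofPred,
    Tuple.lt_card_lt_iff_apply_lt_of_monotone ht.monotone]

/-- The rank of a time among the others is the number of times below it, and this increases strictly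
with the time. -/
theorem bijective_rankOf {t : Fin (n + 1) → ℝ} (ht : Function.Injective t) :
    Function.Bijective fun i => rankOf (t i) (i.removeNth t) := by
  rw [← Finite.injective_iff_bijective]
  have h : ∀ i, (rankOf (t i) (i.removeNth t) : ℕ) = {j | t j < t i}.ncard := by
    intro i
    rw [val_rankOf, ncard_setOf_lt, ncard_setOf_lt, Fin.sum_univ_succAbove _ i, if_neg (lt_irrefl _),
      zero_add]
    rfl
  have hlt : ∀ i j, t i < t j → {l | t l < t i}.ncard < {l | t l < t j}.ncard := by
    intro i j hij
    refine Set.ncard_lt_ncard ⟨fun l hl => lt_trans hl hij, fun hle => ?_⟩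
    exact lt_irrefl _ (show t i < t i from hle hij)
  intro i j hij
  have hij : {l | t l < t i}.ncard = {l | t l < t j}.ncard := by
    rw [← h, ← h]; exact congrArg Fin.val hij
  rcases lt_trichotomy (t i) (t j) with h1 | h1 | h1
  · exact absurd hij (hlt _ _ h1).ne
  · exact ht h1
  · exact absurd hij (hlt _ _ h1).ne'

theorem ae_injective (β : ℝ) (n : ℕ) :
    ∀ᵐ t ∂timeMeasure β n, Function.Injective t := by
  have h : ∀ i j : Fin n, i ≠ j → ∀ᵐ t ∂timeMeasure β n, t i ≠ t j := by
    intro i j hij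
    rw [timeMeasure, ← Measure.restrict_pi_pi]
    refine ae_restrict_of_ae ?_
    rw [← volume_pi]
    have := Measure.addHaar_submodule (volume : Measure (Fin n → ℝ))
      (LinearMap.ker (LinearMap.proj (R := ℝ) (φ := fun _ : Fin n => ℝ) i - LinearMap.proj j)) (by
        intro htop
        have h1 : (Pi.single i 1 : Fin n → ℝ) ∈ LinearMap.ker
          (LinearMap.proj (R := ℝ) (φ := fun _ : Fin n => ℝ) i - LinearMap.proj j) := htop ▸ trivial
        simp [hij.symm] at h1)
    rw [ae_iff]
    refine measure_mono_null (fun t ht => ?_) this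
    simp only [ne_eq, not_not, Set.mem_ofPred_eq] at ht
    simp [ht]
  have h' : ∀ᵐ t ∂timeMeasure β n, ∀ i j, i ≠ j → t i ≠ t j := by
    rw [ae_all_iff]; intro i; rw [ae_all_iff]; intro j; rw [Filter.eventually_imp_distrib_left]
    exact h i j
  filter_upwards [h'] with t ht i j hij
  by_contra hne
  exact ht i j hne hij

theorem ae_forall_ne (β : ℝ) (n : ℕ) (s : ℝ) : ∀ᵐ t ∂timeMeasure β n, ∀ i, t i ≠ s := by
  rw [ae_all_iff]
  exact fun i => Measure.ae_eval_ne (fun _ : Fin n => volume.restrict (Set.Icc 0 β)) i s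

theorem ae_forall_mem (β : ℝ) (n : ℕ) : ∀ᵐ t ∂timeMeasure β n, ∀ i, t i ∈ Set.Icc 0 β := by
  rw [ae_all_iff]
  intro i
  exact (Measure.quasiMeasurePreserving_eval (fun _ : Fin n => volume.restrict (Set.Icc 0 β)) i).ae
    (ae_restrict_mem measurableSet_Icc)

theorem ae_ordered_sort (β : ℝ) (n : ℕ) :
    ∀ᵐ t ∂timeMeasure β n, Ordered β (t ∘ Tuple.sort t) := by
  filter_upwards [ae_injective β n, ae_forall_ne β n 0, ae_forall_ne β n β, ae_forall_mem β n]
    with t h1 h2 h3 h4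
  exact ⟨(Tuple.monotone_sort t).strictMono_of_injective (h1.comp (Tuple.sort t).injective),
    fun i => lt_of_le_of_ne (h4 _).1 (h2 _).symm, fun i => lt_of_le_of_ne (h4 _).2 (h3 _)⟩

/-- A time that is uniform with respect to `n` others has all ranks with the same probability. -/
theorem lintegral_rankOf (β : ℝ) (B : Fin (n + 1) → ℝ≥0∞) :
    ((n : ℝ≥0∞) + 1) * ∫⁻ s in Set.Icc 0 β, ∫⁻ t, B (rankOf s t) ∂timeMeasure β n =
      ENNReal.ofReal β ^ (n + 1) * ∑ k, B k := by
  have hm : Measurable fun p : ℝ × (Fin n → ℝ) => B (rankOf p.1 p.2) :=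
    (measurable_of_finite B).comp measurable_rankOf
  have h : ∀ i : Fin (n + 1),
      ∫⁻ s in Set.Icc 0 β, ∫⁻ t, B (rankOf s t) ∂timeMeasure β n =
        ∫⁻ t, B (rankOf (t i) (i.removeNth t)) ∂timeMeasure β (n + 1) := by
    intro i
    rw [← lintegral_prod _ hm.aemeasurable,
      ← (measurePreserving_piFinSuccAbove (fun _ : Fin (n + 1) => volume.restrict (Set.Icc 0 β))
        i).lintegral_comp hm]
    rfl
  have h2 : ∀ i : Fin (n + 1), Measurable fun t : Fin (n + 1) → ℝ =>
      B (rankOf (t i) (i.removeNth t)) := fun i =>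
    hm.comp (MeasurableEquiv.piFinSuccAbove (fun _ => ℝ) i).measurable
  -- Each of n + 1 uniform times may play the role of `s`; summing over the choice runs through
  -- every rank exactly once, almost surely.
  calc
    _ = ∑ i : Fin (n + 1), ∫⁻ t, B (rankOf (t i) (i.removeNth t)) ∂timeMeasure β (n + 1) := by
      rw [← Finset.sum_congr rfl fun i _ => h i]
      simp
    _ = ∫⁻ t, ∑ k, B k ∂timeMeasure β (n + 1) := by
      rw [← lintegral_finsetSum _ fun i _ => h2 i]
      refine lintegral_congr_ae ?_
      filter_upwards [ae_injective β (n + 1)] with t ht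
      exact (bijective_rankOf ht).sum_comp B
    _ = _ := by
      rw [lintegral_const, mul_comm, Measure.pi_univ]
      simp

end Times

/-! ### Functions that depend only on the ordered marks -/

section Poisson

variable {M : Type*} [Fintype M] [MeasurableSpace M] [DiscreteMeasurableSpace M]

/-- The configurations with marks `m` at ordered times different from `s`, `j` of which are
before `s`. -/
def orderedWith (β s : ℝ) {n : ℕ} (m : Fin n → M) (j : Fin (n + 1)) : Set (Configuration (M × ℝ)) :=
  {ω | ∃ τ, Ordered β τ ∧ (∀ i, τ i ≠ s) ∧ (∀ i, τ i < s ↔ (i : ℕ) < j) ∧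
    ω = Configuration.ofTuple fun i => (m i, τ i)}

theorem measurableSet_ordered (β : ℝ) (n : ℕ) : MeasurableSet {τ : Fin n → ℝ | Ordered β τ} := by
  have h : {τ : Fin n → ℝ | Ordered β τ} = (⋂ i, ⋂ j, ⋂ (_ : i < j), {τ | τ i < τ j}) ∩
      ((⋂ i, {τ | 0 < τ i}) ∩ ⋂ i, {τ | τ i < β}) := by
    ext τ
    simp only [Set.mem_inter_iff, Set.mem_iInter, Set.mem_ofPred_eq]
    exact ⟨fun h => ⟨fun i j hij => h.mono hij, h.pos, h.lt⟩, fun h => ⟨fun i j => h.1 i j, h.2.1, h.2.2⟩⟩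
  rw [h]
  refine .inter (.iInter fun i => .iInter fun j => .iInter fun _ => ?_)
    (.inter (.iInter fun i => ?_) (.iInter fun i => ?_)) <;>
  exact measurableSet_lt (by fun_prop) (by fun_prop)

/-- The preimage in every X^N must be measurable. A tuple may list the points in any order and with
repetitions, hence the union over the maps `e` and the condition that every entry is one of the p (e
i). -/
theorem measurableSet_orderedWith (β s : ℝ) {n : ℕ} (m : Fin n → M) (j : Fin (n + 1)) :
    MeasurableSet (orderedWith β s m j) := by
  refine MeasurableSpace.measurableSet_iInf.2 fun N => ?_
  change MeasurableSet ((fun p : Fin N → M × ℝ => Configuration.ofTuple p) ⁻¹' orderedWith β s m j)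
  have h : (fun p : Fin N → M × ℝ => Configuration.ofTuple p) ⁻¹' orderedWith β s m j =
      ⋃ e : Fin n → Fin N, (fun (p : Fin N → M × ℝ) (i : Fin n) => (p (e i)).2) ⁻¹' {τ | Ordered β τ} ∩
        ((⋂ i, {p | (p (e i)).2 ≠ s}) ∩ ((⋂ i, {p | (p (e i)).2 < s ↔ (i : ℕ) < j}) ∩
        ((⋂ i, {p | (p (e i)).1 = m i}) ∩ ⋂ l, ⋃ i, {p | p l = p (e i)}))) := by
    ext p
    simp only [Set.mem_preimage, Set.mem_iUnion, Set.mem_inter_iff, Set.mem_iInter,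
      Set.mem_ofPred_eq, orderedWith]
    constructor
    · rintro ⟨τ, h1, h2, h3, h4⟩
      have h5 : ∀ a, (∃ l, p l = a) ↔ ∃ i, (m i, τ i) = a := fun a => by
        rw [← Configuration.mem_ofTuple, h4, Configuration.mem_ofTuple]
      choose e he using fun i => (h5 (m i, τ i)).2 ⟨i, rfl⟩
      refine ⟨e, by simpa only [he] using h1, by simpa only [he] using h2, by simpa only [he] using h3,
        fun i => by rw [he], fun l => ?_⟩
      obtain ⟨i, hi⟩ := (h5 (p l)).1 ⟨l, rfl⟩
      exact ⟨i, by rw [he, hi]⟩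
    · rintro ⟨e, h1, h2, h3, h4, h5⟩
      refine ⟨_, h1, h2, h3, ?_⟩
      simp only [Configuration.ofTuple, Configuration.mk.injEq, ← h4]
      ext a
      simp only [Set.Finite.mem_toFinset, Set.mem_range, Prod.mk.eta]
      constructor
      · rintro ⟨l, rfl⟩
        obtain ⟨i, hi⟩ := h5 l
        exact ⟨i, hi.symm⟩
      · rintro ⟨i, rfl⟩
        exact ⟨_, rfl⟩
  rw [h]
  refine .iUnion fun e => .inter ?_ (.inter (.iInter fun i => ?_) (.inter (.iInter fun i => ?_)
    (.inter (.iInter fun i => ?_) (.iInter fun l => .iUnion fun i => ?_))))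
  · exact measurableSet_preimage (by fun_prop) (measurableSet_ordered β n)
  · exact (measurableSet_eq_fun (by fun_prop) (by fun_prop)).compl
  · by_cases hi : (i : ℕ) < j
    · simp only [hi, iff_true]
      exact measurableSet_lt (by fun_prop) (by fun_prop)
    · simp only [hi, iff_false, not_lt]
      exact measurableSet_le (by fun_prop) (by fun_prop)
  · exact measurableSet_eq_fun (by fun_prop) (by fun_prop)
  · exact measurableSet_eq_fun (by fun_prop) (by fun_prop)

variable (r : M → ℝ≥0∞) (hr : ∀ a, r a ≠ ∞) (β : ℝ)

/-- The intensity of marks with weights `r` at times in `[0, β]`. -/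
noncomputable abbrev markIntensity : Measure (M × ℝ) :=
  (Measure.sum fun a => r a • Measure.dirac a).prod (volume.restrict (Set.Icc 0 β))

omit [DiscreteMeasurableSpace M] in
include hr in
theorem isFiniteMeasure_marks : IsFiniteMeasure (Measure.sum fun a => r a • Measure.dirac a) := by
  refine ⟨?_⟩
  rw [Measure.sum_apply _ MeasurableSet.univ, tsum_fintype]
  simp [ENNReal.sum_lt_top, (hr _).lt_top]

omit [Fintype M] [MeasurableSpace M] [DiscreteMeasurableSpace M] in
theorem ofTuple_comp_perm {X : Type*} {n : ℕ} (p : Fin n → X) (σ : Equiv.Perm (Fin n)) :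
    Configuration.ofTuple (fun i => p (σ i)) = Configuration.ofTuple p := by
  simp only [Configuration.ofTuple, Configuration.mk.injEq, Set.Finite.toFinset_inj]
  exact σ.surjective.range_comp p

omit [Fintype M] [MeasurableSpace M] [DiscreteMeasurableSpace M] in
theorem ofTuple_mem_orderedWith {n : ℕ} {β s : ℝ} (m : Fin n → M) {t : Fin n → ℝ}
    (h1 : Ordered β (t ∘ Tuple.sort t)) (h2 : ∀ i, t i ≠ s) :
    Configuration.ofTuple (fun i => (m i, t i)) ∈
      orderedWith β s (m ∘ Tuple.sort t) (rankOf s t) := by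
  refine ⟨t ∘ Tuple.sort t, h1, fun i => h2 _, fun i => ?_, ?_⟩
  · rw [← rankOf_comp_perm s t (Tuple.sort t)]
    exact lt_iff_lt_rankOf h1.mono i
  · exact (ofTuple_comp_perm (fun i => (m i, t i)) (Tuple.sort t)).symm

include hr in
theorem lintegral_pi_markIntensity {n : ℕ} {f : (Fin n → M × ℝ) → ℝ≥0∞}
    (hf : AEMeasurable f (Measure.pi fun _ => markIntensity r β)) :
    ∫⁻ p, f p ∂(Measure.pi fun _ => markIntensity r β) =
      ∫⁻ t, ∑ m : Fin n → M, (∏ i, r (m i)) * f (fun i => (m i, t i)) ∂timeMeasure β n := by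
  have := isFiniteMeasure_marks r hr
  have h := measurePreserving_arrowProdEquivProdArrow M ℝ (Fin n)
    (fun _ => Measure.sum fun a => r a • Measure.dirac a) (fun _ => volume.restrict (Set.Icc 0 β))
  have h' := h.symm
  rw [← h'.map_eq, lintegral_map_equiv, lintegral_prod_symm]
  · refine lintegral_congr fun t => ?_
    rw [lintegral_fintype]
    refine Finset.sum_congr rfl fun m _ => ?_
    rw [Measure.pi_singleton, mul_comm]
    congr 1
    refine Finset.prod_congr rfl fun i _ => ?_
    classical
    rw [Measure.sum_apply _ (measurableSet_singleton _), tsum_fintype]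
    simp [Set.indicator_apply]
  · rw [← h'.map_eq] at hf
    exact hf.comp_measurable h'.measurable

omit [DiscreteMeasurableSpace M] in
include hr in
theorem ae_pi_markIntensity {n : ℕ} {p : (Fin n → ℝ) → Prop} (hp : ∀ᵐ t ∂timeMeasure β n, p t) :
    ∀ᵐ q ∂(Measure.pi fun _ : Fin n => markIntensity r β), p fun i => (q i).2 := by
  have := isFiniteMeasure_marks r hr
  exact (Measure.quasiMeasurePreserving_snd.comp (measurePreserving_arrowProdEquivProdArrow M ℝ (Fin n)
    (fun _ => Measure.sum fun a => r a • Measure.dirac a)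
    (fun _ => volume.restrict (Set.Icc 0 β))).quasiMeasurePreserving).ae hp

omit [Fintype M] [MeasurableSpace M] [DiscreteMeasurableSpace M] in
theorem measurable_ofTuple {X : Type*} [MeasurableSpace X] (n : ℕ) :
    Measurable fun p : Fin n → X => Configuration.ofTuple p :=
  fun _ hs => MeasurableSpace.measurableSet_iInf.1 hs n

variable {F : Configuration (M × ℝ) → ℝ≥0∞} {Φ : ∀ n, (Fin n → M) → Fin (n + 1) → ℝ≥0∞} {s : ℝ}
  (hF : ∀ n m j, ∀ ω ∈ orderedWith β s m j, F ω = Φ n m j)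

include hr hF in
-- `F` is controlled only on the sets `orderedWith`, where it is constant; for a fixed n they are
-- finitely many, measurable, and cover almost every configuration.
theorem aemeasurable_map_ofTuple (n : ℕ) : AEMeasurable F
    (Measure.map (fun p : Fin n → M × ℝ => Configuration.ofTuple p)
      (Measure.pi fun _ => markIntensity r β)) := by
  rw [← Measure.restrict_eq_self_of_ae_mem
    (s := ⋃ x : (Fin n → M) × Fin (n + 1), orderedWith β s x.1 x.2) (μ := Measure.map _ _),
    aemeasurable_iUnion_iff]
  · intro x
    refine (aemeasurable_const (b := Φ n x.1 x.2)).congr ?_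
    filter_upwards [ae_restrict_mem (measurableSet_orderedWith β s x.1 x.2)] with ω hω
    exact (hF n _ _ ω hω).symm
  · refine (ae_map_iff (p := fun ω => ω ∈ ⋃ x : (Fin n → M) × Fin (n + 1), orderedWith β s x.1 x.2)
      (measurable_ofTuple n).aemeasurable
      (MeasurableSet.iUnion fun x => measurableSet_orderedWith β s x.1 x.2)).2 ?_
    filter_upwards [ae_pi_markIntensity r hr β (ae_ordered_sort β n),
      ae_pi_markIntensity r hr β (ae_forall_ne β n s)] with q h1 h2
    exact Set.mem_iUnion.2 ⟨⟨_, _⟩, ofTuple_mem_orderedWith (fun i => (q i).1) h1 h2⟩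

include hr hF in
theorem aemeasurable_poissonLaw : AEMeasurable F (poissonLaw (markIntensity r β)) :=
  aemeasurable_sum_measure_iff.2 fun n => (aemeasurable_map_ofTuple r hr β hF n).smul_measure _

include hr hF in
theorem lintegral_poissonLaw : ∫⁻ ω, F ω ∂poissonLaw (markIntensity r β) =
    ∑' n : ℕ, ENNReal.ofReal (Real.exp (-(markIntensity r β).real Set.univ)) / (n.factorial : ℝ≥0∞) *
      ∫⁻ t, ∑ m : Fin n → M, (∏ i, r (m i)) * Φ n m (rankOf s t) ∂timeMeasure β n := by
  have hn := aemeasurable_map_ofTuple r hr β hF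
  rw [poissonLaw, lintegral_sum_measure]
  refine tsum_congr fun n => ?_
  rw [lintegral_smul_measure, lintegral_map' (hn n) (measurable_ofTuple n).aemeasurable,
    lintegral_pi_markIntensity r hr β (f := fun p => F (Configuration.ofTuple p))
      ((hn n).comp_measurable (measurable_ofTuple n)), smul_eq_mul]
  congr 1
  refine lintegral_congr_ae ?_
  filter_upwards [ae_ordered_sort β n, ae_forall_ne β n s] with t h1 h2
  -- Sorting the times permutes the marks. Their product weight is symmetric, so the permutation is
  -- absorbed in the sum over all marks.
  rw [← Equiv.sum_comp (Equiv.arrowCongr (Tuple.sort t).symm (Equiv.refl M))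
    (fun m => (∏ i, r (m i)) * Φ n m (rankOf s t))]
  refine Finset.sum_congr rfl fun m _ => ?_
  rw [hF n _ _ _ (ofTuple_mem_orderedWith m h1 h2)]
  congr 1
  exact (Equiv.prod_comp (Tuple.sort t) fun i => r (m i)).symm

end Poisson

end RandomLoop

namespace RandomLoop

/-! ### The random loop model as a spin system -/

section SpinSystem

theorem hasSum_trace_exp {m : Type*} [Fintype m] [DecidableEq m] (β : ℝ) (A : Matrix m m ℝ) :
    HasSum (fun n : ℕ => β ^ n / n.factorial * (A ^ n).trace) (NormedSpace.exp (β • A)).trace := by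
  let _ : NormedRing (Matrix m m ℝ) := Matrix.linftyOpNormedRing
  let _ : NormedAlgebra ℝ (Matrix m m ℝ) := Matrix.linftyOpNormedAlgebra
  have h := (NormedSpace.exp_series_hasSum_exp' (𝕂 := ℝ) (β • A)).mapL
    (LinearMap.toContinuousLinearMap (Matrix.traceLinearMap m ℝ ℝ))
  refine h.congr_fun fun n => ?_
  simp only [LinearMap.coe_toContinuousLinearMap', Matrix.traceLinearMap_apply, smul_pow,
    Matrix.trace_smul, smul_eq_mul]
  ring

variable {V : Type*} [Fintype V] [DecidableEq V] {G : SimpleGraph V} [DecidableRel G.Adj]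
  {C : Type*} [Fintype C] [DecidableEq C] {β u : ℝ}

theorem rate_nonneg (hu0 : 0 ≤ u) (hu1 : u ≤ 1) (k : LinkKind) : 0 ≤ rate u k := by
  cases k
  · exact hu0
  · exact sub_nonneg.2 hu1

/-- The normalization of the Poisson point process. -/
noncomputable def poissonFactor (G : SimpleGraph V) (β u : ℝ) : ℝ≥0∞ :=
  ENNReal.ofReal (Real.exp (-(intensity G β u).real Set.univ))

omit [Fintype V] [DecidableEq V] [DecidableRel G.Adj] in
theorem poissonFactor_ne_zero : poissonFactor G β u ≠ 0 := by
  simp [poissonFactor, Real.exp_pos]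

omit [Fintype V] [DecidableEq V] [DecidableRel G.Adj] in
theorem poissonFactor_ne_top : poissonFactor G β u ≠ ∞ := ENNReal.ofReal_ne_top

/-- The weight of the marks of `n` events. -/
noncomputable def marksWeight (C : Type*) [Fintype C] (u : ℝ) {n : ℕ} (m : Fin n → Mark G) : ℝ :=
  (∏ i, rate u (m i).kind) * (Fintype.card C : ℝ) ^ Fintype.card (LoopClass m)

omit [DecidableRel G.Adj] [DecidableEq C] in
theorem marksWeight_nonneg (hu0 : 0 ≤ u) (hu1 : u ≤ 1) {n : ℕ} (m : Fin n → Mark G) :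
    0 ≤ marksWeight C u m :=
  mul_nonneg (Finset.prod_nonneg fun _ _ => rate_nonneg hu0 hu1 _) (by positivity)

open scoped Classical in
/-- The weight of the marks that connect `(x, 0)` with `y` in the time slot `j`. -/
noncomputable def pairWeight (G : SimpleGraph V) (C : Type*) [Fintype C] (u : ℝ) (x y : V) (n : ℕ)
    (j : Fin (n + 1)) : ℝ :=
  ∑ m : Fin n → Mark G, if loopClass m x 0 = loopClass m y j then marksWeight C u m else 0

variable (G C β u) in
/-- The term with `n` events in the integral of the loop correlation over time. -/
noncomputable def pairTerm (x y : V) (n : ℕ) : ℝ :=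
  β ^ (n + 1) / (n + 1).factorial * ∑ j, pairWeight G C u x y n j

omit [DecidableRel G.Adj] [DecidableEq C] in
theorem pairWeight_nonneg (hu0 : 0 ≤ u) (hu1 : u ≤ 1) (x y : V) (n : ℕ) (j : Fin (n + 1)) :
    0 ≤ pairWeight G C u x y n j :=
  Finset.sum_nonneg fun m _ => by
    split_ifs
    · exact marksWeight_nonneg hu0 hu1 m
    · exact le_rfl

theorem sum_marksWeight (n : ℕ) :
    ∑ m : Fin n → Mark G, marksWeight C u m = (loopGenerator G C u ^ n).trace :=
  sum_marks_pow_card u n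

theorem pairWeight_le (hu0 : 0 ≤ u) (hu1 : u ≤ 1) (x y : V) (n : ℕ) (j : Fin (n + 1)) :
    pairWeight G C u x y n j ≤ (loopGenerator G C u ^ n).trace := by
  rw [← sum_marksWeight]
  refine Finset.sum_le_sum fun m _ => ?_
  split_ifs
  · exact le_rfl
  · exact marksWeight_nonneg hu0 hu1 m

theorem sum_sq_mul_pairWeight {w : C → ℝ} (hw : ∑ a, w a = 0) (x y : V) (n : ℕ) (j : Fin (n + 1)) :
    (∑ a, w a ^ 2) * pairWeight G C u x y n j = Fintype.card C *
      (siteOp x (Matrix.diagonal w) * loopGenerator G C u ^ (j : ℕ) *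
        siteOp y (Matrix.diagonal w) * loopGenerator G C u ^ (n - j)).trace := by
  classical
  rw [← sum_marks_two_point u hw, pairWeight, Finset.mul_sum]
  refine Finset.sum_congr rfl fun m _ => ?_
  rw [marksWeight]
  split_ifs <;> ring

omit [DecidableRel G.Adj] [DecidableEq C] in
theorem pairTerm_nonneg (hβ : 0 ≤ β) (hu0 : 0 ≤ u) (hu1 : u ≤ 1) (x y : V) (n : ℕ) :
    0 ≤ pairTerm G C β u x y n :=
  mul_nonneg (by positivity) (Finset.sum_nonneg fun j _ => pairWeight_nonneg hu0 hu1 x y n j)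

theorem summable_pairTerm (hβ : 0 ≤ β) (hu0 : 0 ≤ u) (hu1 : u ≤ 1) (x y : V) :
    Summable (pairTerm G C β u x y) := by
  refine Summable.of_nonneg_of_le (pairTerm_nonneg hβ hu0 hu1 x y) (fun n => ?_)
    ((hasSum_trace_exp β (loopGenerator G C u)).summable.mul_left β)
  -- The n + 1 slots reduce (n+1)! to n!, leaving β times the series of tr e^{βH}.
  calc pairTerm G C β u x y n
      ≤ β ^ (n + 1) / (n + 1).factorial * ∑ j : Fin (n + 1), (loopGenerator G C u ^ n).trace :=
        mul_le_mul_of_nonneg_left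
          (Finset.sum_le_sum fun j _ => pairWeight_le hu0 hu1 x y n j) (by positivity)
    _ = _ := by
      rw [Finset.sum_const, Finset.card_univ, Fintype.card_fin, nsmul_eq_mul, Nat.factorial_succ]
      have := Nat.factorial_ne_zero n
      push_cast
      field_simp
      ring

/-- All terms of the series are nonnegative, being sums of weights, and the term n = 0 counts the
colourings of V. -/
theorem trace_exp_pos [Nonempty C] (hβ : 0 ≤ β) (hu0 : 0 ≤ u) (hu1 : u ≤ 1) :
    0 < (NormedSpace.exp (β • loopGenerator G C u)).trace := by
  have h := hasSum_trace_exp β (loopGenerator G C u)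
  have h0 := h.summable.sum_le_tsum {0} (fun n _ => mul_nonneg (by positivity) (by
    rw [← sum_marksWeight]
    exact Finset.sum_nonneg fun m _ => marksWeight_nonneg hu0 hu1 m))
  rw [h.tsum_eq] at h0
  refine lt_of_lt_of_le ?_ h0
  simp [Fintype.card_pos]

theorem slot_of_lt_iff {n : ℕ} {τ : Fin n → ℝ} {s : ℝ} {j : Fin (n + 1)} (hs0 : 0 < s) (hsβ : s < β)
    (h1 : ∀ i, τ i ≠ s) (h2 : ∀ i, τ i < s ↔ (i : ℕ) < j) :
    slotStart τ j < s ∧ s < slotEnd β τ j := by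
  constructor
  · induction j using Fin.cases with
    | zero => exact hs0
    | succ i => exact (h2 i).2 (by simp)
  · induction j using Fin.lastCases with
    | last => simpa [slotEnd] using hsβ
    | cast i =>
      have : slotEnd β τ i.castSucc = τ i := by simp [slotEnd]
      rw [this]
      exact lt_of_le_of_ne (not_lt.1 fun h => by simpa using (h2 i).1 h) (h1 i).symm

omit [Fintype V] [DecidableEq V] [DecidableRel G.Adj] in
theorem intensity_eq (β u : ℝ) : intensity G β u =
    markIntensity (fun a : Mark G => ENNReal.ofReal (rate u a.kind)) β := rfl

omit [DecidableRel G.Adj] [DecidableEq C] in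
theorem numLoops_orderedWith (hβ : 0 < β) {s : ℝ} (n : ℕ) (m : Fin n → Mark G) (j : Fin (n + 1)) :
    ∀ ω ∈ orderedWith β s m j, ENNReal.ofReal (Fintype.card C) ^ numLoops β ω =
      ENNReal.ofReal (Fintype.card C) ^ Fintype.card (LoopClass m) := by
  have : Fact (0 < β) := ⟨hβ⟩
  rintro ω ⟨τ, hτ, h1, h2, rfl⟩
  rw [← hτ.numLoops_eq m]

omit [DecidableRel G.Adj] [DecidableEq C] in
open scoped Classical in
theorem connected_orderedWith (hβ : 0 < β) {s : ℝ} (hs : s ∈ Set.Ioo 0 β) (x y : V) (n : ℕ)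
    (m : Fin n → Mark G) (j : Fin (n + 1)) : ∀ ω ∈ orderedWith β s m j,
      (connected G β x y s).indicator
        (fun ω => ENNReal.ofReal (Fintype.card C) ^ numLoops β ω) ω =
      if loopClass m x 0 = loopClass m y j then
        ENNReal.ofReal (Fintype.card C) ^ Fintype.card (LoopClass m) else 0 := by
  have : Fact (0 < β) := ⟨hβ⟩
  intro ω hω
  rw [← numLoops_orderedWith hβ n m j ω hω]
  obtain ⟨τ, hτ, h1, h2, rfl⟩ := hω
  obtain ⟨h3, h4⟩ := slot_of_lt_iff hs.1 hs.2 h1 h2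
  have := hτ.mem_connected_iff m x y h3 h4
  rw [Set.indicator_apply]
  exact if_congr this rfl rfl

omit [DecidableRel G.Adj] [DecidableEq C] in
theorem prod_ofReal_rate_mul (hu0 : 0 ≤ u) (hu1 : u ≤ 1) {n : ℕ} (m : Fin n → Mark G) :
    (∏ i, ENNReal.ofReal (rate u (m i).kind)) *
      ENNReal.ofReal (Fintype.card C) ^ Fintype.card (LoopClass m) =
      ENNReal.ofReal (marksWeight C u m) := by
  rw [marksWeight, ENNReal.ofReal_mul (Finset.prod_nonneg fun _ _ => rate_nonneg hu0 hu1 _),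
    ENNReal.ofReal_prod_of_nonneg fun _ _ => rate_nonneg hu0 hu1 _,
    ENNReal.ofReal_pow (Nat.cast_nonneg _)]

theorem partitionFunction_eq (hβ : 0 < β) (hu0 : 0 ≤ u) (hu1 : u ≤ 1) :
    partitionFunction G β u (Fintype.card C) = poissonFactor G β u *
      ENNReal.ofReal (NormedSpace.exp (β • loopGenerator G C u)).trace := by
  have h0 : ∀ n : ℕ, 0 ≤ (loopGenerator G C u ^ n).trace := fun n => by
    rw [← sum_marksWeight]
    exact Finset.sum_nonneg fun m _ => marksWeight_nonneg hu0 hu1 m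
  have h := hasSum_trace_exp β (loopGenerator G C u)
  rw [partitionFunction, poissonMeasure, intensity_eq,
    lintegral_poissonLaw _ (fun _ => ENNReal.ofReal_ne_top) β (s := 0)
      (fun n m j => numLoops_orderedWith (C := C) hβ n m j), ← h.tsum_eq,
    ENNReal.ofReal_tsum_of_nonneg (fun n => mul_nonneg (by positivity) (h0 n)) h.summable,
    ← ENNReal.tsum_mul_left]
  refine tsum_congr fun n => ?_
  simp only [prod_ofReal_rate_mul hu0 hu1]
  rw [← ENNReal.ofReal_sum_of_nonneg fun m _ => marksWeight_nonneg hu0 hu1 m, sum_marksWeight,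
    lintegral_const, Measure.pi_univ, ENNReal.ofReal_mul (by positivity),
    ENNReal.ofReal_div_of_pos (by positivity), ENNReal.ofReal_pow hβ.le, ENNReal.ofReal_natCast]
  simp only [Measure.restrict_apply_univ, Real.volume_Icc, sub_zero, Finset.prod_const,
    Finset.card_univ, Fintype.card_fin, div_eq_mul_inv, ← intensity_eq, poissonFactor]
  ring

/-- The integral over the events of the weight of the configurations that connect. -/
noncomputable def pairIntegral (G : SimpleGraph V) (C : Type*) [Fintype C] (β u : ℝ) (x y : V)
    (s : ℝ) : ℝ≥0∞ :=
  ∑' n : ℕ, (n.factorial : ℝ≥0∞)⁻¹ *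
    ∫⁻ t, ENNReal.ofReal (pairWeight G C u x y n (rankOf s t)) ∂timeMeasure β n

omit [DecidableRel G.Adj] [DecidableEq C] in
theorem loopMeasure_connected [Nonempty C] (hβ : 0 < β) (hu0 : 0 ≤ u) (hu1 : u ≤ 1) {s : ℝ}
    (hs : s ∈ Set.Ioo 0 β) (x y : V) :
    loopMeasure G β u (Fintype.card C) (connected G β x y s) =
      (partitionFunction G β u (Fintype.card C))⁻¹ *
        (poissonFactor G β u * pairIntegral G C β u x y s) := by
  classical
  have hF := fun n m j => connected_orderedWith (G := G) (C := C) hβ hs x y n m j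
  have hr : ∀ a : Mark G, ENNReal.ofReal (rate u a.kind) ≠ ∞ := fun _ => ENNReal.ofReal_ne_top
  -- The weight never vanishes, so the event is the set where the indicator times the weight is
  -- nonzero.
  have hnull : NullMeasurableSet (connected G β x y s) (poissonMeasure G β u) := by
    have h := (aemeasurable_poissonLaw _ hr β hF).nullMeasurable (measurableSet_singleton 0).compl
    rw [poissonMeasure, intensity_eq]
    convert h using 1
    ext ω
    simp
  have hfin := isFiniteMeasure_marks _ hr
  have : IsFiniteMeasure (intensity G β u) := by rw [intensity]; infer_instance
  have : SFinite (poissonMeasure G β u) := by rw [poissonMeasure, poissonLaw]; infer_instance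
  rw [loopMeasure, Measure.smul_apply, withDensity_apply', ← lintegral_indicator₀ hnull, smul_eq_mul,
    poissonMeasure, intensity_eq, lintegral_poissonLaw _ hr β hF]
  congr 1
  rw [pairIntegral, ← ENNReal.tsum_mul_left]
  refine tsum_congr fun n => ?_
  simp only [mul_ite, mul_zero, prod_ofReal_rate_mul hu0 hu1]
  rw [← intensity_eq, ← poissonFactor, div_eq_mul_inv, mul_assoc]
  congr 2
  refine lintegral_congr fun t => ?_
  rw [pairWeight, ENNReal.ofReal_sum_of_nonneg fun m _ => by
    split_ifs
    · exact marksWeight_nonneg hu0 hu1 m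
    · exact le_rfl]
  refine Finset.sum_congr rfl fun m _ => ?_
  split_ifs <;> simp

omit [DecidableRel G.Adj] [DecidableEq C] in
theorem measurable_lintegral_pairWeight (x y : V) (n : ℕ) : Measurable fun s : ℝ =>
    ∫⁻ t, ENNReal.ofReal (pairWeight G C u x y n (rankOf s t)) ∂timeMeasure β n :=
  Measurable.lintegral_prod_right' (f := fun p : ℝ × (Fin n → ℝ) =>
      ENNReal.ofReal (pairWeight G C u x y n (rankOf p.1 p.2)))
    ((measurable_of_finite fun j => ENNReal.ofReal (pairWeight G C u x y n j)).comp
      measurable_rankOf)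

omit [DecidableRel G.Adj] [DecidableEq C] in
theorem measurable_pairIntegral (x y : V) : Measurable (pairIntegral G C β u x y) :=
  Measurable.tsum fun n => (measurable_lintegral_pairWeight x y n).const_mul _

/-- By `lintegral_rankOf`, integration over s replaces the random slot by the sum over all slots and
turns β^n/n! into β^{n+1}/(n+1)!. -/
theorem lintegral_pairIntegral (hβ : 0 ≤ β) (hu0 : 0 ≤ u) (hu1 : u ≤ 1) (x y : V) :
    ∫⁻ s in Set.Icc 0 β, pairIntegral G C β u x y s =
      ENNReal.ofReal (∑' n, pairTerm G C β u x y n) := by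
  simp only [pairIntegral]
  rw [lintegral_tsum fun n => ((measurable_lintegral_pairWeight x y n).const_mul _).aemeasurable,
    ENNReal.ofReal_tsum_of_nonneg (pairTerm_nonneg hβ hu0 hu1 x y)
      (summable_pairTerm hβ hu0 hu1 x y)]
  refine tsum_congr fun n => ?_
  rw [lintegral_const_mul _ (measurable_lintegral_pairWeight x y n)]
  have h := lintegral_rankOf β fun j => ENNReal.ofReal (pairWeight G C u x y n j)
  rw [← ENNReal.ofReal_sum_of_nonneg fun j _ => pairWeight_nonneg hu0 hu1 x y n j] at h
  rw [pairTerm, ENNReal.ofReal_mul (by positivity), ENNReal.ofReal_div_of_pos (by positivity),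
    ENNReal.ofReal_pow hβ, ENNReal.ofReal_natCast, div_eq_mul_inv, mul_right_comm, ← h,
    Nat.factorial_succ, Nat.cast_mul, ENNReal.mul_inv (by simp) (by simp)]
  have h1 : ((n + 1 : ℕ) : ℝ≥0∞)⁻¹ * ((n : ℝ≥0∞) + 1) = 1 := by
    rw [Nat.cast_add_one]
    exact ENNReal.inv_mul_cancel (by simp) (by simp)
  calc _ = (((n + 1 : ℕ) : ℝ≥0∞)⁻¹ * ((n : ℝ≥0∞) + 1)) * ((n.factorial : ℝ≥0∞)⁻¹ *
        ∫⁻ s in Set.Icc 0 β, ∫⁻ t, ENNReal.ofReal (pairWeight G C u x y n (rankOf s t))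
          ∂timeMeasure β n) := by rw [h1, one_mul]
    _ = _ := by ring

/-- The integral of the loop correlation over time. -/
theorem integral_loopMeasure_connected [Nonempty C] (hβ : 0 < β) (hu0 : 0 ≤ u) (hu1 : u ≤ 1)
    (x y : V) : ∫ s in (0 : ℝ)..β, (loopMeasure G β u (Fintype.card C)).real (connected G β x y s) =
      (∑' n, pairTerm G C β u x y n) / (NormedSpace.exp (β • loopGenerator G C u)).trace := by
  have hZ := trace_exp_pos (G := G) (C := C) hβ.le hu0 hu1
  have hY : ∀ s ∈ Set.Ioo 0 β, loopMeasure G β u (Fintype.card C) (connected G β x y s) =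
      (ENNReal.ofReal (NormedSpace.exp (β • loopGenerator G C u)).trace)⁻¹ *
        pairIntegral G C β u x y s := by
    intro s hs
    rw [loopMeasure_connected hβ hu0 hu1 hs, partitionFunction_eq hβ hu0 hu1,
      ENNReal.mul_inv (.inl poissonFactor_ne_zero) (.inl poissonFactor_ne_top)]
    calc _ = ((poissonFactor G β u)⁻¹ * poissonFactor G β u) * ((ENNReal.ofReal
          (NormedSpace.exp (β • loopGenerator G C u)).trace)⁻¹ * pairIntegral G C β u x y s) := by ring
      _ = _ := by rw [ENNReal.inv_mul_cancel poissonFactor_ne_zero poissonFactor_ne_top, one_mul]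
  have hlin := lintegral_pairIntegral (G := G) (C := C) hβ.le hu0 hu1 x y
  rw [← restrict_Ioo_eq_restrict_Icc] at hlin
  rw [intervalIntegral.integral_of_le hβ.le, ← integral_Ioc_eq_integral_Ioo.symm,
    setIntegral_congr_fun (g := fun s => ((ENNReal.ofReal
      (NormedSpace.exp (β • loopGenerator G C u)).trace)⁻¹ * pairIntegral G C β u x y s).toReal)
      measurableSet_Ioo (fun s hs => by rw [measureReal_def, hY s hs]),
    integral_toReal, lintegral_const_mul _ (measurable_pairIntegral x y), hlin, ENNReal.toReal_mul,
    ENNReal.toReal_inv, ENNReal.toReal_ofReal hZ.le, ENNReal.toReal_ofReal, div_eq_inv_mul]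
  · exact tsum_nonneg (pairTerm_nonneg hβ.le hu0 hu1 x y)
  · exact ((measurable_pairIntegral x y).const_mul _).aemeasurable
  · have : ∀ᵐ s ∂volume.restrict (Set.Ioo 0 β), pairIntegral G C β u x y s < ∞ :=
      ae_lt_top (measurable_pairIntegral x y) (by rw [hlin]; exact ENNReal.ofReal_ne_top)
    filter_upwards [this] with s hs
    exact ENNReal.mul_lt_top (ENNReal.inv_lt_top.2 (ENNReal.ofReal_pos.2 hZ)) hs

end SpinSystem

end RandomLoop

namespace RandomLoop

/-! ### The infrared bound -/

section InfraredBound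

variable {V : Type*} [Fintype V] [DecidableEq V] {G : SimpleGraph V}
  {C : Type*} [Fintype C] [DecidableEq C] {β u : ℝ}

theorem exists_sum_eq_zero (hC : 2 ≤ Fintype.card C) :
    ∃ w : C → ℝ, ∑ a, w a = 0 ∧ 0 < ∑ a, w a ^ 2 := by
  obtain ⟨a, b, hab⟩ := Fintype.one_lt_card_iff.1 hC
  refine ⟨Pi.single a 1 - Pi.single b 1, by simp, ?_⟩
  refine Finset.sum_pos' (fun _ _ => sq_nonneg _) ⟨a, Finset.mem_univ a, ?_⟩
  simp [hab]

theorem trace_reindexAlgEquiv {m n : Type*} [Fintype m] [DecidableEq m] [Fintype n] [DecidableEq n]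
    (e : m ≃ n) (A : Matrix m m ℝ) : (Matrix.reindexAlgEquiv ℝ ℝ e A).trace = A.trace := by
  rw [Matrix.coe_reindexAlgEquiv, Matrix.reindex_apply]
  exact e.symm.sum_comp fun i => A i i

theorem trace_siteOp_equiv [DecidableRel G.Adj] (e : V ≃ V)
    (he : ∀ x y, G.Adj (e x) (e y) ↔ G.Adj x y) (x y : V) (M N : Matrix C C ℝ) (a b : ℕ) :
    (siteOp (e x) M * loopGenerator G C u ^ a * siteOp (e y) N * loopGenerator G C u ^ b).trace =
      (siteOp x M * loopGenerator G C u ^ a * siteOp y N * loopGenerator G C u ^ b).trace := by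
  rw [← trace_reindexAlgEquiv (Equiv.arrowCongr e (Equiv.refl C)) (siteOp x M * _ * _ * _),
    map_mul, map_mul, map_mul, map_pow, map_pow, reindex_loopGenerator u e he, reindex_siteOp,
    reindex_siteOp]

/-- The symmetry is read off from the traces, so the loops themselves need not be transported; any
`w` of mean zero with Σ w² > 0 can be divided out. -/
theorem pairTerm_equiv [DecidableRel G.Adj] (hC : 2 ≤ Fintype.card C) (e : V ≃ V)
    (he : ∀ x y, G.Adj (e x) (e y) ↔ G.Adj x y) (x y : V) :
    pairTerm G C β u (e x) (e y) = pairTerm G C β u x y := by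
  obtain ⟨w, hw, hw2⟩ := exists_sum_eq_zero hC
  funext n
  rw [pairTerm, pairTerm]
  congr 1
  refine Finset.sum_congr rfl fun j _ => mul_left_cancel₀ hw2.ne' ?_
  rw [sum_sq_mul_pairWeight hw, sum_sq_mul_pairWeight hw, trace_siteOp_equiv e he]

/-- The integral of the correlation between two sites over time. -/
noncomputable def pairCorrelation (G : SimpleGraph V) (β u θ : ℝ) (x y : V) : ℝ :=
  ∫ s in (0 : ℝ)..β, (loopMeasure G β u θ).real (connected G β x y s)

theorem pairCorrelation_equiv (hC : 2 ≤ Fintype.card C) (hβ : 0 < β) (hu0 : 0 ≤ u) (hu1 : u ≤ 1)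
    (e : V ≃ V) (he : ∀ x y, G.Adj (e x) (e y) ↔ G.Adj x y) (x y : V) :
    pairCorrelation G β u (Fintype.card C) (e x) (e y) =
      pairCorrelation G β u (Fintype.card C) x y := by
  classical
  have : Nonempty C := Fintype.card_pos_iff.1 (by omega)
  rw [pairCorrelation, pairCorrelation, integral_loopMeasure_connected hβ hu0 hu1,
    integral_loopMeasure_connected hβ hu0 hu1, pairTerm_equiv hC e he]

/-- The trace formula turns `tsum_duhamel_le` into a bound on correlations. The factor β (Σ w²) tr
e^{βH} is common to both sides and cancels; only the factor θ of the two-point colouring sum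
remains. -/
theorem sum_laplacian_mul_pairCorrelation_le [DecidableRel G.Adj] (hC : 2 ≤ Fintype.card C)
    (hβ : 0 < β) (hu0 : 0 ≤ u) (hu1 : u ≤ 1 / 2) (hG : G.Connected)
    (hrefl : ∀ x y, G.Adj x y → ∃ r H, IsReflection G r H ∧ r x = y) (v : V → ℝ) :
    ∑ x, ∑ y, laplacian G v x * laplacian G v y *
        pairCorrelation G β u (Fintype.card C) x y ≤
      Fintype.card C * ∑ x, v x * laplacian G v x := by
  have hu1' : u ≤ 1 := by linarith
  have : Nonempty C := Fintype.card_pos_iff.1 (by omega)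
  obtain ⟨w, hw, hw2⟩ := exists_sum_eq_zero hC
  have hZ := trace_exp_pos (G := G) (C := C) hβ.le hu0 hu1'
  have hθ : (0 : ℝ) < Fintype.card C := by exact_mod_cast Fintype.card_pos
  have h := tsum_duhamel_le (G := G) (C := C) hβ.le hu0 hu1 w hG hrefl v _ _ rfl rfl
  have h1 : ∀ n : ℕ, ((n + 1).factorial : ℝ)⁻¹ * ∑ i ∈ Finset.range (n + 1),
      ((β • ∑ x, laplacian G v x • siteOp x (Matrix.diagonal w)) *
        (β • loopGenerator G C u) ^ i * (β • ∑ x, laplacian G v x • siteOp x (Matrix.diagonal w)) *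
        (β • loopGenerator G C u) ^ (n - i)).trace =
      ∑ x, ∑ y, laplacian G v x * laplacian G v y * (β * (∑ a, w a ^ 2) / Fintype.card C) *
        pairTerm G C β u x y n := by
    intro n
    have h2 : ∀ i ∈ Finset.range (n + 1),
        ((β • ∑ x, laplacian G v x • siteOp x (Matrix.diagonal w)) *
          (β • loopGenerator G C u) ^ i *
          (β • ∑ x, laplacian G v x • siteOp x (Matrix.diagonal w)) *
          (β • loopGenerator G C u) ^ (n - i)).trace = β ^ (n + 2) *
        ∑ x, ∑ y, laplacian G v x * laplacian G v y * (siteOp x (Matrix.diagonal w) *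
          loopGenerator G C u ^ i * siteOp y (Matrix.diagonal w) *
          loopGenerator G C u ^ (n - i)).trace := by
      intro i hi
      have hi : i ≤ n := Nat.lt_succ_iff.1 (Finset.mem_range.1 hi)
      simp only [smul_pow, Matrix.smul_mul, Matrix.mul_smul, Matrix.trace_smul, smul_eq_mul,
        Finset.sum_mul, Finset.mul_sum, Matrix.trace_sum]
      rw [Finset.sum_comm]
      refine Finset.sum_congr rfl fun x _ => Finset.sum_congr rfl fun y _ => ?_
      -- There are n powers of β from `X` and two from `Y`; `pairTerm` takes n + 1 of them.
      have : β ^ (n + 2) = β ^ i * β ^ (n - i) * β * β := by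
        rw [← pow_add, Nat.add_sub_cancel' hi]; ring
      rw [this]
      ring
    rw [Finset.sum_congr rfl h2, ← Finset.mul_sum, Finset.sum_comm, Finset.mul_sum, Finset.mul_sum]
    refine Finset.sum_congr rfl fun x _ => ?_
    rw [Finset.sum_comm, Finset.mul_sum, Finset.mul_sum]
    refine Finset.sum_congr rfl fun y _ => ?_
    rw [← Finset.mul_sum, Finset.sum_range, pairTerm]
    have h3 := fun j => sum_sq_mul_pairWeight (G := G) (u := u) hw x y n j
    have h4 : (∑ a, w a ^ 2) / Fintype.card C * ∑ j, pairWeight G C u x y n j =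
        ∑ j : Fin (n + 1), (siteOp x (Matrix.diagonal w) * loopGenerator G C u ^ (j : ℕ) *
          siteOp y (Matrix.diagonal w) * loopGenerator G C u ^ (n - j)).trace := by
      rw [Finset.mul_sum]
      refine Finset.sum_congr rfl fun j _ => ?_
      rw [div_mul_eq_mul_div, h3, mul_div_cancel_left₀ _ hθ.ne']
    rw [← h4]
    ring
  have hs : ∀ x y, Summable (pairTerm G C β u x y) := summable_pairTerm hβ.le hu0 hu1'
  rw [tsum_congr h1, Summable.tsum_finsetSum fun x _ => summable_sum fun y _ => (hs x y).mul_left _]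
    at h
  simp only [Summable.tsum_finsetSum fun y _ => (hs _ y).mul_left _, tsum_mul_left] at h
  have h5 : ∀ x y, ∑' n, pairTerm G C β u x y n =
      pairCorrelation G β u (Fintype.card C) x y *
        (NormedSpace.exp (β • loopGenerator G C u)).trace := fun x y => by
    rw [pairCorrelation, integral_loopMeasure_connected hβ hu0 hu1', div_mul_cancel₀ _ hZ.ne']
  simp only [h5] at h
  have h6 : (∑ x, ∑ y, laplacian G v x * laplacian G v y * (β * (∑ a, w a ^ 2) / Fintype.card C) *
      (pairCorrelation G β u (Fintype.card C) x y *
        (NormedSpace.exp (β • loopGenerator G C u)).trace)) =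
      (β * (∑ a, w a ^ 2) * (NormedSpace.exp (β • loopGenerator G C u)).trace / Fintype.card C) *
      ∑ x, ∑ y, laplacian G v x * laplacian G v y *
        pairCorrelation G β u (Fintype.card C) x y := by
    simp only [Finset.mul_sum]
    refine Finset.sum_congr rfl fun x _ => Finset.sum_congr rfl fun y _ => ?_
    ring
  rw [h6, div_mul_eq_mul_div, div_le_iff₀ hθ] at h
  have h7 : 0 < β * (∑ a, w a ^ 2) * (NormedSpace.exp (β • loopGenerator G C u)).trace := by
    positivity
  refine le_of_mul_le_mul_left (h.trans_eq ?_) h7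
  ring

end InfraredBound

/-! ### The torus -/

section Torus

variable {d L : ℕ}

theorem torus_adj_iff (hL : 2 < L) (x y : Fin d → ZMod L) :
    (torus d L).Adj x y ↔ ∃ p : Fin d × ℤˣ, y = x + Pi.single p.1 ((p.2 : ℤ) : ZMod L) := by
  have : Fact (1 < L) := ⟨by omega⟩
  rw [torus, SimpleGraph.fromRel_adj]
  constructor
  · rintro ⟨-, ⟨i, h⟩ | ⟨i, h⟩⟩
    · exact ⟨(i, 1), by simpa using h⟩
    · exact ⟨(i, -1), by simp [h, Pi.single_neg]⟩
  · rintro ⟨⟨i, δ⟩, rfl⟩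
    rcases Int.units_eq_one_or δ with rfl | rfl
    · exact ⟨by simp, .inl ⟨i, by simp⟩⟩
    · exact ⟨by simp, .inr ⟨i, by simp [Pi.single_neg]⟩⟩

/-- Since L > 2 the steps 1 and -1 differ modulo L, so there are no double edges and the Laplacian
is a sum over directions and signs. -/
theorem neighbour_injective (hL : 2 < L) (x : Fin d → ZMod L) :
    Function.Injective fun p : Fin d × ℤˣ => x + Pi.single p.1 ((p.2 : ℤ) : ZMod L) := by
  have : Fact (1 < L) := ⟨by omega⟩
  have : Fact (2 < L) := ⟨hL⟩
  rintro ⟨i, δ⟩ ⟨j, δ'⟩ h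
  have h1 := congrFun (add_left_cancel h) i
  have h0 : ((δ : ℤ) : ZMod L) ≠ 0 := by
    rcases Int.units_eq_one_or δ with rfl | rfl <;> simp
  have hij : i = j := by
    by_contra hij
    simp [hij, h0] at h1
  subst hij
  rcases Int.units_eq_one_or δ with rfl | rfl <;> rcases Int.units_eq_one_or δ' with rfl | rfl
  · rfl
  · simp [ZMod.neg_one_ne_one.symm] at h1
  · simp [ZMod.neg_one_ne_one] at h1
  · rfl

open scoped Classical in
theorem laplacian_torus [NeZero L] (hL : 2 < L) (v : (Fin d → ZMod L) → ℝ) (x : Fin d → ZMod L) :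
    laplacian (torus d L) v x =
      ∑ i, (2 * v x - v (x + Pi.single i 1) - v (x - Pi.single i 1)) := by
  have h : laplacian (torus d L) v x =
      ∑ p : Fin d × ℤˣ, (v x - v (x + Pi.single p.1 ((p.2 : ℤ) : ZMod L))) := by
    rw [laplacian, ← Finset.sum_filter, ← Finset.sum_image (f := fun y => v x - v y)
      fun p _ q _ h => neighbour_injective hL x h]
    refine Finset.sum_congr ?_ fun _ _ => rfl
    ext y
    simp [torus_adj_iff hL, eq_comm]
  rw [h, Fintype.sum_prod_type]
  refine Finset.sum_congr rfl fun i _ => ?_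
  have hu : (Finset.univ : Finset ℤˣ) = {1, -1} := rfl
  rw [hu, Finset.sum_pair (by decide)]
  simp [Pi.single_neg, ← sub_eq_add_neg]
  ring

theorem torus_adj_add (a x y : Fin d → ZMod L) :
    (torus d L).Adj (x + a) (y + a) ↔ (torus d L).Adj x y := by
  simp only [torus, SimpleGraph.fromRel_adj, ne_eq, add_left_inj, add_right_comm _ a]

theorem torus_adj_neg (x y : Fin d → ZMod L) :
    (torus d L).Adj (-x) (-y) ↔ (torus d L).Adj x y := by
  have h : ∀ x y : Fin d → ZMod L, (∃ i, -y = -x + Pi.single i 1) ↔ ∃ i, x = y + Pi.single i 1 :=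
    fun x y => exists_congr fun i => by
      constructor <;> intro h
      · rw [neg_eq_iff_eq_neg.1 h]; abel
      · rw [h]; abel
  simp only [torus, SimpleGraph.fromRel_adj, ne_eq, neg_inj, h, or_comm]

theorem torus_connected [NeZero L] (hL : 2 < L) : (torus d L).Connected := by
  let S : AddSubmonoid (Fin d → ZMod L) :=
    { carrier := {a | ∀ x, (torus d L).Reachable x (x + a)}
      zero_mem' := fun x => by rw [add_zero]
      add_mem' := fun {a b} ha hb x => by
        rw [← add_assoc]
        exact (ha x).trans (hb _) }
  have h1 : ∀ i, Pi.single i 1 ∈ S := fun i x =>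
    SimpleGraph.Adj.reachable ((torus_adj_iff hL _ _).2 ⟨(i, 1), by simp⟩)
  have h2 : ∀ a, a ∈ S := fun a => by
    rw [← Finset.univ_sum_single a]
    refine sum_mem fun i _ => ?_
    have : (Pi.single i (a i) : Fin d → ZMod L) = (a i).val • Pi.single i 1 := by
      rw [← Pi.single_smul', nsmul_one, ZMod.natCast_zmod_val]
    rw [this]
    exact nsmul_mem (h1 i) _
  refine ⟨fun x y => ?_⟩
  have := h2 (y - x) x
  rwa [add_sub_cancel] at this

theorem val_neg_one_sub [NeZero L] (a : ZMod L) : (-1 - a).val = L - 1 - a.val := by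
  have h := a.val_lt
  have h1 : (-1 - a) = ((L - 1 - a.val : ℕ) : ZMod L) := by
    rw [Nat.cast_sub (by omega), Nat.cast_sub (by omega)]
    simp
  rw [h1, ZMod.val_natCast_of_lt (by omega)]

/-- The reflection of the torus that exchanges the coordinates `c` and `c + 1` in direction `i`. -/
def torusReflection (i : Fin d) (c : ZMod L) : (Fin d → ZMod L) ≃ (Fin d → ZMod L) :=
  Function.Involutive.toPerm (fun x => Function.update x i (2 * c + 1 - x i)) fun x => by simp

theorem torusReflection_apply (i : Fin d) (c : ZMod L) (x : Fin d → ZMod L) :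
    torusReflection i c x = Function.update x i (2 * c + 1 - x i) := rfl

theorem torusReflection_torusReflection (i : Fin d) (c : ZMod L) (x : Fin d → ZMod L) :
    torusReflection i c (torusReflection i c x) = x := by
  simp [torusReflection_apply]

/-- The half of the torus on one side of the reflection planes. -/
def torusHalf [NeZero L] (i : Fin d) (c : ZMod L) : Finset (Fin d → ZMod L) :=
  {x | (x i - c - 1).val < L / 2}

/-- In the coordinate a = x_i - c - 1 the reflection is a ↦ L - 1 - a and the half is 0 ≤ a < L/2.
An edge leaves the half only from a = L/2 - 1 upwards or from a = 0 downwards, and the reflection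
exchanges the end points of such an edge. -/
theorem isReflection_torus [NeZero L] (hL : Even L) (hL2 : 2 < L) (i : Fin d) (c : ZMod L) :
    IsReflection (torus d L) (torusReflection i c) (torusHalf i c) := by
  obtain ⟨h, rfl⟩ := hL
  have hdiv : (h + h) / 2 = h := by omega
  have hh : (h : ZMod (h + h)) + h = 0 := by exact_mod_cast ZMod.natCast_self (h + h)
  have hadj : ∀ x y, (torus d (h + h)).Adj x y →
      (torus d (h + h)).Adj (torusReflection i c x) (torusReflection i c y) := by
    intro x y hxy
    rw [torus_adj_iff hL2] at hxy ⊢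
    obtain ⟨⟨j, δ⟩, rfl⟩ := hxy
    refine ⟨(j, if j = i then -δ else δ), ?_⟩
    ext l
    simp only [torusReflection_apply, Pi.add_apply]
    by_cases hl : l = i
    · subst hl
      by_cases hj : j = l
      · subst hj
        simp
        ring
      · simp [hj, Ne.symm hj]
    · by_cases hj : j = i
      · subst hj
        simp [hl]
      · simp [hl, hj]
  refine ⟨torusReflection_torusReflection i c, fun x => ?_, fun x y => ?_, fun x hx y hy hxy => ?_⟩
  · have h1 : torusReflection i c x i - c - 1 = -1 - (x i - c - 1) := by
      simp [torusReflection_apply]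
      ring
    have := (x i - c - 1).val_lt
    simp only [torusHalf, Finset.mem_filter, Finset.mem_univ, true_and, h1, val_neg_one_sub, hdiv]
    omega
  · refine ⟨fun hxy => ?_, hadj x y⟩
    have := hadj _ _ hxy
    rwa [torusReflection_torusReflection, torusReflection_torusReflection] at this
  · obtain ⟨⟨j, δ⟩, rfl⟩ := (torus_adj_iff hL2 _ _).1 hxy
    simp only [torusHalf, Finset.mem_filter, Finset.mem_univ, true_and, hdiv, Pi.add_apply] at hx hy
    by_cases hj : j = i
    swap
    · simp [Ne.symm hj, hx] at hy
    subst hj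
    have hval : ((x j - c - 1).val : ZMod (h + h)) = x j - c - 1 := ZMod.natCast_zmod_val _
    suffices h2 : x j + ((δ : ℤ) : ZMod (h + h)) = 2 * c + 1 - x j by
      ext l
      by_cases hl : l = j
      · subst hl
        simpa [torusReflection_apply] using h2
      · simp [torusReflection_apply, hl]
    generalize ha : (x j - c - 1).val = a at *
    simp only [Pi.single_eq_same] at hy
    rcases Int.units_eq_one_or δ with rfl | rfl
    · have h3 : x j + (((1 : ℤˣ) : ℤ) : ZMod (h + h)) - c - 1 = ((a + 1 : ℕ) : ZMod (h + h)) := by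
        push_cast
        rw [hval]
        ring
      rw [h3, ZMod.val_natCast_of_lt (by omega)] at hy
      have h4 : a + 1 = h := by omega
      have h5 : (a : ZMod (h + h)) + 1 = h := by exact_mod_cast congrArg (Nat.cast) h4
      push_cast
      linear_combination 2 * h5 - 2 * hval + hh
    · rcases Nat.eq_zero_or_pos a with rfl | hpos
      · push_cast
        linear_combination - 2 * hval
      · have h3 : x j + (((-1 : ℤˣ) : ℤ) : ZMod (h + h)) - c - 1 =
            ((a - 1 : ℕ) : ZMod (h + h)) := by
          rw [Nat.cast_sub hpos]
          push_cast
          rw [hval]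
          ring
        rw [h3, ZMod.val_natCast_of_lt (by omega)] at hy
        omega

theorem exists_isReflection_torus [NeZero L] (hL : Even L) (hL2 : 2 < L) (x y : Fin d → ZMod L)
    (hxy : (torus d L).Adj x y) : ∃ r H, IsReflection (torus d L) r H ∧ r x = y := by
  rw [torus, SimpleGraph.fromRel_adj] at hxy
  have h : ∀ (x : Fin d → ZMod L) i, torusReflection i (x i) x = x + Pi.single i 1 := by
    intro x i
    ext l
    by_cases hl : l = i
    · subst hl
      simp [torusReflection_apply]
      ring
    · simp [torusReflection_apply, hl]
  rcases hxy.2 with ⟨i, rfl⟩ | ⟨i, rfl⟩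
  · exact ⟨_, _, isReflection_torus hL hL2 i (x i), h x i⟩
  · refine ⟨_, _, isReflection_torus hL hL2 i (y i), ?_⟩
    rw [← h y i, torusReflection_torusReflection]

end Torus

/-! ### The Fourier transform -/

section Fourier

variable {d L : ℕ} {k : Fin d → ℝ}

/-- Representatives add up only modulo L; as k_i ∈ (2π/L)ℤ, the defect is a multiple of 2π and is
invisible to sine and cosine. -/
theorem exists_pairing_add [NeZero L] (hk : k ∈ dualTorus d L) (x y : Fin d → ZMod L) :
    ∃ N : ℤ, pairing k (x + y) = pairing k x + pairing k y + N * (2 * Real.pi) := by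
  have h : ∀ i, ∃ N : ℤ, k i * ((x i + y i).valMinAbs : ℝ) =
      k i * ((x i).valMinAbs : ℝ) + k i * ((y i).valMinAbs : ℝ) + N * (2 * Real.pi) := by
    intro i
    obtain ⟨n, hn⟩ := (hk i).1
    have h1 : (((x i + y i).valMinAbs - ((x i).valMinAbs + (y i).valMinAbs) : ℤ) : ZMod L) = 0 := by
      simp
    obtain ⟨N, hN⟩ := (ZMod.intCast_zmod_eq_zero_iff_dvd _ L).1 h1
    have hN : ((x i + y i).valMinAbs : ℝ) = (x i).valMinAbs + (y i).valMinAbs + L * N := by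
      rw [sub_eq_iff_eq_add] at hN
      rw [hN]
      push_cast
      ring
    have hL : (L : ℝ) ≠ 0 := Nat.cast_ne_zero.2 (NeZero.ne L)
    refine ⟨n * N, ?_⟩
    rw [hN, hn]
    push_cast
    field_simp
  choose N hN using h
  refine ⟨∑ i, N i, ?_⟩
  simp only [pairing, Pi.add_apply, hN, Finset.sum_add_distrib, Int.cast_sum, Finset.sum_mul]

theorem exists_pairing_single [NeZero L] (hk : k ∈ dualTorus d L) (i : Fin d) :
    ∃ N : ℤ, pairing k (Pi.single i (1 : ZMod L)) = k i + N * (2 * Real.pi) := by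
  obtain ⟨n, hn⟩ := (hk i).1
  have h1 : ((((1 : ZMod L).valMinAbs) - 1 : ℤ) : ZMod L) = 0 := by simp
  obtain ⟨N, hN⟩ := (ZMod.intCast_zmod_eq_zero_iff_dvd _ L).1 h1
  have hN : ((1 : ZMod L).valMinAbs : ℝ) = 1 + L * N := by
    rw [sub_eq_iff_eq_add'] at hN
    rw [hN]
    push_cast
    ring
  have hL : (L : ℝ) ≠ 0 := Nat.cast_ne_zero.2 (NeZero.ne L)
  refine ⟨n * N, ?_⟩
  rw [pairing, Finset.sum_eq_single i (fun j _ hj => by simp [hj]) (by simp), Pi.single_eq_same, hN,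
    hn]
  push_cast
  field_simp

variable [NeZero L] (hk : k ∈ dualTorus d L)
include hk

theorem cos_pairing_add (x y : Fin d → ZMod L) : Real.cos (pairing k (x + y)) =
    Real.cos (pairing k x) * Real.cos (pairing k y) -
      Real.sin (pairing k x) * Real.sin (pairing k y) := by
  obtain ⟨N, h⟩ := exists_pairing_add hk x y
  rw [h, Real.cos_add_int_mul_two_pi, Real.cos_add]

theorem sin_pairing_add (x y : Fin d → ZMod L) : Real.sin (pairing k (x + y)) =
    Real.sin (pairing k x) * Real.cos (pairing k y) +
      Real.cos (pairing k x) * Real.sin (pairing k y) := by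
  obtain ⟨N, h⟩ := exists_pairing_add hk x y
  rw [h, Real.sin_add_int_mul_two_pi, Real.sin_add]

theorem exists_pairing_neg (x : Fin d → ZMod L) :
    ∃ N : ℤ, pairing k (-x) = -pairing k x + N * (2 * Real.pi) := by
  obtain ⟨N, h⟩ := exists_pairing_add hk x (-x)
  refine ⟨-N, ?_⟩
  have : pairing k (0 : Fin d → ZMod L) = 0 := by simp [pairing]
  rw [add_neg_cancel, this] at h
  push_cast
  linarith

theorem cos_pairing_neg (x : Fin d → ZMod L) :
    Real.cos (pairing k (-x)) = Real.cos (pairing k x) := by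
  obtain ⟨N, h⟩ := exists_pairing_neg hk x
  rw [h, Real.cos_add_int_mul_two_pi, Real.cos_neg]

theorem sin_pairing_neg (x : Fin d → ZMod L) :
    Real.sin (pairing k (-x)) = -Real.sin (pairing k x) := by
  obtain ⟨N, h⟩ := exists_pairing_neg hk x
  rw [h, Real.sin_add_int_mul_two_pi, Real.sin_neg]

theorem cos_pairing_sub (x y : Fin d → ZMod L) : Real.cos (pairing k (x - y)) =
    Real.cos (pairing k x) * Real.cos (pairing k y) +
      Real.sin (pairing k x) * Real.sin (pairing k y) := by
  rw [sub_eq_add_neg, cos_pairing_add hk, cos_pairing_neg hk, sin_pairing_neg hk]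
  ring

theorem cos_pairing_single (i : Fin d) :
    Real.cos (pairing k (Pi.single i (1 : ZMod L))) = Real.cos (k i) := by
  obtain ⟨N, h⟩ := exists_pairing_single hk i
  rw [h, Real.cos_add_int_mul_two_pi]

open scoped Classical in
theorem laplacian_cos_pairing (hL : 2 < L) (x : Fin d → ZMod L) :
    laplacian (torus d L) (fun x => Real.cos (pairing k x)) x =
      dispersion k * Real.cos (pairing k x) := by
  rw [laplacian_torus hL, dispersion, Finset.mul_sum, Finset.sum_mul]
  refine Finset.sum_congr rfl fun i _ => ?_
  rw [sub_eq_add_neg x, cos_pairing_add hk, cos_pairing_add hk, cos_pairing_neg hk,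
    sin_pairing_neg hk, cos_pairing_single hk]
  ring

open scoped Classical in
theorem laplacian_sin_pairing (hL : 2 < L) (x : Fin d → ZMod L) :
    laplacian (torus d L) (fun x => Real.sin (pairing k x)) x =
      dispersion k * Real.sin (pairing k x) := by
  rw [laplacian_torus hL, dispersion, Finset.mul_sum, Finset.sum_mul]
  refine Finset.sum_congr rfl fun i _ => ?_
  rw [sub_eq_add_neg x, sin_pairing_add hk, sin_pairing_add hk, cos_pairing_neg hk,
    sin_pairing_neg hk, cos_pairing_single hk]
  ring

omit [NeZero L] in
theorem dispersion_pos (hk0 : k ≠ 0) : 0 < dispersion k := by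
  obtain ⟨i, hi⟩ := Function.ne_iff.1 hk0
  refine mul_pos two_pos (Finset.sum_pos' (fun j _ => by linarith [Real.cos_le_one (k j)])
    ⟨i, Finset.mem_univ i, ?_⟩)
  have h1 := (hk i).2
  have h2 : Real.cos (k i) ≠ 1 := fun h => hi
    ((Real.cos_eq_one_iff_of_lt_of_lt (by linarith [Real.pi_pos]) (by linarith [Real.pi_pos])).1 h)
  have h3 := lt_of_le_of_ne (Real.cos_le_one (k i)) h2
  linarith

end Fourier

/-! ### Symmetries of the correlation and the bound at momentum k -/

section Main

variable {d L : ℕ} [NeZero L] {β u : ℝ} {θ : ℕ}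

theorem pairCorrelation_torus_sub (hθ : 2 ≤ θ) (hβ : 0 < β) (hu0 : 0 ≤ u) (hu1 : u ≤ 1)
    (x y : Fin d → ZMod L) :
    pairCorrelation (torus d L) β u θ x y = pairCorrelation (torus d L) β u θ 0 (y - x) := by
  have h := pairCorrelation_equiv (G := torus d L) (C := Fin θ) (by simpa using hθ) hβ hu0 hu1
    (Equiv.addRight (-x)) (fun a b => torus_adj_add (-x) a b) x y
  simpa [← sub_eq_add_neg] using h.symm

theorem pairCorrelation_torus_neg (hθ : 2 ≤ θ) (hβ : 0 < β) (hu0 : 0 ≤ u) (hu1 : u ≤ 1)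
    (x : Fin d → ZMod L) :
    pairCorrelation (torus d L) β u θ 0 (-x) = pairCorrelation (torus d L) β u θ 0 x := by
  have h := pairCorrelation_equiv (G := torus d L) (C := Fin θ) (by simpa using hθ) hβ hu0 hu1
    (Equiv.neg _) torus_adj_neg 0 x
  simpa using h

theorem kappaTilde_zero (k : Fin d → ℝ) (θ : ℝ) : kappaTilde d L β u θ k 0 =
    ∑ x : Fin d → ZMod L, Complex.exp (((-pairing k x : ℝ) : ℂ) * Complex.I) *
      (pairCorrelation (torus d L) β u θ 0 x : ℂ) := by
  rw [kappaTilde]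
  refine Finset.sum_congr rfl fun x _ => ?_
  rw [intervalIntegral.integral_congr (g := fun t => Complex.exp (((-pairing k x : ℝ) : ℂ) * Complex.I) *
    (kappa d L β u θ x t : ℂ)) fun t _ => ?_, intervalIntegral.integral_const_mul,
    intervalIntegral.integral_ofReal]
  · rfl
  · simp [mul_comm]

theorem kappaTilde_zero_re (k : Fin d → ℝ) (θ : ℝ) : (kappaTilde d L β u θ k 0).re =
    ∑ x : Fin d → ZMod L, Real.cos (pairing k x) * pairCorrelation (torus d L) β u θ 0 x := by
  rw [kappaTilde_zero, Complex.re_sum]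
  refine Finset.sum_congr rfl fun x _ => ?_
  rw [Complex.re_mul_ofReal, Complex.exp_ofReal_mul_I_re, Real.cos_neg]

theorem kappaTilde_zero_im (k : Fin d → ℝ) (θ : ℝ) : (kappaTilde d L β u θ k 0).im =
    ∑ x : Fin d → ZMod L, -Real.sin (pairing k x) * pairCorrelation (torus d L) β u θ 0 x := by
  rw [kappaTilde_zero, Complex.im_sum]
  refine Finset.sum_congr rfl fun x _ => ?_
  rw [Complex.im_mul_ofReal, Complex.exp_ofReal_mul_I_im, Real.sin_neg]

theorem kappaTilde_zero_im_eq_zero (hθ : 2 ≤ θ) (hβ : 0 < β) (hu0 : 0 ≤ u) (hu1 : u ≤ 1)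
    {k : Fin d → ℝ} (hk : k ∈ dualTorus d L) : (kappaTilde d L β u θ k 0).im = 0 := by
  rw [kappaTilde_zero_im]
  have h := Equiv.sum_comp (Equiv.neg (Fin d → ZMod L)) fun x =>
    -Real.sin (pairing k x) * pairCorrelation (torus d L) β u θ 0 x
  simp only [Equiv.neg_apply, sin_pairing_neg hk, pairCorrelation_torus_neg hθ hβ hu0 hu1, neg_neg]
    at h
  simp only [neg_mul, Finset.sum_neg_distrib] at h ⊢
  linarith

/-- The bounds for cos kx and sin kx are added: cos cos + sin sin is a function of y - x, so
translation invariance makes the left side |Λ| ε² κ̃, while cos² + sin² = 1 makes the right side |Λ|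
θ ε. -/
theorem kappaTilde_zero_re_le (hL : Even L) (hL2 : 2 < L) (hθ : 2 ≤ θ) (hβ : 0 < β) (hu0 : 0 ≤ u)
    (hu1 : u ≤ 1 / 2) {k : Fin d → ℝ} (hk : k ∈ dualTorus d L) (hk0 : k ≠ 0) :
    (kappaTilde d L β u θ k 0).re ≤ θ / dispersion k := by
  classical
  have hε := dispersion_pos hk hk0
  have hu1' : u ≤ 1 := by linarith
  have h := sum_laplacian_mul_pairCorrelation_le (G := torus d L) (C := Fin θ) (by simpa using hθ)
    hβ hu0 hu1 (torus_connected hL2) (exists_isReflection_torus hL hL2)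
  have hc := h fun x => Real.cos (pairing k x)
  have hs := h fun x => Real.sin (pairing k x)
  simp only [laplacian_cos_pairing hk hL2, Fintype.card_fin] at hc
  simp only [laplacian_sin_pairing hk hL2, Fintype.card_fin] at hs
  have h1 := add_le_add hc hs
  have hl : ∀ x : Fin d → ZMod L,
      (∑ y, dispersion k * Real.cos (pairing k x) * (dispersion k * Real.cos (pairing k y)) *
        pairCorrelation (torus d L) β u θ x y) +
      (∑ y, dispersion k * Real.sin (pairing k x) * (dispersion k * Real.sin (pairing k y)) *
        pairCorrelation (torus d L) β u θ x y) =
      dispersion k ^ 2 * (kappaTilde d L β u θ k 0).re := by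
    intro x
    rw [kappaTilde_zero_re, ← Equiv.sum_comp (Equiv.subRight x) fun z =>
      Real.cos (pairing k z) * pairCorrelation (torus d L) β u θ 0 z, Finset.mul_sum,
      ← Finset.sum_add_distrib]
    refine Finset.sum_congr rfl fun y _ => ?_
    rw [pairCorrelation_torus_sub hθ hβ hu0 hu1' x y, Equiv.subRight_apply, cos_pairing_sub hk]
    ring
  have hr : (θ : ℝ) * ∑ x : Fin d → ZMod L, Real.cos (pairing k x) *
        (dispersion k * Real.cos (pairing k x)) +
      θ * ∑ x : Fin d → ZMod L, Real.sin (pairing k x) *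
        (dispersion k * Real.sin (pairing k x)) =
      Fintype.card (Fin d → ZMod L) * (θ * dispersion k) := by
    rw [← mul_add, ← Finset.sum_add_distrib, Finset.sum_congr rfl fun x _ =>
      show _ = dispersion k by linear_combination dispersion k * Real.sin_sq_add_cos_sq (pairing k x)]
    rw [Finset.sum_const, Finset.card_univ, nsmul_eq_mul]
    ring
  rw [hr, ← Finset.sum_add_distrib, Finset.sum_congr rfl fun x _ => hl x, Finset.sum_const,
    Finset.card_univ, nsmul_eq_mul] at h1
  have h2 := le_of_mul_le_mul_left h1 (by exact_mod_cast Fintype.card_pos)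
  rw [le_div_iff₀ hε]
  refine le_of_mul_le_mul_left (le_of_eq_of_le ?_ (h2.trans_eq ?_)) hε <;> ring

end Main

end RandomLoop

theorem mainTheorem11 (d L : ℕ) [NeZero L] (hL : Even L) (hL2 : 2 < L)
    (β : ℝ) (hβ : 0 < β) (u : ℝ) (hu0 : 0 ≤ u) (hu1 : u ≤ 1 / 2)
    (θ : ℕ) (hθ : 2 ≤ θ) (S : ℝ) (hS : (θ : ℝ) = 2 * S + 1)
    (k : Fin d → ℝ) (hk : k ∈ RandomLoop.dualTorus d L) (hk0 : k ≠ 0) :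
    (RandomLoop.kappaTilde d L β u θ k 0).im = 0 ∧
      (RandomLoop.kappaTilde d L β u θ k 0).re ≤ (2 * S + 1) / RandomLoop.dispersion k := by
  rw [← hS]
  exact ⟨RandomLoop.kappaTilde_zero_im_eq_zero hθ hβ hu0 (by linarith) hk,
    RandomLoop.kappaTilde_zero_re_le hL hL2 hθ hβ hu0 hu1 hk hk0⟩
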